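/- Let $k=\mathbb R$ or $k=\mathbb C$. A super algebra is a finite-dimensional $\mathbb Z_2$-graded unital associative $k$-algebra $A=A_0\oplus A_1$. It is central simple if $A\neq 0$, its only graded two-sided ideals are $0$ and $A$, and the even elements of its centre are exactly $k\cdot 1$. Let $\mathrm{Aut}(A)$ be the Lie group of even (grading-preserving) algebra automorphisms of $A$; for $\varphi\in\mathrm{Aut}(A)$ let $A_\varphi$ be the bimodule $A$ with right action twisted by $\varphi$. $A$ is Picard-surjective if every invertible finite-dimensional $\mathbb Z_2$-graded $A$-$A$-bimodule $M$ (one that has an $N$ with $M\otimes_AN\cong A\cong N\otimes_AM$) is isomorphic to $A_\varphi$ for some $\varphi\in\mathrm{Aut}(A)$; isomorphisms of bimodules are bijective even intertwiners. Let $\mathrm{AUT}(A)$ be the crossed module of Lie groups $A_0^\times\to\mathrm{Aut}(A)$, $a\mapsto(x\mapsto axa^{-1})$, with $\mathrm{Aut}(A)$ acting on $A_0^\times$ by evaluation, and let $Bk^\times\times(\mathbb Z_2)_{dis}$ be the crossed module $k^\times\to\mathbb Z_2$ with trivial homomorphism and trivial action. A weak equivalence between crossed modules of Lie groups $t_j:H_j\to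 G_j$ ($j=1,2$) is an invertible butterfly: a Lie group $K$ with Lie group homomorphisms $i_j:H_j\to K$, $p_j:K\to G_j$ such that $p_j\circ i_j=t_j$, both $H_1\xrightarrow{i_1}K\xrightarrow{p_2}G_2$ and $H_2\xrightarrow{i_2}K\xrightarrow{p_1}G_1$ are short exact sequences of Lie groups, and $i_j({}^{p_j(x)}h)=x\,i_j(h)\,x^{-1}$ for all $x\in K$, $h\in H_j$. For $\varepsilon\in\mathbb Z_2$ let $\Pi^\varepsilon A$ be $A$ for $\varepsilon=0$, and for $\varepsilon=1$ the bimodule $\Pi A$ with underlying space $A$, opposite grading, the same left action and right action $x\triangleleft b=(-1)^{|b|}xb$. Lemma. Let $A$ be a Picard-surjective central simple super algebra over $k$. (1) Let $K\subset\mathrm{Aut}(A)\times\mathbb Z_2\times\mathrm{GL}(A)$ consist of all triples $(\varphi,\varepsilon,f)$ with $f:\Pi^\varepsilon A\to A_\varphi$ an invertible even intertwiner, with componentwise composition and the submanifold Lie group structure. Then $K$, with $i_1:A_0^\times\to K$ sending $a$ to (conjugation by $a$, $0$, $x\mapsto xa^{-1}$), $i_2:k^\times\to K$ sending $\lambda$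 to $(\mathrm{id},0,\lambda\cdot\mathrm{id}_A)$, and $p_1$, $p_2$ the projections to $\mathrm{Aut}(A)$ and $\mathbb Z_2$, is a weak equivalence $\mathrm{AUT}(A)\simeq Bk^\times\times(\mathbb Z_2)_{dis}$. (2) Consequently, for every smooth manifold $X$ (finite-dimensional, Hausdorff, second countable), the weak equivalence in (1) induces a bijection $$\check H^1(X,\mathrm{AUT}(A))\;\cong\; H^1(X,\mathbb Z_2)\times\check H^2(X,k^\times).$$ Here $\check H^1(X,\Gamma)$, for a crossed module $t:H\to G$ denoted $\Gamma$, is the set of classes of cocycles on open covers $(U_\alpha)$ of $X$, i.e. of families of smooth maps $g_{\alpha\beta}:U_\alpha\cap U_\beta\to G$, $a_{\alpha\beta\gamma}:U_\alpha\cap U_\beta\cap U_\gamma\to H$ with $t(a_{\alpha\beta\gamma})g_{\beta\gamma}g_{\alpha\beta}=g_{\alpha\gamma}$ and $a_{\alpha\gamma\delta}\cdot{}^{g_{\gamma\delta}}a_{\alpha\beta\gamma}=a_{\alpha\beta\delta}\,a_{\beta\gamma\delta}$; cocycles $(g,a)$, $(g',a')$ are equivalent if over a common refinement there are smooth $h_\alpha:U_\alpha\to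 G$, $e_{\alpha\beta}:U_\alpha\cap U_\beta\to H$ with $t(e_{\alpha\beta})h_\beta g_{\alpha\beta}=g'_{\alpha\beta}h_\alpha$ and $a'_{\alpha\beta\gamma}\cdot{}^{g'_{\beta\gamma}}e_{\alpha\beta}\cdot e_{\beta\gamma}=e_{\alpha\gamma}\cdot{}^{h_\gamma}a_{\alpha\beta\gamma}$. $H^1(X,\mathbb Z_2)$ and $\check H^2(X,k^\times)$ are the Čech cohomologies of locally constant $\mathbb Z_2$-valued and of smooth $k^\times$-valued functions. The bijection sends the class of $(g,a)$ to $([\epsilon],[x])$ whenever there are smooth $\tilde g_{\alpha\beta}:U_\alpha\cap U_\beta\to K$ with $p_1(\tilde g_{\alpha\beta})=g_{\alpha\beta}$, $p_2(\tilde g_{\alpha\beta})=\epsilon_{\alpha\beta}$ and $i_2(x_{\alpha\beta\gamma})\,i_1(a_{\alpha\beta\gamma})\,\tilde g_{\beta\gamma}\,\tilde g_{\alpha\beta}=\tilde g_{\alpha\gamma}$. -/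

import Mathlib

open scoped Manifold ContDiff Topology TensorProduct

set_option linter.unusedSectionVars false
set_option linter.checkUnivs false

noncomputable section

namespace SuperAUT

open Set NormedSpace

universe u v w u₁ v₁ u₂ v₂

/-- `ρ` embeds the group `G` in the units of the Banach algebra `R`, and near `0` the elements whose
exponential lies in `G` form the complemented subspace `j(E)`. Such a `G` is a Lie group with Lie
algebra `E`, charted by translated logarithms. -/
structure IsLinearLie {G R E : Type*} [Group G] [TopologicalSpace G] [NormedRing R]
    [NormedAlgebra ℝ R] [NormedAddCommGroup E] [NormedSpace ℝ E]
    (ρ : G →* R) (j : E →L[ℝ] R) (P : R →L[ℝ] E) : Prop where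
  emb : Topology.IsEmbedding ρ
  left_inv : ∀ v, P (j v) = v
  exp_mem : ∀ᶠ T in 𝓝 (0 : R), exp T ∈ range ρ ↔ T ∈ range j

namespace IsLinearLie

variable {G R E : Type*} [Group G] [TopologicalSpace G] [NormedRing R]
    [NormedAlgebra ℝ R] [CompleteSpace R] [NormedAddCommGroup E] [NormedSpace ℝ E]
    {ρ : G →* R} {j : E →L[ℝ] R} {P : R →L[ℝ] E}

theorem exists_expChart (h : IsLinearLie ρ j P) : ∃ e : OpenPartialHomeomorph R R,
    (0 : R) ∈ e.source ∧ (∀ T, e T = exp T) ∧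
    (∀ T ∈ e.source, exp T ∈ range ρ ↔ T ∈ range j) ∧
    ContDiffOn ℝ ∞ e.symm e.target := by
  have hc : ContDiffAt ℝ ω (exp : R → R) 0 := (exp_analytic (𝕂 := ℝ) (0 : R)).contDiffAt
  have hd : HasFDerivAt (exp : R → R)
      ((ContinuousLinearEquiv.refl ℝ R : R ≃L[ℝ] R) : R →L[ℝ] R) 0 := hasFDerivAt_exp_zero
  have hne : (ω : WithTop ℕ∞) ≠ 0 := by simp
  let e₀ := hc.toOpenPartialHomeomorph exp hd hne
  have h0 : (0 : R) ∈ e₀.source := hc.mem_toOpenPartialHomeomorph_source hd hne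
  have hinv : ContDiffAt ℝ ω e₀.symm (exp 0) := hc.to_localInverse hd hne
  have hev : ∀ᶠ T in 𝓝 (0 : R), ContDiffAt ℝ ω e₀.symm (exp T) := by
    have h1 := hinv.eventually (by simp)
    exact (exp_analytic (𝕂 := ℝ) (0 : R)).continuousAt.eventually h1
  obtain ⟨U, hU, hUo, hU0⟩ := eventually_nhds_iff.1 (hev.and h.exp_mem)
  refine ⟨e₀.restrOpen U hUo, ⟨h0, hU0⟩, fun T => rfl, fun T hT => (hU T hT.2).2, ?_⟩
  intro y hy
  have hy' := (e₀.restrOpen U hUo).map_target hy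
  have hval : exp ((e₀.restrOpen U hUo).symm y) = y := (e₀.restrOpen U hUo).right_inv hy
  have := (hU _ hy'.2).1
  rw [hval] at this
  exact (this.of_le le_top).contDiffWithinAt

/-- The exponential, as a local homeomorphism near `0`. -/
def expChart (h : IsLinearLie ρ j P) : OpenPartialHomeomorph R R := h.exists_expChart.choose

theorem zero_mem (h : IsLinearLie ρ j P) : (0 : R) ∈ h.expChart.source :=
  h.exists_expChart.choose_spec.1

theorem expChart_apply (h : IsLinearLie ρ j P) (T : R) : h.expChart T = exp T :=
  h.exists_expChart.choose_spec.2.1 T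

theorem mem_range_iff (h : IsLinearLie ρ j P) {T : R} (hT : T ∈ h.expChart.source) :
    exp T ∈ range ρ ↔ T ∈ range j :=
  h.exists_expChart.choose_spec.2.2.1 T hT

theorem contDiffOn_symm (h : IsLinearLie ρ j P) :
    ContDiffOn ℝ ∞ h.expChart.symm h.expChart.target :=
  h.exists_expChart.choose_spec.2.2.2

theorem symm_mem_range (h : IsLinearLie ρ j P) {g : G} (hg : ρ g ∈ h.expChart.target) :
    j (P (h.expChart.symm (ρ g))) = h.expChart.symm (ρ g) := by
  have h1 := h.expChart.map_target hg
  have h2 : exp (h.expChart.symm (ρ g)) = ρ g := by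
    rw [← h.expChart_apply, h.expChart.right_inv hg]
  obtain ⟨v, hv⟩ := (h.mem_range_iff h1).1 ⟨g, h2.symm⟩
  rw [← hv, h.left_inv]

theorem rho_invFun (h : IsLinearLie ρ j P) {v : E} (hv : j v ∈ h.expChart.source) :
    ρ (Function.invFun ρ (exp (j v))) = exp (j v) :=
  Function.invFun_eq ((h.mem_range_iff hv).2 ⟨v, rfl⟩)

/-- The logarithmic chart at the identity. -/
def chartOne (h : IsLinearLie ρ j P) : OpenPartialHomeomorph G E where
  toFun g := P (h.expChart.symm (ρ g))
  invFun v := Function.invFun ρ (exp (j v))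
  source := ρ ⁻¹' h.expChart.target
  target := j ⁻¹' h.expChart.source
  map_source' g hg := by
    rw [mem_preimage, h.symm_mem_range hg]
    exact h.expChart.map_target hg
  map_target' v hv := by
    rw [mem_preimage, h.rho_invFun hv, ← h.expChart_apply]
    exact h.expChart.map_source hv
  left_inv' g hg := by
    apply h.emb.injective
    rw [h.symm_mem_range hg, ← h.expChart_apply, h.expChart.right_inv hg,
      Function.invFun_eq (f := ρ) ⟨g, rfl⟩]
  right_inv' v hv := by
    rw [h.rho_invFun hv, ← h.expChart_apply, h.expChart.left_inv hv, h.left_inv]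
  open_source := h.expChart.open_target.preimage h.emb.continuous
  open_target := h.expChart.open_source.preimage j.continuous
  continuousOn_toFun := P.continuous.comp_continuousOn
    (h.expChart.continuousOn_symm.comp h.emb.continuous.continuousOn fun _ hg => hg)
  continuousOn_invFun := by
    rw [h.emb.continuousOn_iff]
    refine ContinuousOn.congr (f := fun v => exp (j v))
      (Continuous.continuousOn ?_) fun v hv => h.rho_invFun hv
    exact continuous_iff_continuousAt.2 fun v =>
      ContinuousAt.comp (exp_analytic (𝕂 := ℝ) (j v)).continuousAt j.continuous.continuousAt

/-- Left translation by `g`, as a homeomorphism. -/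
def translate (h : IsLinearLie ρ j P) (g : G) : G ≃ₜ G where
  toEquiv := Equiv.mulLeft g
  continuous_toFun := by
    rw [h.emb.continuous_iff]
    have : (ρ ∘ fun x => g * x) = fun x => ρ g * ρ x := by ext; simp
    exact this ▸ continuous_const.mul h.emb.continuous
  continuous_invFun := by
    rw [h.emb.continuous_iff]
    have : (ρ ∘ fun x => g⁻¹ * x) = fun x => ρ g⁻¹ * ρ x := by ext; simp
    exact this ▸ continuous_const.mul h.emb.continuous

/-- The chart at `g`: translate to the identity and take the logarithm. -/
def chart (h : IsLinearLie ρ j P) (g : G) : OpenPartialHomeomorph G E :=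
  (h.translate g⁻¹).transOpenPartialHomeomorph h.chartOne

theorem chart_apply (h : IsLinearLie ρ j P) (g x : G) :
    h.chart g x = P (h.expChart.symm (ρ g⁻¹ * ρ x)) := by
  rw [← map_mul]; rfl

theorem mem_chart_source (h : IsLinearLie ρ j P) (g x : G) :
    x ∈ (h.chart g).source ↔ ρ g⁻¹ * ρ x ∈ h.expChart.target := by
  rw [← map_mul]; rfl

theorem rho_chart_symm (h : IsLinearLie ρ j P) (g : G) {v : E} (hv : v ∈ (h.chart g).target) :
    ρ ((h.chart g).symm v) = ρ g * exp (j v) := by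
  have hv' : j v ∈ h.expChart.source := hv
  change ρ ((g⁻¹)⁻¹ * Function.invFun ρ (exp (j v))) = _
  rw [inv_inv, map_mul, h.rho_invFun hv']

theorem self_mem (h : IsLinearLie ρ j P) (g : G) : g ∈ (h.chart g).source := by
  rw [h.mem_chart_source, ← map_mul, inv_mul_cancel, map_one, ← exp_zero, ← h.expChart_apply]
  exact h.expChart.map_source h.zero_mem

/-- The charted space structure by translated logarithmic charts. -/
@[reducible] def chartedSpace (h : IsLinearLie ρ j P) : ChartedSpace E G where
  atlas := range h.chart
  chartAt := h.chart
  mem_chart_source := h.self_mem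
  chart_mem_atlas g := ⟨g, rfl⟩

theorem isManifold (h : IsLinearLie ρ j P) :
    letI := h.chartedSpace; IsManifold 𝓘(ℝ, E) ∞ G := by
  let := h.chartedSpace
  refine isManifold_of_contDiffOn _ _ _ ?_
  rintro _ _ ⟨g, rfl⟩ ⟨g', rfl⟩
  simp only [modelWithCornersSelf_coe, modelWithCornersSelf_coe_symm, Function.comp_id,
    Function.id_comp, preimage_id, range_id, inter_univ]
  have key : ∀ v ∈ ((h.chart g).symm.trans (h.chart g')).source,
      v ∈ (h.chart g).target ∧ ρ g'⁻¹ * (ρ g * exp (j v)) ∈ h.expChart.target := by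
    intro v hv
    rw [OpenPartialHomeomorph.trans_source] at hv
    have h1 : v ∈ (h.chart g).target := hv.1
    refine ⟨h1, ?_⟩
    rw [← h.rho_chart_symm g h1]
    exact (h.mem_chart_source _ _).1 hv.2
  have hexp : ContDiff ℝ ∞ (exp : R → R) :=
    contDiff_iff_contDiffAt.2 fun x => (exp_analytic (𝕂 := ℝ) x).contDiffAt
  refine ContDiffOn.congr (f := fun v => P (h.expChart.symm (ρ g'⁻¹ * (ρ g * exp (j v))))) ?_ ?_
  · refine P.contDiff.comp_contDiffOn (h.contDiffOn_symm.comp ?_ fun v hv => (key v hv).2)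
    exact (contDiff_const.mul (contDiff_const.mul (hexp.comp j.contDiff))).contDiffOn
  · intro v hv
    rw [OpenPartialHomeomorph.coe_trans, Function.comp_apply, h.chart_apply,
      h.rho_chart_symm g (key v hv).1]

section Smooth

variable {F H M : Type*} [NormedAddCommGroup F] [NormedSpace ℝ F] [TopologicalSpace H]
  {I : ModelWithCorners ℝ F H} [TopologicalSpace M] [ChartedSpace H M]

theorem contMDiff_rho (h : IsLinearLie ρ j P) :
    letI := h.chartedSpace; ContMDiff 𝓘(ℝ, E) 𝓘(ℝ, R) ∞ ρ := by
  let := h.chartedSpace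
  have := h.isManifold
  intro g
  have hexp : ContDiff ℝ ∞ (exp : R → R) :=
    contDiff_iff_contDiffAt.2 fun x => (exp_analytic (𝕂 := ℝ) x).contDiffAt
  have h1 : ContMDiffAt 𝓘(ℝ, E) 𝓘(ℝ, E) ∞ (h.chart g) g :=
    contMDiffAt_of_mem_maximalAtlas (IsManifold.chart_mem_maximalAtlas g) (h.self_mem g)
  have h2 : ContDiff ℝ ∞ fun v => ρ g * exp (j v) :=
    contDiff_const.mul (hexp.comp j.contDiff)
  refine (h2.contMDiff.contMDiffAt.comp g h1).congr_of_eventuallyEq ?_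
  filter_upwards [(h.chart g).open_source.mem_nhds (h.self_mem g)] with x hx
  rw [Function.comp_apply, ← h.rho_chart_symm g ((h.chart g).map_source hx),
    (h.chart g).left_inv hx]

/-- A map into a linear Lie group is smooth as soon as it is smooth as a map into the ambient
algebra. -/
theorem contMDiffWithinAt_of_rho (h : IsLinearLie ρ j P) {f : M → G} {s : Set M} {x : M}
    (hf : ContMDiffWithinAt I 𝓘(ℝ, R) ∞ (fun y => ρ (f y)) s x) :
    letI := h.chartedSpace; ContMDiffWithinAt I 𝓘(ℝ, E) ∞ f s x := by
  let := h.chartedSpace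
  have := h.isManifold
  have hcont : ContinuousWithinAt f s x := h.emb.continuousWithinAt_iff.2 hf.continuousWithinAt
  rw [contMDiffWithinAt_iff_target]
  refine ⟨hcont, ?_⟩
  have e1 : (extChartAt 𝓘(ℝ, E) (f x) ∘ f) =
      fun y => P (h.expChart.symm (ρ (f x)⁻¹ * ρ (f y))) := by
    ext y
    exact h.chart_apply (f x) (f y)
  rw [e1]
  have hx : ρ (f x)⁻¹ * ρ (f x) ∈ h.expChart.target := (h.mem_chart_source _ _).1 (h.self_mem _)
  have h2 : ContDiffAt ℝ ∞ (fun T => P (h.expChart.symm (ρ (f x)⁻¹ * T))) (ρ (f x)) := by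
    refine P.contDiff.contDiffAt.comp _ (ContDiffAt.comp _
      (h.contDiffOn_symm.contDiffAt (h.expChart.open_target.mem_nhds hx)) ?_)
    exact contDiffAt_const.mul contDiffAt_id
  exact ContMDiffAt.comp_contMDiffWithinAt (f := fun y => ρ (f y)) x h2.contMDiffAt hf

theorem contMDiff_of_rho (h : IsLinearLie ρ j P) {f : M → G}
    (hf : ContMDiff I 𝓘(ℝ, R) ∞ (fun y => ρ (f y))) :
    letI := h.chartedSpace; ContMDiff I 𝓘(ℝ, E) ∞ f := by
  let := h.chartedSpace
  intro x
  exact h.contMDiffWithinAt_of_rho (hf x)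

end Smooth

theorem lieGroup (h : IsLinearLie ρ j P) :
    letI := h.chartedSpace; LieGroup 𝓘(ℝ, E) ∞ G := by
  let := h.chartedSpace
  have := h.isManifold
  refine { h.isManifold with contMDiff_mul := ?_, contMDiff_inv := ?_ }
  · refine h.contMDiff_of_rho ?_
    simp only [map_mul]
    have h1 := (h.contMDiff_rho.comp (contMDiff_fst (I := 𝓘(ℝ, E)) (J := 𝓘(ℝ, E)) (M := G) (N := G))).prodMk_space
      (h.contMDiff_rho.comp (contMDiff_snd (I := 𝓘(ℝ, E)) (J := 𝓘(ℝ, E)) (M := G) (N := G)))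
    exact (contDiff_mul (𝕜 := ℝ) (𝔸 := R)).contMDiff.comp h1
  · refine h.contMDiff_of_rho ?_
    intro g
    have e1 : (fun x : G => ρ x⁻¹) = Ring.inverse ∘ ρ := by
      ext x
      have hu : ρ x * ρ x⁻¹ = 1 := by rw [← map_mul, mul_inv_cancel, map_one]
      have hu' : ρ x⁻¹ * ρ x = 1 := by rw [← map_mul, inv_mul_cancel, map_one]
      exact (Ring.inverse_unit (⟨ρ x, ρ x⁻¹, hu, hu'⟩ : Rˣ)).symm
    rw [e1]
    have hu : ρ g * ρ g⁻¹ = 1 := by rw [← map_mul, mul_inv_cancel, map_one]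
    have hu' : ρ g⁻¹ * ρ g = 1 := by rw [← map_mul, inv_mul_cancel, map_one]
    have h3 : ContDiffAt ℝ ∞ (Ring.inverse : R → R) (ρ g) :=
      contDiffAt_ringInverse ℝ (⟨ρ g, ρ g⁻¹, hu, hu'⟩ : Rˣ)
    exact h3.contMDiffAt.comp g (h.contMDiff_rho g)

end IsLinearLie


section SuperAlg
variable {k : Type v} [RCLike k] {A : Type u} [NormedRing A] [NormedAlgebra k A]
  (𝒜 : ZMod 2 → Submodule k A)

/-- The group of even (i.e. grading-preserving) algebra automorphisms. -/
def evenAut : Subgroup (A ≃ₐ[k] A) where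
  carrier := {φ | ∀ i a, φ a ∈ 𝒜 i ↔ a ∈ 𝒜 i}
  one_mem' _ _ := Iff.rfl
  mul_mem' {φ ψ} hφ hψ i a := (hφ i (ψ a)).trans (hψ i a)
  inv_mem' {φ} hφ i a := by
    rw [← hφ i (φ⁻¹ a)]
    exact iff_of_eq (congrArg (· ∈ 𝒜 i) (φ.apply_symm_apply a))

/-- The group of even automorphisms, as a type. -/
def EvenAut : Type u := evenAut 𝒜

instance : Group (EvenAut 𝒜) := inferInstanceAs (Group (evenAut 𝒜))

/-- The even derivations of `A`: the Lie algebra of the group of even automorphisms. -/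
def evenDer : Submodule k (A →L[k] A) where
  carrier := {T | (∀ x y, T (x * y) = T x * y + x * T y) ∧ ∀ i, ∀ a ∈ 𝒜 i, T a ∈ 𝒜 i}
  zero_mem' := ⟨fun x y => by simp, fun i a _ => by simp⟩
  add_mem' {S T} hS hT := ⟨fun x y => by
    simp only [_root_.add_apply, hS.1, hT.1, add_mul, mul_add]; abel,
    fun i a ha => (𝒜 i).add_mem (hS.2 i a ha) (hT.2 i a ha)⟩
  smul_mem' c T hT := ⟨fun x y => by
    simp only [_root_.smul_apply, hT.1, smul_add, smul_mul_assoc, mul_smul_comm],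
    fun i a ha => (𝒜 i).smul_mem c (hT.2 i a ha)⟩

/-- The space of even derivations, as a type. -/
def EvenDer : Type u := evenDer 𝒜

instance : NormedAddCommGroup (EvenDer 𝒜) := inferInstanceAs (NormedAddCommGroup (evenDer 𝒜))
instance : NormedSpace k (EvenDer 𝒜) := inferInstanceAs (NormedSpace k (evenDer 𝒜))
instance : NormedSpace ℝ (EvenDer 𝒜) := NormedSpace.restrictScalars ℝ k (EvenDer 𝒜)
instance : IsScalarTower ℝ k (EvenDer 𝒜) := IsScalarTower.of_algebraMap_smul fun _ _ => rfl

variable [FiniteDimensional k A]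

instance : FiniteDimensional k (EvenDer 𝒜) := inferInstanceAs (FiniteDimensional k (evenDer 𝒜))
instance : FiniteDimensional ℝ (EvenDer 𝒜) := FiniteDimensional.trans ℝ k (EvenDer 𝒜)

variable {𝒜} in
/-- The continuous operator underlying an even automorphism. -/
def EvenAut.toCLM : EvenAut 𝒜 →* (A →L[k] A) where
  toFun φ := LinearMap.toContinuousLinearMap (φ.1 : A ≃ₐ[k] A).toLinearMap
  map_one' := rfl
  map_mul' _ _ := rfl

instance : TopologicalSpace (EvenAut 𝒜) := TopologicalSpace.induced EvenAut.toCLM inferInstance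

theorem EvenAut.isEmbedding_toCLM : Topology.IsEmbedding (EvenAut.toCLM (𝒜 := 𝒜)) where
  eq_induced := rfl
  injective _ _ h := Subtype.ext (AlgEquiv.ext fun a => congrArg (fun T : A →L[k] A => T a) h)

variable [GradedAlgebra 𝒜]

/-- The projection onto the degree `i` part. -/
def gradeProj (i : ZMod 2) : A →L[k] A := LinearMap.toContinuousLinearMap (GradedAlgebra.proj 𝒜 i)

theorem gradeProj_eq_self_iff (i : ZMod 2) (a : A) : gradeProj 𝒜 i a = a ↔ a ∈ 𝒜 i := by
  change ((DirectSum.decompose 𝒜 a i : 𝒜 i) : A) = a ↔ _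
  exact ⟨fun h => h ▸ SetLike.coe_mem _, fun h => DirectSum.decompose_of_mem_same 𝒜 h⟩

theorem even_iff_commute (T : A →L[k] A) :
    (∀ i, ∀ a ∈ 𝒜 i, T a ∈ 𝒜 i) ↔ ∀ i, Commute T (gradeProj 𝒜 i) := by
  constructor
  · intro h i
    ext a
    change T (gradeProj 𝒜 i a) = gradeProj 𝒜 i (T a)
    induction a using DirectSum.Decomposition.inductionOn 𝒜 with
    | zero => simp
    | @homogeneous l m =>
      change T ((DirectSum.decompose 𝒜 (m : A) i : 𝒜 i) : A) =
        ((DirectSum.decompose 𝒜 (T m) i : 𝒜 i) : A)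
      by_cases hl : l = i
      · subst hl
        rw [DirectSum.decompose_of_mem_same 𝒜 m.2, DirectSum.decompose_of_mem_same 𝒜 (h _ _ m.2)]
      · rw [DirectSum.decompose_of_mem_ne 𝒜 m.2 hl, DirectSum.decompose_of_mem_ne 𝒜 (h _ _ m.2) hl,
          map_zero]
    | add x y hx hy => simp only [map_add, hx, hy]
  · intro h i a ha
    rw [← gradeProj_eq_self_iff] at ha ⊢
    have := congrArg (fun S : A →L[k] A => S a) (h i).eq
    change T (gradeProj 𝒜 i a) = gradeProj 𝒜 i (T a) at this
    rw [← this, ha]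

theorem commute_of_commute_exp : ∀ᶠ T in 𝓝 (0 : A →L[k] A), ∀ i,
    Commute (exp T) (gradeProj 𝒜 i) → Commute T (gradeProj 𝒜 i) := by
  have := FiniteDimensional.complete k A
  obtain ⟨s, hs, hinj⟩ : ∃ s ∈ 𝓝 (0 : A →L[k] A), InjOn (exp : (A →L[k] A) → (A →L[k] A)) s := by
    have hd : HasStrictFDerivAt (exp : (A →L[k] A) → (A →L[k] A))
      ((ContinuousLinearEquiv.refl k (A →L[k] A) : _ ≃L[k] _) : (A →L[k] A) →L[k] (A →L[k] A)) 0 :=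
      hasStrictFDerivAt_exp_zero
    exact ⟨_, (hd.toOpenPartialHomeomorph _).open_source.mem_nhds
      hd.mem_toOpenPartialHomeomorph_source, (hd.toOpenPartialHomeomorph _).injOn⟩
  rw [Filter.eventually_all]
  intro i
  set p := gradeProj 𝒜 i with hp
  have hpp : p * p = p := by
    ext a
    exact (gradeProj_eq_self_iff 𝒜 i _).2 (SetLike.coe_mem (DirectSum.decompose 𝒜 a i))
  have hw : (1 - (p + p)) * (1 - (p + p)) = 1 := by
    simp only [sub_mul, mul_sub, mul_add, add_mul, one_mul, mul_one, hpp]; abel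
  let w : (A →L[k] A)ˣ := ⟨1 - (p + p), 1 - (p + p), hw, hw⟩
  have hcont : Continuous fun T : A →L[k] A => (w : A →L[k] A) * T * ((w⁻¹ : (A →L[k] A)ˣ) : A →L[k] A) := by
    fun_prop
  have h2 : ∀ᶠ T in 𝓝 (0 : A →L[k] A), (w : A →L[k] A) * T * ((w⁻¹ : (A →L[k] A)ˣ) : A →L[k] A) ∈ s :=
    (hcont.tendsto' 0 0 (by simp)).eventually hs
  filter_upwards [hs, h2] with T hT hT2 hc
  have e1 : exp ((w : A →L[k] A) * T * ((w⁻¹ : (A →L[k] A)ˣ) : A →L[k] A)) = exp T := by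
    let : NormedAlgebra ℚ (A →L[k] A) := NormedAlgebra.restrictScalars ℚ k _
    rw [exp_units_conj]
    have hcw : Commute (exp T) (w : A →L[k] A) :=
      (Commute.one_right _).sub_right (hc.add_right hc)
    rw [← hcw.eq, mul_assoc, Units.mul_inv, mul_one]
  have e2 := hinj hT2 hT e1
  have e3 : (w : A →L[k] A) * T = T * w := by
    rw [← Units.mul_inv_eq_iff_eq_mul]; exact e2
  have e4 : (1 - (p + p)) * T = T * (1 - (p + p)) := e3
  have e5 : (2 : k) • (T * p) = (2 : k) • (p * T) := by
    rw [two_smul k (T * p), two_smul k (p * T)]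
    have h1 : (1 - (p + p)) * T = T - (p * T + p * T) := by
      rw [sub_mul, add_mul, one_mul]
    have h2 : T * (1 - (p + p)) = T - (T * p + T * p) := by
      rw [mul_sub, mul_add, mul_one]
    rw [h1, h2] at e4
    exact (sub_right_injective e4).symm
  exact smul_right_injective _ (two_ne_zero (α := k)) e5

/-- The failure of `T` to be a derivation. -/
def derDefect (T : A →L[k] A) : A →L[k] A →L[k] A :=
  (ContinuousLinearMap.compL k A A A T).comp (ContinuousLinearMap.mul k A)
    - (ContinuousLinearMap.mul k A).comp T
    - ((ContinuousLinearMap.compL k A A A).flip T).comp (ContinuousLinearMap.mul k A)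

theorem derDefect_apply (T : A →L[k] A) (x y : A) :
    derDefect T x y = T (x * y) - T x * y - x * T y := by
  simp [derDefect]

theorem hasDerivAt_conj_mul (T : A →L[k] A) (x y : A) (t : k) :
    HasDerivAt (fun t : k => exp (t • T) ((exp (-t • T) x) * (exp (-t • T) y)))
      (exp (t • T) (derDefect T (exp (-t • T) x) (exp (-t • T) y))) t := by
  have := FiniteDimensional.complete k A
  have h1 := hasDerivAt_exp_smul_const (𝕂 := k) T t
  have h2 : HasDerivAt (fun t : k => exp (-t • T)) (-(T * exp (-t • T))) t := by
    have h := (hasDerivAt_exp_smul_const' (𝕂 := k) T (-t)).scomp t (hasDerivAt_neg t)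
    exact h.congr_deriv (by rw [neg_smul, one_smul])
  have hx := h2.clm_apply (hasDerivAt_const t x)
  have hy := h2.clm_apply (hasDerivAt_const t y)
  have := h1.clm_apply (hx.mul hy)
  refine this.congr_deriv ?_
  rw [derDefect_apply]
  simp
  abel

theorem exp_smul_mul_exp_neg (T : A →L[k] A) : exp T * exp (-T) = 1 ∧ exp (-T) * exp T = 1 := by
  have := FiniteDimensional.complete k A
  let : NormedAlgebra ℚ (A →L[k] A) := NormedAlgebra.restrictScalars ℚ k _
  have h1 : Commute T (-T) := (Commute.refl T).neg_right
  refine ⟨?_, ?_⟩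
  · rw [← exp_add_of_commute h1]; simp
  · rw [← exp_add_of_commute h1.symm]; simp

theorem conj_mul_bound (T : A →L[k] A) (x y : A) (C : ℝ)
    (hC : ∀ t : k, ‖t‖ ≤ 1 →
      ‖exp (t • T) (derDefect T (exp (-t • T) x) (exp (-t • T) y)) - derDefect T x y‖ ≤ C) :
    ‖exp T ((exp (-T) x) * (exp (-T) y)) - derDefect T x y - x * y‖ ≤ C := by
  have key := Convex.norm_image_sub_le_of_norm_hasDerivWithin_le (𝕜 := k) (C := C)
    (f := fun t : k => exp (t • T) ((exp (-t • T) x) * (exp (-t • T) y)) - t • derDefect T x y)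
    (f' := fun t => exp (t • T) (derDefect T (exp (-t • T) x) (exp (-t • T) y)) - derDefect T x y)
    (s := Metric.closedBall 0 1) (x := 0) (y := 1)
    (fun t _ => by
      have h := ((hasDerivAt_conj_mul T x y t).sub
        ((hasDerivAt_id t).smul_const (derDefect T x y)))
      simp only [one_smul] at h
      exact h.hasDerivWithinAt)
    (fun t ht => hC t (by simpa using ht)) (convex_closedBall _ _) (by simp) (by simp)
  have e1 : (-1 : k) • T = -T := by rw [neg_smul (1 : k) T, one_smul]
  simp only [neg_zero, zero_smul k T, one_smul k, e1, exp_zero, sub_zero, norm_one, mul_one,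
    zero_smul k (derDefect T x y)] at key
  exact key

/-- The exponential of a derivation is multiplicative. -/
theorem exp_map_mul {T : A →L[k] A} (h : ∀ x y, T (x * y) = T x * y + x * T y) (x y : A) :
    exp T (x * y) = exp T x * exp T y := by
  have h0 : derDefect T = 0 := by
    ext x y; simp [derDefect_apply, h]
  have := conj_mul_bound T (exp T x) (exp T y) 0 (by simp [h0])
  have h1 : ∀ z, exp (-T) (exp T z) = z := fun z =>
    congrArg (fun S : A →L[k] A => S z) (exp_smul_mul_exp_neg T).2
  rw [h0, h1, h1] at this
  have := norm_le_zero_iff.1 this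
  simpa [sub_eq_zero] using this

/-- A small operator whose exponential is multiplicative is a derivation. -/
theorem derivation_of_exp_map_mul : ∀ᶠ T in 𝓝 (0 : A →L[k] A),
    (∀ x y : A, (exp T : A →L[k] A) (x * y) = (exp T : A →L[k] A) x * (exp T : A →L[k] A) y) → ∀ x y, T (x * y) = T x * y + x * T y := by
  have := FiniteDimensional.complete k A
  have hc : Filter.Tendsto (fun T : A →L[k] A => exp T - 1) (𝓝 0) (𝓝 0) := by
    have := ((exp_analytic (𝕂 := k) (0 : A →L[k] A)).continuousAt.sub_const 1)
    simpa [ContinuousAt] using this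
  obtain ⟨δ, hδ, hball⟩ := Metric.eventually_nhds_iff.1 (hc.eventually (Metric.ball_mem_nhds 0
    (show (0 : ℝ) < 1 / 10 by norm_num)))
  have hsmall : ∀ T : A →L[k] A, ‖T‖ < δ → ∀ x, ‖exp T x - x‖ ≤ 1 / 10 * ‖x‖ := by
    intro T hT x
    have h1 := hball (y := T) (by simpa using hT)
    have h2 : ‖exp T - 1‖ ≤ 1 / 10 := by
      rw [← dist_zero_right]; exact h1.le
    exact ((exp T - 1).le_opNorm x).trans (mul_le_mul_of_nonneg_right h2 (norm_nonneg x))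
  refine Metric.eventually_nhds_iff.2 ⟨δ, hδ, fun T hT hmul => ?_⟩
  have hT : ‖T‖ < δ := by simpa using hT
  set D := derDefect T with hD
  have h1 : ∀ z, exp T (exp (-T) z) = z := fun z =>
    congrArg (fun S : A →L[k] A => S z) (exp_smul_mul_exp_neg T).1
  have hbd : ‖D‖ ≤ 1 / 2 * ‖D‖ := by
    refine ContinuousLinearMap.opNorm_le_bound₂ _ (by positivity) fun x y => ?_
    have := conj_mul_bound T x y (1 / 2 * ‖D‖ * ‖x‖ * ‖y‖) ?_
    · rw [hmul, h1, h1] at this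
      simpa using this
    intro t ht
    have hs : ‖t • T‖ < δ := by
      rw [norm_smul]
      nlinarith [norm_nonneg T]
    have hs' : ‖-t • T‖ < δ := by
      rw [neg_smul t T, norm_neg]; exact hs
    set u := exp (-t • T) x
    set v := exp (-t • T) y
    have hu := hsmall _ hs' x
    have hv := hsmall _ hs' y
    have hu2 : ‖u‖ ≤ 11 / 10 * ‖x‖ := by
      have := norm_add_le (u - x) x
      rw [sub_add_cancel] at this; linarith
    have hv2 : ‖v‖ ≤ 11 / 10 * ‖y‖ := by
      have := norm_add_le (v - y) y
      rw [sub_add_cancel] at this; linarith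
    have hw := hsmall _ hs (D u v)
    have e1 : exp (t • T) (D u v) - D x y =
        (exp (t • T) (D u v) - D u v) + (D (u - x) v + D x (v - y)) := by
      simp only [map_sub, _root_.sub_apply]; abel
    rw [e1]
    have b0 := D.le_opNorm₂ u v
    have b1 := D.le_opNorm₂ (u - x) v
    have b2 := D.le_opNorm₂ x (v - y)
    have c0 : ‖D‖ * ‖u‖ * ‖v‖ ≤ ‖D‖ * (11 / 10 * ‖x‖) * (11 / 10 * ‖y‖) := by gcongr
    have c1 : ‖D‖ * ‖u - x‖ * ‖v‖ ≤ ‖D‖ * (1 / 10 * ‖x‖) * (11 / 10 * ‖y‖) := by gcongr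
    have c2 : ‖D‖ * ‖x‖ * ‖v - y‖ ≤ ‖D‖ * ‖x‖ * (1 / 10 * ‖y‖) := by gcongr
    have hpos : 0 ≤ ‖D‖ * ‖x‖ * ‖y‖ := by positivity
    calc _ ≤ ‖exp (t • T) (D u v) - D u v‖ + (‖D (u - x) v‖ + ‖D x (v - y)‖) :=
          (norm_add_le _ _).trans (add_le_add le_rfl (norm_add_le _ _))
      _ ≤ _ := by nlinarith
  have hD0 : D = 0 := by
    have h0 : ‖D‖ ≤ 0 := by linarith
    ext x y
    have h1 := D.le_opNorm₂ x y
    have h2 : ‖D‖ * ‖x‖ * ‖y‖ ≤ 0 := by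
      rw [mul_assoc]; exact mul_nonpos_of_nonpos_of_nonneg h0 (by positivity)
    exact norm_le_zero_iff.1 (h1.trans h2)
  intro x y
  have := derDefect_apply T x y
  rw [← hD, hD0] at this
  simp only [_root_.zero_apply] at this
  rw [sub_sub, eq_comm, sub_eq_zero] at this
  exact this

/-- `exp T`, for `T` near `0`, is an even automorphism exactly when `T` is an even derivation. -/
theorem exp_mem_range_iff : ∀ᶠ T in 𝓝 (0 : A →L[k] A),
    exp T ∈ range (EvenAut.toCLM (𝒜 := 𝒜)) ↔ T ∈ evenDer 𝒜 := by
  filter_upwards [derivation_of_exp_map_mul (k := k) (A := A), commute_of_commute_exp 𝒜] with T h1 h2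
  constructor
  · rintro ⟨φ, hφ⟩
    have hφ' : ∀ a, φ.1 a = exp T a := fun a => congrArg (fun S : A →L[k] A => S a) hφ
    refine ⟨h1 fun x y => ?_, ?_⟩
    · simp only [← hφ', map_mul]
    · rw [even_iff_commute]
      refine fun i => h2 i ((even_iff_commute 𝒜 _).1 (fun i a ha => ?_) i)
      rw [← hφ']
      exact (φ.2 i a).2 ha
  · rintro ⟨hd, he⟩
    have hc := (even_iff_commute 𝒜 T).1 he
    have hmul := exp_map_mul hd
    have i1 : ∀ z, exp T (exp (-T) z) = z := fun z =>
      congrArg (fun S : A →L[k] A => S z) (exp_smul_mul_exp_neg T).1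
    have i2 : ∀ z, exp (-T) (exp T z) = z := fun z =>
      congrArg (fun S : A →L[k] A => S z) (exp_smul_mul_exp_neg T).2
    let L : A ≃ₗ[k] A :=
      { (exp T : A →L[k] A).toLinearMap with
        invFun := fun z => (exp (-T) : A →L[k] A) z
        left_inv := i2
        right_inv := i1 }
    have hone : exp T (1 : A) = 1 := by
      have := hmul 1 (exp (-T) 1)
      rwa [one_mul, i1, mul_one, eq_comm] at this
    let φ : A ≃ₐ[k] A := AlgEquiv.ofLinearEquiv L hone hmul
    have hce : ∀ i, Commute (exp T) (gradeProj 𝒜 i) := fun i => (hc i).exp_left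
    refine ⟨⟨φ, fun i a => ?_⟩, rfl⟩
    change exp T a ∈ 𝒜 i ↔ _
    rw [← gradeProj_eq_self_iff, ← gradeProj_eq_self_iff]
    have := congrArg (fun S : A →L[k] A => S a) (hce i).eq
    change exp T (gradeProj 𝒜 i a) = gradeProj 𝒜 i (exp T a) at this
    rw [← this]
    exact ⟨fun h => by rw [← i2 (gradeProj 𝒜 i a), h, i2], fun h => by rw [h]⟩



end SuperAlg

section EvenAutLie

variable {k : Type v} [RCLike k] {A : Type u} [NormedRing A] [NormedAlgebra k A]
  [FiniteDimensional k A] (𝒜 : ZMod 2 → Submodule k A)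

/-- The operator algebra `A →L[k] A`, as a real normed algebra. -/
@[reducible] def opAlgebra (k : Type v) [RCLike k] (A : Type u) [NormedRing A] [NormedAlgebra k A] :
    NormedAlgebra ℝ (A →L[k] A) := NormedAlgebra.restrictScalars ℝ k (A →L[k] A)

attribute [local instance] opAlgebra

theorem tower_op (k : Type v) [RCLike k] (A : Type u) [NormedRing A] [NormedAlgebra k A] :
    IsScalarTower ℝ k (A →L[k] A) := IsScalarTower.of_algebraMap_smul fun _ _ => rfl

/-- The inclusion of the even derivations. -/
def EvenDer.incl : EvenDer 𝒜 →L[ℝ] (A →L[k] A) :=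
  { toFun := fun T => T.1
    map_add' := fun _ _ => rfl
    map_smul' := fun _ _ => rfl
    cont := continuous_subtype_val }

theorem EvenDer.exists_leftInverse : ∃ P : (A →L[k] A) →L[ℝ] EvenDer 𝒜,
    ∀ v, P (EvenDer.incl 𝒜 v) = v := by
  obtain ⟨g, hg⟩ := Submodule.ClosedComplemented.of_finiteDimensional (evenDer 𝒜)
  let g' : (A →L[k] A) →L[k] EvenDer 𝒜 := g
  exact ⟨{ toFun := g'
           map_add' := g'.map_add
           map_smul' := fun r x => g'.map_smul (algebraMap ℝ k r) x
           cont := g'.cont }, hg⟩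

variable [GradedAlgebra 𝒜]

theorem EvenAut.isLinearLie : IsLinearLie (EvenAut.toCLM (𝒜 := 𝒜)) (EvenDer.incl 𝒜)
    (EvenDer.exists_leftInverse 𝒜).choose where
  emb := EvenAut.isEmbedding_toCLM 𝒜
  left_inv := (EvenDer.exists_leftInverse 𝒜).choose_spec
  exp_mem := by
    filter_upwards [exp_mem_range_iff 𝒜] with T hT
    rw [hT]
    exact ⟨fun h => ⟨⟨T, h⟩, rfl⟩, fun ⟨v, hv⟩ => hv ▸ v.2⟩

theorem complete_op (k : Type v) [RCLike k] (A : Type u) [NormedRing A] [NormedAlgebra k A]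
    [FiniteDimensional k A] : CompleteSpace (A →L[k] A) :=
  FiniteDimensional.complete k (A →L[k] A)

attribute [local instance] complete_op

instance : ChartedSpace (EvenDer 𝒜) (EvenAut 𝒜) := (EvenAut.isLinearLie 𝒜).chartedSpace

instance : LieGroup 𝓘(ℝ, EvenDer 𝒜) ∞ (EvenAut 𝒜) := (EvenAut.isLinearLie 𝒜).lieGroup

theorem EvenAut.contMDiff_toCLM :
    ContMDiff 𝓘(ℝ, EvenDer 𝒜) 𝓘(ℝ, A →L[k] A) ∞ (EvenAut.toCLM (𝒜 := 𝒜)) :=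
  (EvenAut.isLinearLie 𝒜).contMDiff_rho

instance : T2Space (EvenAut 𝒜) := (EvenAut.isEmbedding_toCLM 𝒜).t2Space

instance : SecondCountableTopology (EvenAut 𝒜) := by
  have : ProperSpace (A →L[k] A) := FiniteDimensional.proper k _
  exact (EvenAut.isEmbedding_toCLM 𝒜).secondCountableTopology

end EvenAutLie

section EvenPart

variable {k : Type v} [RCLike k] {A : Type u} [NormedRing A] [NormedAlgebra k A]
  (𝒜 : ZMod 2 → Submodule k A) [GradedAlgebra 𝒜]

/-- The even part `A_0`, as an algebra. -/
def EvenPart : Type u := SetLike.GradeZero.subalgebra 𝒜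

instance : NormedRing (EvenPart 𝒜) := inferInstanceAs (NormedRing (SetLike.GradeZero.subalgebra 𝒜))

instance : NormedAlgebra k (EvenPart 𝒜) :=
  inferInstanceAs (NormedAlgebra k (SetLike.GradeZero.subalgebra 𝒜))

instance : NormedAlgebra ℝ (EvenPart 𝒜) := NormedAlgebra.restrictScalars ℝ k (EvenPart 𝒜)

instance : IsScalarTower ℝ k (EvenPart 𝒜) := IsScalarTower.of_algebraMap_smul fun _ _ => rfl

variable [FiniteDimensional k A]

instance : FiniteDimensional k (EvenPart 𝒜) :=
  inferInstanceAs (FiniteDimensional k (SetLike.GradeZero.subalgebra 𝒜).toSubmodule)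

instance : FiniteDimensional ℝ (EvenPart 𝒜) := FiniteDimensional.trans ℝ k (EvenPart 𝒜)

instance : CompleteSpace (EvenPart 𝒜) := FiniteDimensional.complete k (EvenPart 𝒜)

instance : SecondCountableTopology (EvenPart 𝒜)ˣ := by
  have : ProperSpace (EvenPart 𝒜) := FiniteDimensional.proper k _
  exact Units.isOpenEmbedding_val.toIsEmbedding.secondCountableTopology

end EvenPart

/-- A finite-dimensional, Hausdorff, second countable Lie group. -/
structure LieGrp where
  carrier : Type u
  model : Type u
  [group : Group carrier]
  [top : TopologicalSpace carrier]
  [normed : NormedAddCommGroup model]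
  [space : NormedSpace ℝ model]
  [finDim : FiniteDimensional ℝ model]
  [charted : ChartedSpace model carrier]
  [lie : LieGroup 𝓘(ℝ, model) ∞ carrier]
  [t2 : T2Space carrier]
  [sct : SecondCountableTopology carrier]

namespace LieGrp

instance : CoeSort LieGrp.{u} (Type u) := ⟨carrier⟩

attribute [instance] group top normed space finDim charted lie t2 sct

/-- The model with corners of a Lie group. -/
abbrev I (G : LieGrp.{u}) : ModelWithCorners ℝ G.model G.model := 𝓘(ℝ, G.model)

end LieGrp

/-- The discrete group `ℤ/2`, written multiplicatively. -/
def Z2 : Type := Multiplicative (ZMod 2)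

namespace Z2

instance : CommGroup Z2 := inferInstanceAs (CommGroup (Multiplicative (ZMod 2)))

instance : Finite Z2 := inferInstanceAs (Finite (ZMod 2))

instance : TopologicalSpace Z2 := ⊥

instance : DiscreteTopology Z2 := ⟨rfl⟩

instance : ChartedSpace PUnit.{1} Z2 := ChartedSpace.ofDiscreteTopology

instance : LieGroup 𝓘(ℝ, PUnit.{1}) ∞ Z2 where
  toIsManifold := IsManifold.of_discreteTopology ∞
  contMDiff_mul := by
    have : DiscreteTopology (ModelProd PUnit.{1} PUnit.{1}) :=
      inferInstanceAs (DiscreteTopology (PUnit.{1} × PUnit.{1}))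
    exact contMDiff_of_discreteTopology
  contMDiff_inv := contMDiff_of_discreteTopology

/-- The residue class of an element of `Z2`. -/
def val (x : Z2) : ZMod 2 := Multiplicative.toAdd x

end Z2

/-- A crossed module of Lie groups `t : H → G`, with `G` acting on `H`. -/
structure LieCrossedModule where
  H : LieGrp.{u}
  G : LieGrp.{v}
  t : H →* G
  act : G →* MulAut H
  smooth_t : ContMDiff H.I G.I ∞ t
  smooth_act : ContMDiff (G.I.prod H.I) H.I ∞ fun p : G × H => act p.1 p.2
  t_act : ∀ (g : G) (h : H), t (act g h) = g * t h * g⁻¹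
  act_t : ∀ h x : H, act (t h) x = h * x * h⁻¹

/-- The trivial crossed module `B → Q` of an abelian Lie group `B` and a Lie group `Q`: the
homomorphism is trivial and so is the action. It is the product of `B` placed in degree one with
`Q` regarded as a discrete category. -/
def trivialCM (B : LieGrp.{u}) (Q : LieGrp.{v}) (hB : ∀ x y : B, x * y = y * x) :
    LieCrossedModule.{u, v} where
  H := B
  G := Q
  t := 1
  act := 1
  smooth_t := contMDiff_const
  smooth_act := contMDiff_snd
  t_act g h := by simp
  act_t h x := by
    change x = h * x * h⁻¹
    rw [hB h x, mul_inv_cancel_right]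

/-- The Lie group `kˣ`. -/
def unitsLieGrp (k : Type v) [RCLike k] : LieGrp.{v} :=
  have : CompleteSpace k := inferInstance
  have : SecondCountableTopology kˣ := by
    have : ProperSpace k := inferInstance
    exact Units.isOpenEmbedding_val.toIsEmbedding.secondCountableTopology
  have : FiniteDimensional ℝ k := inferInstance
  { carrier := kˣ
    model := k }

/-- The discrete Lie group `ℤ/2`. -/
def z2LieGrp : LieGrp.{0} where
  carrier := Z2
  model := PUnit.{1}

/-- The crossed module `Bkˣ × (ℤ/2)_dis`, i.e. `0 : kˣ → ℤ/2` with the trivial action. -/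
def unitsZ2 (k : Type v) [RCLike k] : LieCrossedModule.{v, 0} :=
  trivialCM (unitsLieGrp k) z2LieGrp fun x y => mul_comm (G := kˣ) x y

section AUT

variable {k : Type v} [RCLike k] {A : Type u} [NormedRing A] [NormedAlgebra k A]
  [FiniteDimensional k A] (𝒜 : ZMod 2 → Submodule k A) [GradedAlgebra 𝒜]

attribute [local instance] opAlgebra complete_op

/-- The Lie group `Aut(A)` of even automorphisms of `A`. -/
def autLieGrp : LieGrp.{u} where
  carrier := EvenAut 𝒜
  model := EvenDer 𝒜

/-- The Lie group of even units of `A`. -/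
def evenUnitsLieGrp : LieGrp.{u} where
  carrier := (EvenPart 𝒜)ˣ
  model := EvenPart 𝒜

variable {𝒜} in
/-- The unit of `A` underlying an even unit. -/
def toUnit : (EvenPart 𝒜)ˣ →* Aˣ := Units.map (SetLike.GradeZero.subalgebra 𝒜).val.toMonoidHom

theorem toUnit_mem (a : (EvenPart 𝒜)ˣ) : ((toUnit a : Aˣ) : A) ∈ 𝒜 0 := a.1.2

theorem toUnit_inv_mem (a : (EvenPart 𝒜)ˣ) : (((toUnit a)⁻¹ : Aˣ) : A) ∈ 𝒜 0 := by
  rw [← map_inv]; exact toUnit_mem 𝒜 a⁻¹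

variable {𝒜} in
/-- Conjugation of `A` by an even unit. -/
def conjAut : (EvenPart 𝒜)ˣ →* EvenAut 𝒜 where
  toFun a := ⟨
    { toFun := fun x => (toUnit a : Aˣ) * x * ((toUnit a)⁻¹ : Aˣ)
      invFun := fun x => ((toUnit a)⁻¹ : Aˣ) * x * (toUnit a : Aˣ)
      left_inv := fun x => by simp [mul_assoc]
      right_inv := fun x => by simp [mul_assoc]
      map_mul' := fun x y => by simp [mul_assoc]
      map_add' := fun x y => by simp [mul_add, add_mul]
      commutes' := fun r => by
        rw [← Algebra.commutes, mul_assoc, Units.mul_inv, mul_one] }, fun i x => by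
    have key : ∀ u w : A, u ∈ 𝒜 0 → w ∈ 𝒜 0 → ∀ y ∈ 𝒜 i, u * y * w ∈ 𝒜 i := by
      intro u w hu hw y hy
      have := SetLike.mul_mem_graded (SetLike.mul_mem_graded hu hy) hw
      simpa using this
    constructor
    · intro h
      have := key _ _ (toUnit_inv_mem 𝒜 a) (toUnit_mem 𝒜 a) _ h
      change ((toUnit a)⁻¹ : Aˣ) * ((toUnit a : Aˣ) * x * ((toUnit a)⁻¹ : Aˣ)) * (toUnit a : Aˣ)
        ∈ 𝒜 i at this
      simpa [mul_assoc] using this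
    · exact key _ _ (toUnit_mem 𝒜 a) (toUnit_inv_mem 𝒜 a) x⟩
  map_one' := Subtype.ext (AlgEquiv.ext fun x => by
    change ((toUnit 1 : Aˣ) : A) * x * ((toUnit 1)⁻¹ : Aˣ) = x
    simp)
  map_mul' a b := Subtype.ext (AlgEquiv.ext fun x => by
    change ((toUnit (a * b) : Aˣ) : A) * x * ((toUnit (a * b))⁻¹ : Aˣ) =
      (toUnit a : Aˣ) * ((toUnit b : Aˣ) * x * ((toUnit b)⁻¹ : Aˣ)) * ((toUnit a)⁻¹ : Aˣ)
    simp [mul_assoc])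

theorem conjAut_apply (a : (EvenPart 𝒜)ˣ) (x : A) :
    (conjAut a).1 x = (toUnit a : Aˣ) * x * ((toUnit a)⁻¹ : Aˣ) := rfl

variable {𝒜} in
/-- An even automorphism restricts to the even part. -/
def evenRestrict : EvenAut 𝒜 →* (EvenPart 𝒜 ≃* EvenPart 𝒜) where
  toFun φ :=
    { toFun := fun x => ⟨φ.1 x.1, (φ.2 0 x.1).2 x.2⟩
      invFun := fun x => ⟨φ.1.symm x.1, (φ.2 0 _).1 (by rw [φ.1.apply_symm_apply]; exact x.2)⟩
      left_inv := fun x => Subtype.ext (φ.1.symm_apply_apply x.1)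
      right_inv := fun x => Subtype.ext (φ.1.apply_symm_apply x.1)
      map_mul' := fun x y => Subtype.ext (map_mul φ.1 x.1 y.1) }
  map_one' := rfl
  map_mul' _ _ := rfl

variable {𝒜} in
/-- Even automorphisms act on the even units by evaluation. -/
def evalAct : EvenAut 𝒜 →* MulAut (EvenPart 𝒜)ˣ where
  toFun φ := Units.mapEquiv (evenRestrict φ)
  map_one' := rfl
  map_mul' _ _ := rfl

theorem toUnit_evalAct (φ : EvenAut 𝒜) (a : (EvenPart 𝒜)ˣ) :
    ((toUnit (evalAct φ a) : Aˣ) : A) = φ.1 (toUnit a : Aˣ) := rfl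

/-- The inclusion of the even part. -/
def evenIncl : EvenPart 𝒜 →L[k] A := (SetLike.GradeZero.subalgebra 𝒜).toSubmodule.subtypeL

theorem contMDiff_conjAut :
    ContMDiff 𝓘(ℝ, EvenPart 𝒜) 𝓘(ℝ, EvenDer 𝒜) ∞ (conjAut (𝒜 := 𝒜)) := by
  refine (EvenAut.isLinearLie 𝒜).contMDiff_of_rho ?_
  have hT := tower_op k A
  have h1 : ContDiff k ∞ fun p : EvenPart 𝒜 × EvenPart 𝒜 =>
      (ContinuousLinearMap.mul k A (evenIncl 𝒜 p.1)) *
        ((ContinuousLinearMap.mul k A).flip (evenIncl 𝒜 p.2)) := by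
    refine ContDiff.mul ?_ ?_
    · exact (ContinuousLinearMap.contDiff _).comp ((evenIncl 𝒜).contDiff.comp contDiff_fst)
    · exact (ContinuousLinearMap.contDiff _).comp ((evenIncl 𝒜).contDiff.comp contDiff_snd)
  have h2 := (h1.restrict_scalars ℝ).contMDiff
  have hv : ContMDiff 𝓘(ℝ, EvenPart 𝒜) 𝓘(ℝ, EvenPart 𝒜) ∞ (Units.val : (EvenPart 𝒜)ˣ → _) :=
    Units.contMDiff_val
  have hi : ContMDiff 𝓘(ℝ, EvenPart 𝒜) 𝓘(ℝ, EvenPart 𝒜) ∞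
      (fun a : (EvenPart 𝒜)ˣ => ((a⁻¹ : (EvenPart 𝒜)ˣ) : EvenPart 𝒜)) :=
    hv.comp (contMDiff_inv 𝓘(ℝ, EvenPart 𝒜) ∞)
  refine (h2.comp (hv.prodMk_space hi)).congr fun a => ?_
  refine ContinuousLinearMap.ext fun x => ?_
  change ((toUnit a : Aˣ) : A) * x * ((toUnit a)⁻¹ : Aˣ) =
    ((toUnit a : Aˣ) : A) * (x * ((toUnit a⁻¹ : Aˣ) : A))
  rw [map_inv, mul_assoc]

theorem contMDiff_evalAct :
    ContMDiff (𝓘(ℝ, EvenDer 𝒜).prod 𝓘(ℝ, EvenPart 𝒜)) 𝓘(ℝ, EvenPart 𝒜) ∞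
      fun p : EvenAut 𝒜 × (EvenPart 𝒜)ˣ => evalAct p.1 p.2 := by
  refine ContMDiff.of_comp_isOpenEmbedding Units.isOpenEmbedding_val ?_
  have hT := tower_op k A
  let pr : A →L[k] EvenPart 𝒜 := LinearMap.toContinuousLinearMap
    { toFun := fun a => (⟨_, (DirectSum.decompose 𝒜 a 0).2⟩ : EvenPart 𝒜)
      map_add' := fun x y => Subtype.ext (by simp [DirectSum.decompose_add]; rfl)
      map_smul' := fun c x => Subtype.ext (by simp [DirectSum.decompose_smul]; rfl) }
  have h1 : ContDiff k ∞ fun p : (A →L[k] A) × EvenPart 𝒜 => pr (p.1 (evenIncl 𝒜 p.2)) :=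
    pr.contDiff.comp (contDiff_fst.clm_apply ((evenIncl 𝒜).contDiff.comp contDiff_snd))
  have h2 := (h1.restrict_scalars ℝ).contMDiff
  have hv : ContMDiff 𝓘(ℝ, EvenPart 𝒜) 𝓘(ℝ, EvenPart 𝒜) ∞ (Units.val : (EvenPart 𝒜)ˣ → _) :=
    Units.contMDiff_val
  refine (h2.comp (((EvenAut.contMDiff_toCLM 𝒜).comp contMDiff_fst).prodMk_space
    (hv.comp contMDiff_snd))).congr fun p => ?_
  refine Subtype.ext ?_
  change p.1.1 p.2.1.1 = (DirectSum.decompose 𝒜 (p.1.1 p.2.1.1) 0 : A)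
  rw [DirectSum.decompose_of_mem_same 𝒜 ((p.1.2 0 _).2 p.2.1.2)]

/-- The automorphism crossed module of a super algebra `A`: conjugation `A_0ˣ → Aut(A)`, with
`Aut(A)` acting on `A_0ˣ` by evaluation. -/
def AUT : LieCrossedModule.{u, u} where
  H := evenUnitsLieGrp 𝒜
  G := autLieGrp 𝒜
  t := conjAut
  act := evalAct
  smooth_t := contMDiff_conjAut 𝒜
  smooth_act := contMDiff_evalAct 𝒜
  t_act φ a := Subtype.ext (AlgEquiv.ext fun x => by
    change φ.1 ((toUnit a : Aˣ) : A) * x * φ.1 (((toUnit a)⁻¹ : Aˣ) : A) =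
      φ.1 ((toUnit a : Aˣ) * φ.1.symm x * ((toUnit a)⁻¹ : Aˣ))
    rw [map_mul, map_mul, φ.1.apply_symm_apply])
  act_t a x := Units.ext (Subtype.ext rfl)

end AUT

/-- A short exact sequence `1 → N → K → Q → 1` of Lie groups: `i` is a smooth closed embedding onto
the kernel of the surjective submersion `p`. -/
structure IsShortExact {N : LieGrp.{u}} {K : LieGrp.{v}} {Q : LieGrp.{w}}
    (i : N →* K) (p : K →* Q) : Prop where
  smooth_i : ContMDiff N.I K.I ∞ i
  smooth_p : ContMDiff K.I Q.I ∞ p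
  closedEmbedding : Topology.IsClosedEmbedding i
  range_eq_ker : i.range = p.ker
  surjective : Function.Surjective p
  submersion : ∀ x : K, Function.Surjective (mfderiv K.I Q.I p x)

/-- An invertible butterfly, i.e. a weak equivalence, between two crossed modules of Lie groups:
a Lie group `K` with homomorphisms

`H₁ → K ← H₂` (namely `i₁`, `i₂`) and `G₁ ← K → G₂` (namely `p₁`, `p₂`)

such that `p₁ i₁ = t₁`, `p₂ i₂ = t₂`, both diagonals `H₁ → K → G₂` and `H₂ → K → G₁` are short exact
sequences of Lie groups, and the conjugation action of `K` on `H₁`, `H₂` is the given one. -/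
structure InvertibleButterfly (Γ₁ : LieCrossedModule.{u₁, v₁}) (Γ₂ : LieCrossedModule.{u₂, v₂}) where
  K : LieGrp.{w}
  i₁ : Γ₁.H →* K
  i₂ : Γ₂.H →* K
  p₁ : K →* Γ₁.G
  p₂ : K →* Γ₂.G
  p₁_i₁ : ∀ h, p₁ (i₁ h) = Γ₁.t h
  p₂_i₂ : ∀ h, p₂ (i₂ h) = Γ₂.t h
  exact₁₂ : IsShortExact i₁ p₂
  exact₂₁ : IsShortExact i₂ p₁
  conj₁ : ∀ x h, i₁ (Γ₁.act (p₁ x) h) = x * i₁ h * x⁻¹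
  conj₂ : ∀ x h, i₂ (Γ₂.act (p₂ x) h) = x * i₂ h * x⁻¹

/-- An open cover of `X`. -/
structure OpenCover (X : Type w) [TopologicalSpace X] where
  ι : Type w
  U : ι → TopologicalSpace.Opens X
  cover : ∀ x, ∃ i, x ∈ U i

/-- `r` exhibits `𝒱` as a refinement of `𝒰`. -/
def OpenCover.IsRefinement {X : Type w} [TopologicalSpace X] (𝒱 𝒰 : OpenCover X)
    (r : 𝒱.ι → 𝒰.ι) : Prop := ∀ i, 𝒱.U i ≤ 𝒰.U (r i)

/-- The intersection of finitely many members of a cover. -/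
def OpenCover.inter {X : Type w} [TopologicalSpace X] (𝒰 : OpenCover X) {n : ℕ}
    (s : Fin n → 𝒰.ι) : Set X := {x | ∀ m, x ∈ 𝒰.U (s m)}

section Cech

variable (E : Type v) [NormedAddCommGroup E] [NormedSpace ℝ E]
  {X : Type w} [TopologicalSpace X] [ChartedSpace E X]

/-- A smooth Čech 1-cocycle with values in a crossed module. The functions are total; only their
values on the relevant intersections matter. -/
structure Cocycle (𝒰 : OpenCover X) (Γ : LieCrossedModule.{u₁, v₁}) where
  g : 𝒰.ι → 𝒰.ι → X → Γ.G
  a : 𝒰.ι → 𝒰.ι → 𝒰.ι → X → Γ.H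
  smooth_g : ∀ i j, ContMDiffOn 𝓘(ℝ, E) Γ.G.I ∞ (g i j) (𝒰.U i ∩ 𝒰.U j)
  smooth_a : ∀ i j l, ContMDiffOn 𝓘(ℝ, E) Γ.H.I ∞ (a i j l) (𝒰.U i ∩ 𝒰.U j ∩ 𝒰.U l)
  cocycle_g : ∀ i j l x, x ∈ 𝒰.U i → x ∈ 𝒰.U j → x ∈ 𝒰.U l →
    Γ.t (a i j l x) * g j l x * g i j x = g i l x
  cocycle_a : ∀ i j l m x, x ∈ 𝒰.U i → x ∈ 𝒰.U j → x ∈ 𝒰.U l → x ∈ 𝒰.U m →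
    a i l m x * Γ.act (g l m x) (a i j l x) = a i j m x * a j l m x

/-- A 1-cocycle with respect to some open cover. -/
abbrev CocycleOnCover (X : Type w) [TopologicalSpace X] [ChartedSpace E X]
    (Γ : LieCrossedModule.{u₁, v₁}) := Σ 𝒰 : OpenCover X, Cocycle E 𝒰 Γ

variable {E} in
/-- Two cocycles are equivalent if, over a common refinement, they are related by smooth `h`, `e`. -/
def CocycleEquiv {Γ : LieCrossedModule.{u₁, v₁}} (c c' : CocycleOnCover E X Γ) : Prop :=
  ∃ (𝒱 : OpenCover X) (r : 𝒱.ι → c.1.ι) (r' : 𝒱.ι → c'.1.ι)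
    (h : 𝒱.ι → X → Γ.G) (e : 𝒱.ι → 𝒱.ι → X → Γ.H),
    𝒱.IsRefinement c.1 r ∧ 𝒱.IsRefinement c'.1 r' ∧
    (∀ i, ContMDiffOn 𝓘(ℝ, E) Γ.G.I ∞ (h i) (𝒱.U i)) ∧
    (∀ i j, ContMDiffOn 𝓘(ℝ, E) Γ.H.I ∞ (e i j) (𝒱.U i ∩ 𝒱.U j)) ∧
    (∀ i j x, x ∈ 𝒱.U i → x ∈ 𝒱.U j →
      Γ.t (e i j x) * h j x * c.2.g (r i) (r j) x = c'.2.g (r' i) (r' j) x * h i x) ∧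
    (∀ i j l x, x ∈ 𝒱.U i → x ∈ 𝒱.U j → x ∈ 𝒱.U l →
      c'.2.a (r' i) (r' j) (r' l) x * Γ.act (c'.2.g (r' j) (r' l) x) (e i j x) * e j l x =
        e i l x * Γ.act (h l x) (c.2.a (r i) (r j) (r l) x))

/-- The Čech cohomology set `Ȟ¹(X, Γ)` of a crossed module. -/
def CechH1 (X : Type w) [TopologicalSpace X] [ChartedSpace E X] (Γ : LieCrossedModule.{u₁, v₁}) :=
  Quot (CocycleEquiv (E := E) (X := X) (Γ := Γ))

/-- The class of a cocycle. -/
def CechH1.mk {𝒰 : OpenCover X} {Γ : LieCrossedModule.{u₁, v₁}} (c : Cocycle E 𝒰 Γ) :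
    CechH1 E X Γ := Quot.mk _ ⟨𝒰, c⟩

/-- The Čech coboundary of a cochain with values in an abelian group, written multiplicatively. -/
def cechDelta {ι : Type w} {Y : Type u} {B : Type v₁} [CommGroup B] {n : ℕ}
    (c : (Fin (n + 1) → ι) → Y → B) (s : Fin (n + 2) → ι) (x : Y) : B :=
  ∏ m : Fin (n + 2), c (s ∘ m.succAbove) x ^ ((-1 : ℤ) ^ (m : ℕ))

variable (F : Type u₁) [NormedAddCommGroup F] [NormedSpace ℝ F]
  (B : Type v₁) [CommGroup B] [TopologicalSpace B] [ChartedSpace F B]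

/-- A smooth Čech `n`-cocycle with values in an abelian Lie group `B`. -/
structure AbCocycle (𝒰 : OpenCover X) (n : ℕ) where
  val : (Fin (n + 1) → 𝒰.ι) → X → B
  smooth : ∀ s, ContMDiffOn 𝓘(ℝ, E) 𝓘(ℝ, F) ∞ (val s) (𝒰.inter s)
  closed : ∀ (s : Fin (n + 2) → 𝒰.ι) (x : X), x ∈ 𝒰.inter s → cechDelta val s x = 1

/-- An abelian `n`-cocycle with respect to some open cover. -/
abbrev AbCocycleOnCover (X : Type w) [TopologicalSpace X] [ChartedSpace E X] (n : ℕ) :=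
  Σ 𝒰 : OpenCover X, AbCocycle E F B 𝒰 n

variable {E F B} in
/-- Two `(n + 1)`-cocycles are cohomologous if, over a common refinement, they differ by the
coboundary of a smooth `n`-cochain. -/
def Cohomologous {n : ℕ} (c c' : AbCocycleOnCover E F B X (n + 1)) : Prop :=
  ∃ (𝒱 : OpenCover X) (r : 𝒱.ι → c.1.ι) (r' : 𝒱.ι → c'.1.ι)
    (b : (Fin (n + 1) → 𝒱.ι) → X → B),
    𝒱.IsRefinement c.1 r ∧ 𝒱.IsRefinement c'.1 r' ∧
    (∀ s, ContMDiffOn 𝓘(ℝ, E) 𝓘(ℝ, F) ∞ (b s) (𝒱.inter s)) ∧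
    ∀ (s : Fin (n + 2) → 𝒱.ι) (x : X), x ∈ 𝒱.inter s →
      c'.2.val (r' ∘ s) x = c.2.val (r ∘ s) x * cechDelta b s x

/-- The Čech cohomology `Ȟⁿ⁺¹(X, B)` of the sheaf of smooth `B`-valued functions. -/
def CechAb (X : Type w) [TopologicalSpace X] [ChartedSpace E X] (n : ℕ) :=
  Quot (Cohomologous (E := E) (F := F) (B := B) (X := X) (n := n))

variable {F B} in
/-- The class of an abelian cocycle. -/
def CechAb.mk {𝒰 : OpenCover X} {n : ℕ} (c : AbCocycle E F B 𝒰 (n + 1)) : CechAb E F B X n :=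
  Quot.mk _ ⟨𝒰, c⟩

variable {E} in
/-- The correspondence between cocycles that an invertible butterfly induces: `d` is obtained from
`c` by lifting `c.g` along `p₁` to smooth `K`-valued functions `k` and applying `p₂`. -/
def InvertibleButterfly.Relates {Γ₁ : LieCrossedModule.{u₁, v₁}} {Γ₂ : LieCrossedModule.{u₂, v₂}}
    (B : InvertibleButterfly.{u, u₁, v₁, u₂, v₂} Γ₁ Γ₂) {𝒰 : OpenCover X} (c : Cocycle E 𝒰 Γ₁)
    (d : Cocycle E 𝒰 Γ₂) : Prop :=
  ∃ k : 𝒰.ι → 𝒰.ι → X → B.K,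
    (∀ i j, ContMDiffOn 𝓘(ℝ, E) B.K.I ∞ (k i j) (𝒰.U i ∩ 𝒰.U j)) ∧
    (∀ i j x, x ∈ 𝒰.U i → x ∈ 𝒰.U j → B.p₁ (k i j x) = c.g i j x ∧ B.p₂ (k i j x) = d.g i j x) ∧
    ∀ i j l x, x ∈ 𝒰.U i → x ∈ 𝒰.U j → x ∈ 𝒰.U l →
      B.i₂ (d.a i j l x) * B.i₁ (c.a i j l x) * k j l x * k i j x = k i l x

end Cech

section Super

variable {k : Type v} [RCLike k] {A : Type u} [NormedRing A] [NormedAlgebra k A]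
  (𝒜 : ZMod 2 → Submodule k A) [GradedAlgebra 𝒜]

/-- A super algebra is central simple if it is nonzero, has no graded two-sided ideals besides `0`
and itself, and the even part of its centre is `k`. -/
structure IsCentralSimple : Prop where
  nontrivial : Nontrivial A
  simple : ∀ I : TwoSidedIdeal A,
    (∀ a ∈ I, ∀ i, (DirectSum.decompose 𝒜 a i : A) ∈ I) → I = ⊥ ∨ I = ⊤
  central : ∀ z ∈ 𝒜 0, (∀ a, z * a = a * z) → ∃ c : k, z = algebraMap k A c

/-- A finite-dimensional `ℤ/2`-graded `A`-`A`-bimodule; the right action is an action of `Aᵐᵒᵖ`. -/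
structure SuperBimodule where
  carrier : Type u
  [addCommGroup : AddCommGroup carrier]
  [module : Module k carrier]
  [left : Module A carrier]
  [right : Module Aᵐᵒᵖ carrier]
  [towerLeft : IsScalarTower k A carrier]
  [towerRight : IsScalarTower k Aᵐᵒᵖ carrier]
  [comm : SMulCommClass A Aᵐᵒᵖ carrier]
  [finite : Module.Finite k carrier]
  deg : ZMod 2 → Submodule k carrier
  internal : DirectSum.IsInternal deg
  smul_mem : ∀ i j, ∀ a ∈ 𝒜 i, ∀ m ∈ deg j, a • m ∈ deg (i + j)
  op_smul_mem : ∀ i j, ∀ a ∈ 𝒜 i, ∀ m ∈ deg j, MulOpposite.op a • m ∈ deg (j + i)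

namespace SuperBimodule

instance : CoeSort (SuperBimodule 𝒜) (Type u) := ⟨carrier⟩

attribute [instance] addCommGroup module left right towerLeft towerRight comm finite

variable {𝒜}

/-- The relations `m b ⊗ n = m ⊗ b n`. -/
def balanced (M N : SuperBimodule 𝒜) : Submodule k (M ⊗[k] N) :=
  Submodule.span k {z | ∃ (m : M) (b : A) (n : N), z = (MulOpposite.op b • m) ⊗ₜ n - m ⊗ₜ (b • n)}

/-- The relative tensor product `M ⊗_A N`. -/
abbrev RelTensor (M N : SuperBimodule 𝒜) : Type u := (M ⊗[k] N) ⧸ balanced M N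

/-- The class of a pure tensor. -/
def pure {M N : SuperBimodule 𝒜} (m : M) (n : N) : RelTensor M N :=
  Submodule.Quotient.mk (m ⊗ₜ n)

/-- `M ⊗_A N ≅ A`, by an even intertwiner of bimodules. -/
def TensorIsoUnit (M N : SuperBimodule 𝒜) : Prop :=
  ∃ θ : RelTensor M N ≃ₗ[k] A,
    (∀ (a : A) (m : M) (n : N), θ (pure (a • m) n) = a * θ (pure m n)) ∧
    (∀ (m : M) (n : N) (b : A), θ (pure m (MulOpposite.op b • n)) = θ (pure m n) * b) ∧
    ∀ i j, ∀ m ∈ M.deg i, ∀ n ∈ N.deg j, θ (pure m n) ∈ 𝒜 (i + j)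

/-- `M` is invertible. -/
def IsInvertible (M : SuperBimodule 𝒜) : Prop :=
  ∃ N : SuperBimodule 𝒜, TensorIsoUnit M N ∧ TensorIsoUnit N M

/-- `M ≅ A_φ`, by an even intertwiner; `A_φ` is `A` with right action twisted by `φ`. -/
def IsoTwist (M : SuperBimodule 𝒜) (φ : EvenAut 𝒜) : Prop :=
  ∃ f : M ≃ₗ[k] A,
    (∀ (a : A) (m : M), f (a • m) = a * f m) ∧
    (∀ (m : M) (b : A), f (MulOpposite.op b • m) = f m * φ.1 b) ∧
    ∀ i, ∀ m ∈ M.deg i, f m ∈ 𝒜 i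

end SuperBimodule

/-- `A` is Picard-surjective: every invertible `A`-`A`-bimodule is isomorphic to some `A_φ`. -/
def PicardSurjective : Prop :=
  ∀ M : SuperBimodule 𝒜, M.IsInvertible → ∃ φ : EvenAut 𝒜, M.IsoTwist φ

/-- `f : Π^ε A → A_φ` is an invertible even intertwiner. Here `Π^0 A = A`, and `Π^1 A = ΠA` has the
opposite grading, the same left action, and right action `x ◁ b = (-1)^{|b|} x b`. -/
structure IsParityIntertwiner (ε : Z2) (φ : EvenAut 𝒜) (f : A ≃ₗ[k] A) : Prop where
  even : ∀ i, ∀ x ∈ 𝒜 (i + ε.val), f x ∈ 𝒜 i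
  left : ∀ a x, f (a * x) = a * f x
  right : ∀ j, ∀ b ∈ 𝒜 j, ∀ x, f ((-1 : k) ^ (ε.val.val * j.val) • (x * b)) = f x * φ.1 b

variable [FiniteDimensional k A] {𝒜} in
/-- The butterfly is the canonical one: `K` consists of all triples `(φ, ε, f)` with
`f : Π^ε A → A_φ` an invertible even intertwiner, with componentwise composition and the Lie group
structure of a submanifold of `Aut(A) × ℤ/2 × GL(A)`; `p₁`, `p₂` are the projections, an even unit
`a` is sent to right multiplication by `a⁻¹`, and `c : kˣ` to multiplication by `c`. -/
def IsCanonical (B : InvertibleButterfly.{u, u, u, v, 0} (AUT 𝒜) (unitsZ2 k)) : Prop :=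
  ∃ f : B.K →* (A ≃ₗ[k] A),
    (∀ x, IsParityIntertwiner 𝒜 (B.p₂ x) (B.p₁ x) (f x)) ∧
    (∀ (ε : Z2) (φ : EvenAut 𝒜) (F : A ≃ₗ[k] A), IsParityIntertwiner 𝒜 ε φ F →
      ∃! x, B.p₂ x = ε ∧ B.p₁ x = φ ∧ f x = F) ∧
    (∀ (a : (EvenPart 𝒜)ˣ) (y : A), f (B.i₁ a) y = y * ((toUnit a)⁻¹ : Aˣ)) ∧
    (∀ (c : kˣ) (y : A), f (B.i₂ c) y = (c : k) • y) ∧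
    Topology.IsEmbedding fun x => (B.p₁ x, B.p₂ x, LinearMap.toContinuousLinearMap (f x).toLinearMap)

end Super

end SuperAUT

end

open SuperAUT

universe u v w₁ w₂

noncomputable section

namespace SuperAUT

open Set NormedSpace

universe w u₁ v₁ u₂ v₂

/-! ### Covers, restriction and equivalence of cocycles over a fixed cover -/

namespace OpenCover

variable {X : Type w} [TopologicalSpace X]

/-! The group K has a concrete model. An intertwiner f : Π^ε A → A_φ is left linear, hence right
multiplication by f(1); invertibility and evenness make f(1) a homogeneous unit of degree ε, and
right linearity forces φ(b) = (-1)^{|x||b|} x b x⁻¹ with x = f(1)⁻¹. So K is the group `HomUnits` of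
homogeneous units with their degrees (`HomUnits.existsUnique_of_intertwiner`). It embeds in A and
has Lie algebra A_0, because near 0 the element exp T is a homogeneous unit exactly when T is even.

The sequence A_0ˣ → K → ℤ/2 is exact once A has an odd unit. Picard-surjectivity supplies one: ΠA is
its own inverse, so ΠA ≅ A_φ, and the image of 1 is an odd unit
(`PicardSurjective.exists_odd_unit`).

The sequence kˣ → K → Aut(A) is exact by a graded Skolem–Noether theorem. Let σ be the parity
involution. For a homogeneous basis b_i with degrees d_i, the operators x ↦ ∑ a_i σ^{d_i}(x) b_i
determine their coefficients a_i, by a shortest-relation argument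
(`IsCentralSimple.sandwich_injective`), and by a dimension count they exhaust End(A). Writing a
rank-one operator f(·)1 in this form gives a Casimir element ∑ a_i ⊗ b_i. For an even automorphism φ
and homogeneous y, the element ∑ a_i σ^{d_i}(y) φ(b_i) then intertwines A with A_φ up to parity; it
is nonzero for some y, and a nonzero homogeneous normal element is a unit. This element is linear in
φ and equals 1 for φ = id, y = 1, so the same formula yields a smooth local section of K → Aut(A)
near the identity.

For the cohomology, a cocycle (g, a) is lifted along p₁ to smooth K-valued functions after a
refinement, which exists because X is paracompact. Applying p₂ to the lifts gives the new transition
functions, and the failure of the lifts to satisfy the cocycle identity with a lies in ker p₁ =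
i₂(kˣ), which gives x. The construction is symmetric in the two crossed modules, so the butterfly
read backwards gives the inverse map. Over kˣ → ℤ/2 with trivial structure, the cocycle and
equivalence equations decouple into two abelian ones, whence the product decomposition. -/

theorem IsRefinement.refl (𝒰 : OpenCover X) : 𝒰.IsRefinement 𝒰 id := fun _ => le_rfl

theorem IsRefinement.trans {𝒲 𝒱 𝒰 : OpenCover X} {q : 𝒲.ι → 𝒱.ι} {r : 𝒱.ι → 𝒰.ι}
    (hq : 𝒲.IsRefinement 𝒱 q) (hr : 𝒱.IsRefinement 𝒰 r) : 𝒲.IsRefinement 𝒰 (r ∘ q) :=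
  fun i => (hq i).trans (hr (q i))

/-- The cover by the pairwise intersections of the members of two covers. -/
def prod (𝒰 𝒱 : OpenCover X) : OpenCover X where
  ι := 𝒰.ι × 𝒱.ι
  U p := 𝒰.U p.1 ⊓ 𝒱.U p.2
  cover x := by
    obtain ⟨i, hi⟩ := 𝒰.cover x
    obtain ⟨j, hj⟩ := 𝒱.cover x
    exact ⟨(i, j), hi, hj⟩

theorem isRefinement_fst (𝒰 𝒱 : OpenCover X) : (𝒰.prod 𝒱).IsRefinement 𝒰 Prod.fst :=
  fun _ => inf_le_left

theorem isRefinement_snd (𝒰 𝒱 : OpenCover X) : (𝒰.prod 𝒱).IsRefinement 𝒱 Prod.snd :=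
  fun _ => inf_le_right

end OpenCover

section Restriction

variable {E : Type v} [NormedAddCommGroup E] [NormedSpace ℝ E]
  {X : Type w} [TopologicalSpace X] [ChartedSpace E X] {Γ : LieCrossedModule.{u₁, v₁}}
  {𝒰 𝒱 𝒲 : OpenCover X}

/-- The restriction of a cocycle to a refinement. -/
def Cocycle.restrict (c : Cocycle E 𝒰 Γ) (r : 𝒱.ι → 𝒰.ι) (hr : 𝒱.IsRefinement 𝒰 r) :
    Cocycle E 𝒱 Γ where
  g i j := c.g (r i) (r j)
  a i j l := c.a (r i) (r j) (r l)
  smooth_g i j := (c.smooth_g _ _).mono (inter_subset_inter (hr i) (hr j))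
  smooth_a i j l := (c.smooth_a _ _ _).mono
    (inter_subset_inter (inter_subset_inter (hr i) (hr j)) (hr l))
  cocycle_g i j l x hi hj hl := c.cocycle_g _ _ _ x (hr i hi) (hr j hj) (hr l hl)
  cocycle_a i j l m x hi hj hl hm :=
    c.cocycle_a _ _ _ _ x (hr i hi) (hr j hj) (hr l hl) (hr m hm)

/-- Equivalence of cocycles over a fixed cover, without passing to a refinement. -/
def Cocycle.StrictEquiv (c c' : Cocycle E 𝒱 Γ) : Prop :=
  ∃ (h : 𝒱.ι → X → Γ.G) (e : 𝒱.ι → 𝒱.ι → X → Γ.H),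
    (∀ i, ContMDiffOn 𝓘(ℝ, E) Γ.G.I ∞ (h i) (𝒱.U i)) ∧
    (∀ i j, ContMDiffOn 𝓘(ℝ, E) Γ.H.I ∞ (e i j) (𝒱.U i ∩ 𝒱.U j)) ∧
    (∀ i j x, x ∈ 𝒱.U i → x ∈ 𝒱.U j →
      Γ.t (e i j x) * h j x * c.g i j x = c'.g i j x * h i x) ∧
    (∀ i j l x, x ∈ 𝒱.U i → x ∈ 𝒱.U j → x ∈ 𝒱.U l →
      c'.a i j l x * Γ.act (c'.g j l x) (e i j x) * e j l x =
        e i l x * Γ.act (h l x) (c.a i j l x))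

theorem cocycleEquiv_iff {c c' : CocycleOnCover E X Γ} : CocycleEquiv c c' ↔
    ∃ (𝒱 : OpenCover X) (r : 𝒱.ι → c.1.ι) (r' : 𝒱.ι → c'.1.ι) (hr : 𝒱.IsRefinement c.1 r)
      (hr' : 𝒱.IsRefinement c'.1 r'), (c.2.restrict r hr).StrictEquiv (c'.2.restrict r' hr') := by
  constructor
  · rintro ⟨𝒱, r, r', h, e, hr, hr', H⟩
    exact ⟨𝒱, r, r', hr, hr', h, e, H⟩
  · rintro ⟨𝒱, r, r', hr, hr', h, e, H⟩
    exact ⟨𝒱, r, r', h, e, hr, hr', H⟩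

theorem Cocycle.StrictEquiv.refl (c : Cocycle E 𝒱 Γ) : c.StrictEquiv c :=
  ⟨fun _ _ => 1, fun _ _ _ => 1, fun _ => contMDiffOn_const, fun _ _ => contMDiffOn_const,
    fun i j x _ _ => by simp, fun i j l x _ _ _ => by simp⟩

/-- Reflexivity is what makes the induced map on classes independent of the lifts chosen for a
single cocycle. -/
theorem CocycleEquiv.refl (c : CocycleOnCover E X Γ) : CocycleEquiv c c :=
  cocycleEquiv_iff.2 ⟨c.1, id, id, .refl _, .refl _, .refl _⟩

theorem Cocycle.StrictEquiv.restrict {c c' : Cocycle E 𝒰 Γ} (h : c.StrictEquiv c')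
    (r : 𝒱.ι → 𝒰.ι) (hr : 𝒱.IsRefinement 𝒰 r) :
    (c.restrict r hr).StrictEquiv (c'.restrict r hr) := by
  obtain ⟨h, e, h1, h2, h3, h4⟩ := h
  exact ⟨fun i => h (r i), fun i j => e (r i) (r j), fun i => (h1 _).mono (hr i),
    fun i j => (h2 _ _).mono (inter_subset_inter (hr i) (hr j)),
    fun i j x hi hj => h3 _ _ x (hr i hi) (hr j hj),
    fun i j l x hi hj hl => h4 _ _ _ x (hr i hi) (hr j hj) (hr l hl)⟩

theorem _root_.ContMDiffOn.crossedModule_act {f : X → Γ.G} {f' : X → Γ.H} {s : Set X}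
    (hf : ContMDiffOn 𝓘(ℝ, E) Γ.G.I ∞ f s) (hf' : ContMDiffOn 𝓘(ℝ, E) Γ.H.I ∞ f' s) :
    ContMDiffOn 𝓘(ℝ, E) Γ.H.I ∞ (fun x => Γ.act (f x) (f' x)) s :=
  Γ.smooth_act.comp_contMDiffOn (hf.prodMk hf')

/-- Gauge transformations (h, e) and (h', e') compose to h'h and e' · ^{h'}e. -/
theorem Cocycle.StrictEquiv.trans {c c' c'' : Cocycle E 𝒱 Γ} (h₁ : c.StrictEquiv c')
    (h₂ : c'.StrictEquiv c'') : c.StrictEquiv c'' := by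
  obtain ⟨h, e, h1, h2, h3, h4⟩ := h₁
  obtain ⟨h', e', h1', h2', h3', h4'⟩ := h₂
  refine ⟨fun i x => h' i x * h i x, fun i j x => e' i j x * Γ.act (h' j x) (e i j x),
    fun i => (h1' i).mul (h1 i), fun i j => (h2' i j).mul
      (((h1' j).mono inter_subset_right).crossedModule_act (h2 i j)), ?_, ?_⟩
  · intro i j x hi hj
    have e1 := h3 i j x hi hj
    have e2 := h3' i j x hi hj
    calc _ = Γ.t (e' i j x) * h' j x * (Γ.t (e i j x) * h j x * c.g i j x) := by
          rw [map_mul, Γ.t_act]; group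
      _ = _ := by rw [e1, ← mul_assoc, e2, mul_assoc]
  · intro i j l x hi hj hl
    have e1 := h4 i j l x hi hj hl
    have e2 := h4' i j l x hi hj hl
    have e3 := h3' j l x hj hl
    -- Both sides of the transition identity `e3` act on e_ij; the factor t(e'_jl) acts by
    -- conjugation with e'_jl, which moves e' past the action.
    have key : e' j l x * Γ.act (h' l x) (Γ.act (c'.g j l x) (e i j x)) =
        Γ.act (c''.g j l x) (Γ.act (h' j x) (e i j x)) * e' j l x := by
      have e4 := congrArg (fun z => Γ.act z (e i j x)) e3
      simp only [map_mul, MulAut.mul_apply, Γ.act_t] at e4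
      rw [← e4]
      group
    simp only [map_mul, MulAut.mul_apply]
    calc _ = c''.a i j l x * Γ.act (c''.g j l x) (e' i j x) *
          (Γ.act (c''.g j l x) (Γ.act (h' j x) (e i j x)) * e' j l x) *
            Γ.act (h' l x) (e j l x) := by group
      _ = c''.a i j l x * Γ.act (c''.g j l x) (e' i j x) * e' j l x *
          Γ.act (h' l x) (Γ.act (c'.g j l x) (e i j x) * e j l x) := by
            rw [← key, map_mul]; group
      _ = e' i l x * Γ.act (h' l x) (c'.a i j l x * Γ.act (c'.g j l x) (e i j x) * e j l x) := by
            rw [e2]; simp only [map_mul, mul_assoc]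
      _ = _ := by rw [e1, map_mul, mul_assoc]

/-- The restrictions of a cocycle along two refinement maps are equivalent. -/
theorem Cocycle.restrict_strictEquiv (c : Cocycle E 𝒰 Γ) {r r' : 𝒱.ι → 𝒰.ι}
    (hr : 𝒱.IsRefinement 𝒰 r) (hr' : 𝒱.IsRefinement 𝒰 r') :
    (c.restrict r hr).StrictEquiv (c.restrict r' hr') := by
  -- The element e_ij compares the two paths from r(i) to r'(j), one through r'(i) and one through
  -- r(j).
  refine ⟨fun i => c.g (r i) (r' i), fun i j x => (c.a (r i) (r' i) (r' j) x)⁻¹ *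
    c.a (r i) (r j) (r' j) x, fun i => ?_, fun i j => ?_, fun i j x hi hj => ?_,
    fun i j l x hi hj hl => ?_⟩
  · exact (c.smooth_g _ _).mono fun x hx => ⟨hr i hx, hr' i hx⟩
  · exact ((c.smooth_a _ _ _).mono fun x hx => ⟨⟨hr i hx.1, hr' i hx.1⟩, hr' j hx.2⟩).inv.mul
      ((c.smooth_a _ _ _).mono fun x hx => ⟨⟨hr i hx.1, hr j hx.2⟩, hr' j hx.2⟩)
  · have e1 := c.cocycle_g (r i) (r' i) (r' j) x (hr i hi) (hr' i hi) (hr' j hj)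
    have e2 := c.cocycle_g (r i) (r j) (r' j) x (hr i hi) (hr j hj) (hr' j hj)
    change Γ.t _ * _ * c.g (r i) (r j) x = c.g (r' i) (r' j) x * _
    rw [map_mul, map_inv, mul_assoc, mul_assoc, ← mul_assoc (Γ.t (c.a (r i) (r j) (r' j) x)), e2,
      ← e1]
    group
  -- The prism over the triangle (i, j, l) is cut into three tetrahedra, and the cocycle condition
  -- is used on each.
  · have e1 := c.cocycle_a (r i) (r' i) (r' j) (r' l) x (hr i hi) (hr' i hi) (hr' j hj) (hr' l hl)
    have e2 := c.cocycle_a (r i) (r j) (r' j) (r' l) x (hr i hi) (hr j hj) (hr' j hj) (hr' l hl)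
    have e3 := c.cocycle_a (r i) (r j) (r l) (r' l) x (hr i hi) (hr j hj) (hr l hl) (hr' l hl)
    change c.a (r' i) (r' j) (r' l) x * Γ.act (c.g (r' j) (r' l) x) _ * _ =
      _ * Γ.act (c.g (r l) (r' l) x) (c.a (r i) (r j) (r l) x)
    rw [← eq_inv_mul_iff_mul_eq] at e1 e2
    rw [map_mul, map_inv, e1, e2, mul_assoc _ _ (Γ.act _ _), e3]
    group

end Restriction

/-! ### Butterflies with smooth lifts -/

/-- The homomorphism `p` has local smooth sections and `i` has a left inverse that is smooth near
the kernel of `p`. -/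
structure HasSmoothLifts {N : LieGrp.{u}} {K : LieGrp.{v}} {Q : LieGrp.{w}}
    (i : N →* K) (p : K →* Q) : Prop where
  exists_section : ∀ g : Q, ∃ O : Set Q, IsOpen O ∧ g ∈ O ∧ ∃ σ : Q → K,
    ContMDiffOn Q.I K.I ∞ σ O ∧ ∀ y ∈ O, p (σ y) = y
  exists_retraction : ∃ (O : Set K) (r : K → N), (∀ x, p x = 1 → x ∈ O) ∧
    ContMDiffOn K.I N.I ∞ r O ∧ ∀ n, r (i n) = n

section Lifts

variable {E : Type u₂} [NormedAddCommGroup E] [NormedSpace ℝ E]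
  {X : Type v₂} [TopologicalSpace X] [ChartedSpace E X]
  {N : LieGrp.{u}} {K : LieGrp.{v}} {Q : LieGrp.{w}} {i : N →* K} {p : K →* Q}

theorem HasSmoothLifts.exists_local_lift (H : HasSmoothLifts i p) {f : X → Q} {s : Set X}
    (hs : IsOpen s) (hf : ContMDiffOn 𝓘(ℝ, E) Q.I ∞ f s) {x : X} (hx : x ∈ s) :
    ∃ W : Set X, IsOpen W ∧ x ∈ W ∧ W ⊆ s ∧ ∃ f' : X → K,
      ContMDiffOn 𝓘(ℝ, E) K.I ∞ f' W ∧ ∀ y ∈ W, p (f' y) = f y := by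
  obtain ⟨O, hO, hxO, σ, hσ, hpσ⟩ := H.exists_section (f x)
  refine ⟨s ∩ f ⁻¹' O, hf.continuousOn.isOpen_inter_preimage hs hO, ⟨hx, hxO⟩, inter_subset_left,
    fun y => σ (f y), ?_, fun y hy => hpσ _ hy.2⟩
  exact hσ.comp (hf.mono inter_subset_left) fun y hy => hy.2

/-- A kernel-valued function has a unique preimage under i; composing with the retraction, which
inverts i on ker p, shows that this preimage is smooth. -/
theorem HasSmoothLifts.exists_kernel_lift (H : HasSmoothLifts i p) (he : i.range = p.ker)
    {f : X → K} {s : Set X} (hf : ContMDiffOn 𝓘(ℝ, E) K.I ∞ f s) (hp : ∀ x ∈ s, p (f x) = 1) :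
    ∃ f' : X → N, ContMDiffOn 𝓘(ℝ, E) N.I ∞ f' s ∧ ∀ x ∈ s, i (f' x) = f x := by
  obtain ⟨O, r, hO, hr, hri⟩ := H.exists_retraction
  refine ⟨fun x => r (f x), hr.comp hf fun x hx => hO _ (hp x hx), fun x hx => ?_⟩
  obtain ⟨n, hn⟩ : f x ∈ i.range := he ▸ hp x hx
  simp only [← hn, hri]

end Lifts

namespace InvertibleButterfly

variable {Γ₁ : LieCrossedModule.{u₁, v₁}} {Γ₂ : LieCrossedModule.{u₂, v₂}}
  (B : InvertibleButterfly.{u, u₁, v₁, u₂, v₂} Γ₁ Γ₂)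

/-- The inverse butterfly. -/
def swap : InvertibleButterfly.{u, u₂, v₂, u₁, v₁} Γ₂ Γ₁ where
  K := B.K
  i₁ := B.i₂
  i₂ := B.i₁
  p₁ := B.p₂
  p₂ := B.p₁
  p₁_i₁ := B.p₂_i₂
  p₂_i₂ := B.p₁_i₁
  exact₁₂ := B.exact₂₁
  exact₂₁ := B.exact₁₂
  conj₁ := B.conj₂
  conj₂ := B.conj₁

theorem p₂_i₁ (h : Γ₁.H) : B.p₂ (B.i₁ h) = 1 :=
  B.exact₁₂.range_eq_ker.le ⟨h, rfl⟩

/-- Since p₂ i₁ = 1, the element i₁(h) acts trivially on H₂, and that action is conjugation in K. -/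
theorem i₁_mul_i₂ (h : Γ₁.H) (h' : Γ₂.H) : B.i₁ h * B.i₂ h' = B.i₂ h' * B.i₁ h := by
  have := B.conj₂ (B.i₁ h) h'
  rw [B.p₂_i₁, map_one, MulAut.one_apply, eq_mul_inv_iff_mul_eq] at this
  exact this.symm

theorem mul_i₁ (x : B.K) (h : Γ₁.H) : x * B.i₁ h = B.i₁ (Γ₁.act (B.p₁ x) h) * x := by
  rw [B.conj₁, inv_mul_cancel_right]

theorem mul_i₂ (x : B.K) (h : Γ₂.H) : x * B.i₂ h = B.i₂ (Γ₂.act (B.p₂ x) h) * x := by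
  rw [B.conj₂, inv_mul_cancel_right]

theorem i₂_injective : Function.Injective B.i₂ := B.exact₂₁.closedEmbedding.injective

/-- Move `x` past `i₂ b i₁ a`. -/
theorem mul_i₂_i₁ (x : B.K) (b : Γ₂.H) (a : Γ₁.H) :
    x * (B.i₂ b * B.i₁ a) =
      B.i₂ (Γ₂.act (B.p₂ x) b) * B.i₁ (Γ₁.act (B.p₁ x) a) * x := by
  rw [← mul_assoc, B.mul_i₂, mul_assoc, B.mul_i₁, mul_assoc]

theorem i₂_i₁_mul (b b' : Γ₂.H) (a a' : Γ₁.H) :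
    B.i₂ b * B.i₁ a * (B.i₂ b' * B.i₁ a') = B.i₂ (b * b') * B.i₁ (a * a') := by
  rw [map_mul, map_mul, mul_assoc, ← mul_assoc (B.i₁ a), B.i₁_mul_i₂]
  group

variable {E : Type v} [NormedAddCommGroup E] [NormedSpace ℝ E]
  {X : Type w} [TopologicalSpace X] [ChartedSpace E X] {𝒰 𝒱 : OpenCover X}

variable {B}

/-- The defining relation is symmetric because the images of i₁ and i₂ commute; the same lifts serve
both directions. -/
theorem Relates.swap {c : Cocycle E 𝒰 Γ₁} {d : Cocycle E 𝒰 Γ₂} (h : B.Relates c d) :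
    B.swap.Relates d c := by
  obtain ⟨k, h1, h2, h3⟩ := h
  refine ⟨k, h1, fun i j x hi hj => (h2 i j x hi hj).symm, fun i j l x hi hj hl => ?_⟩
  rw [← h3 i j l x hi hj hl]
  exact congrArg (fun y : B.K => y * k j l x * k i j x) (B.i₁_mul_i₂ _ _)

theorem Relates.restrict {c : Cocycle E 𝒰 Γ₁} {d : Cocycle E 𝒰 Γ₂} (h : B.Relates c d)
    (r : 𝒱.ι → 𝒰.ι) (hr : 𝒱.IsRefinement 𝒰 r) :
    B.Relates (c.restrict r hr) (d.restrict r hr) := by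
  obtain ⟨k, h1, h2, h3⟩ := h
  exact ⟨fun i j => k (r i) (r j), fun i j => (h1 _ _).mono (inter_subset_inter (hr i) (hr j)),
    fun i j x hi hj => h2 _ _ x (hr i hi) (hr j hj),
    fun i j l x hi hj hl => h3 _ _ _ x (hr i hi) (hr j hj) (hr l hl)⟩

variable (B) in
/-- The correspondence between cocycles on different covers: over a common refinement they are
related by the butterfly. -/
def WeaklyRelates (c : CocycleOnCover E X Γ₁) (d : CocycleOnCover E X Γ₂) : Prop :=
  ∃ (𝒱 : OpenCover X) (r : 𝒱.ι → c.1.ι) (r' : 𝒱.ι → d.1.ι) (hr : 𝒱.IsRefinement c.1 r)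
    (hr' : 𝒱.IsRefinement d.1 r'), B.Relates (c.2.restrict r hr) (d.2.restrict r' hr')

theorem WeaklyRelates.swap {c : CocycleOnCover E X Γ₁} {d : CocycleOnCover E X Γ₂}
    (h : B.WeaklyRelates c d) : B.swap.WeaklyRelates d c := by
  obtain ⟨𝒱, r, r', hr, hr', h⟩ := h
  exact ⟨𝒱, r', r, hr', hr, h.swap⟩

theorem Relates.weaklyRelates {c : Cocycle E 𝒰 Γ₁} {d : Cocycle E 𝒰 Γ₂} (h : B.Relates c d) :
    B.WeaklyRelates ⟨𝒰, c⟩ ⟨𝒰, d⟩ := ⟨𝒰, id, id, .refl _, .refl _, h⟩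

/-- Cocycles related by a butterfly to equivalent cocycles are equivalent. Here the
transition function `h` is assumed to lift. -/
theorem Relates.strictEquiv (H : HasSmoothLifts B.i₂ B.p₁) {c c' : Cocycle E 𝒰 Γ₁}
    {d d' : Cocycle E 𝒰 Γ₂} (hd : B.Relates c d) (hd' : B.Relates c' d')
    {h : 𝒰.ι → X → B.K} {e : 𝒰.ι → 𝒰.ι → X → Γ₁.H}
    (hh : ∀ i, ContMDiffOn 𝓘(ℝ, E) B.K.I ∞ (h i) (𝒰.U i))
    (he : ∀ i j, ContMDiffOn 𝓘(ℝ, E) Γ₁.H.I ∞ (e i j) (𝒰.U i ∩ 𝒰.U j))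
    (hg : ∀ i j x, x ∈ 𝒰.U i → x ∈ 𝒰.U j →
      Γ₁.t (e i j x) * B.p₁ (h j x) * c.g i j x = c'.g i j x * B.p₁ (h i x))
    (ha : ∀ i j l x, x ∈ 𝒰.U i → x ∈ 𝒰.U j → x ∈ 𝒰.U l →
      c'.a i j l x * Γ₁.act (c'.g j l x) (e i j x) * e j l x =
        e i l x * Γ₁.act (B.p₁ (h l x)) (c.a i j l x)) : d.StrictEquiv d' := by
  obtain ⟨k, k1, k2, k3⟩ := hd
  obtain ⟨k', k1', k2', k3'⟩ := hd'
  -- The H₂-part f_ij of the new equivalence measures how far i₁(e_ij) h_j k_ij is from k'_ij h_i.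
  -- The two agree after p₁ by `hg`, so the discrepancy lies in ker p₁ = im i₂.
  have hlift : ∀ i j, ∃ f : X → Γ₂.H, ContMDiffOn 𝓘(ℝ, E) Γ₂.H.I ∞ f (𝒰.U i ∩ 𝒰.U j) ∧
      ∀ x ∈ (𝒰.U i ∩ 𝒰.U j : Set X), B.i₂ (f x) =
        k' i j x * h i x * (B.i₁ (e i j x) * h j x * k i j x)⁻¹ := by
    intro i j
    refine H.exists_kernel_lift B.exact₂₁.range_eq_ker ?_ ?_
    · exact ((k1' i j).mul ((hh i).mono inter_subset_left)).mul
        (((B.exact₁₂.smooth_i.comp_contMDiffOn (he i j)).mul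
          ((hh j).mono inter_subset_right)).mul (k1 i j)).inv
    · rintro x ⟨hi, hj⟩
      simp only [map_mul, map_inv]
      rw [(k2 i j x hi hj).1, (k2' i j x hi hj).1, B.p₁_i₁, hg i j x hi hj, mul_inv_cancel]
  choose f hf hif using hlift
  have key : ∀ i j x, x ∈ 𝒰.U i → x ∈ 𝒰.U j →
      B.i₂ (f i j x) * B.i₁ (e i j x) * (h j x * k i j x) = k' i j x * h i x := by
    intro i j x hi hj
    rw [hif i j x ⟨hi, hj⟩]
    group
  refine ⟨fun i x => B.p₂ (h i x), f, fun i => B.exact₁₂.smooth_p.comp_contMDiffOn (hh i), hf,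
    fun i j x hi hj => ?_, fun i j l x hi hj hl => ?_⟩
  · have := congrArg B.p₂ (key i j x hi hj)
    simp only [map_mul] at this
    rw [(k2 i j x hi hj).2, (k2' i j x hi hj).2, B.p₂_i₁, B.p₂_i₂, mul_one] at this
    rw [← this, mul_assoc]
  -- The element k'_il h_i is written in two ways as i₂(·) i₁(·) h_l k_jl k_ij. By `ha` the
  -- i₁-factors coincide, so the i₂-factors do too, which is the required identity.
  · have e1 : B.i₂ (d'.a i j l x * Γ₂.act (d'.g j l x) (f i j x) * f j l x) *
        B.i₁ (c'.a i j l x * Γ₁.act (c'.g j l x) (e i j x) * e j l x) *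
          (h l x * k j l x * k i j x) = k' i l x * h i x := by
      rw [← B.i₂_i₁_mul, ← B.i₂_i₁_mul, ← k3' i j l x hi hj hl, mul_assoc _ _ (k' i j x),
        mul_assoc _ _ (h i x), mul_assoc _ _ (h i x), ← key i j x hi hj,
        ← mul_assoc (k' j l x), B.mul_i₂_i₁ (k' j l x), (k2' j l x hj hl).1, (k2' j l x hj hl).2,
        mul_assoc _ (k' j l x), ← mul_assoc (k' j l x), ← key j l x hj hl]
      simp only [mul_assoc]
    have e2 : B.i₂ (f i l x * Γ₂.act (B.p₂ (h l x)) (d.a i j l x)) *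
        B.i₁ (e i l x * Γ₁.act (B.p₁ (h l x)) (c.a i j l x)) *
          (h l x * k j l x * k i j x) = k' i l x * h i x := by
      rw [← B.i₂_i₁_mul, ← key i l x hi hl, ← k3 i j l x hi hj hl,
        mul_assoc (B.i₂ (d.a i j l x) * _), ← mul_assoc (h l x) (_ * _), B.mul_i₂_i₁ (h l x)]
      simp only [mul_assoc]
    rw [ha i j l x hi hj hl, ← e2] at e1
    exact B.i₂_injective (mul_right_cancel (mul_right_cancel e1))

/-- On a cover refining all three given ones, only a lift of h along p₁ is missing. As h_i lives on
single members of the cover, passing to small neighbourhoods of points is enough; paracompactness is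
not needed here. -/
theorem WeaklyRelates.cocycleEquiv (H : HasSmoothLifts B.i₂ B.p₁) {c c' : CocycleOnCover E X Γ₁}
    {d d' : CocycleOnCover E X Γ₂} (hd : B.WeaklyRelates c d) (hd' : B.WeaklyRelates c' d')
    (h : CocycleEquiv c c') : CocycleEquiv d d' := by
  obtain ⟨𝒱, r, s, hr, hs, hd⟩ := hd
  obtain ⟨𝒱', r', s', hr', hs', hd'⟩ := hd'
  obtain ⟨𝒲, q, q', hq, hq', h⟩ := cocycleEquiv_iff.1 h
  let 𝒴 := (𝒱.prod 𝒱').prod 𝒲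
  let a : 𝒴.ι → 𝒱.ι := fun y => y.1.1
  let a' : 𝒴.ι → 𝒱'.ι := fun y => y.1.2
  let b : 𝒴.ι → 𝒲.ι := fun y => y.2
  have ha : 𝒴.IsRefinement 𝒱 a := fun i x hx => hx.1.1
  have ha' : 𝒴.IsRefinement 𝒱' a' := fun i x hx => hx.1.2
  have hb : 𝒴.IsRefinement 𝒲 b := fun i x hx => hx.2
  -- The refinement maps through 𝒱 and 𝒱' differ from those through 𝒲, so the equivalence is
  -- corrected at both ends by the comparison of two refinement maps.
  obtain ⟨h, e, h1, h2, h3, h4⟩ : (c.2.restrict (r ∘ a) (ha.trans hr)).StrictEquiv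
      (c'.2.restrict (r' ∘ a') (ha'.trans hr')) :=
    ((c.2.restrict_strictEquiv (ha.trans hr) (hb.trans hq)).trans (h.restrict b hb)).trans
      (c'.2.restrict_strictEquiv (hb.trans hq') (ha'.trans hr'))
  have hloc : ∀ p : 𝒴.ι × X, ∃ W : Set X, IsOpen W ∧ W ⊆ 𝒴.U p.1 ∧ (p.2 ∈ 𝒴.U p.1 → p.2 ∈ W) ∧
      ∃ f' : X → B.K, ContMDiffOn 𝓘(ℝ, E) B.K.I ∞ f' W ∧ ∀ y ∈ W, B.p₁ (f' y) = h p.1 y := by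
    rintro ⟨i, x⟩
    by_cases hx : x ∈ 𝒴.U i
    · obtain ⟨W, hW, hxW, hWU, hf⟩ := H.exists_local_lift (𝒴.U i).2 (h1 i) hx
      exact ⟨W, hW, hWU, fun _ => hxW, hf⟩
    · exact ⟨∅, isOpen_empty, empty_subset _, fun h => (hx h).elim, fun _ => 1,
        contMDiffOn_const, fun y hy => hy.elim⟩
  choose W hW hWU hxW f hf hpf using hloc
  have : ∀ x, ∃ i, x ∈ 𝒴.U i := 𝒴.cover
  choose m hm using this
  -- The new cover is indexed by the points of X; around x it uses the set on which h for the chosen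
  -- index m(x) lifts.
  let 𝒵 : OpenCover X := ⟨X, fun x => ⟨W (m x, x), hW _⟩, fun x => ⟨x, hxW (m x, x) (hm x)⟩⟩
  have hz : 𝒵.IsRefinement 𝒴 m := fun x => hWU (m x, x)
  have key := Relates.strictEquiv H ((hd.restrict a ha).restrict (𝒱 := 𝒵) m hz)
    ((hd'.restrict a' ha').restrict m hz) (h := fun x => f (m x, x))
    (e := fun x y => e (m x) (m y)) (fun x => hf (m x, x))
    (fun x y => (h2 (m x) (m y)).mono (inter_subset_inter (hz x) (hz y)))
    (fun i j x hi hj => by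
      rw [hpf _ x hi, hpf _ x hj]; exact h3 _ _ x (hz i hi) (hz j hj))
    (fun i j l x hi hj hl => by
      rw [hpf _ x hl]; exact h4 _ _ _ x (hz i hi) (hz j hj) (hz l hl))
  exact cocycleEquiv_iff.2 ⟨𝒵, s ∘ a ∘ m, s' ∘ a' ∘ m, (hz.trans ha).trans hs,
    (hz.trans ha').trans hs', key⟩

/-- A cocycle whose transition functions lift to the butterfly is related to some cocycle. -/
theorem exists_relates_of_lift (H : HasSmoothLifts B.i₂ B.p₁) (c : Cocycle E 𝒰 Γ₁)
    {k : 𝒰.ι → 𝒰.ι → X → B.K}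
    (hk : ∀ i j, ContMDiffOn 𝓘(ℝ, E) B.K.I ∞ (k i j) (𝒰.U i ∩ 𝒰.U j))
    (hp : ∀ i j x, x ∈ 𝒰.U i → x ∈ 𝒰.U j → B.p₁ (k i j x) = c.g i j x) :
    ∃ d : Cocycle E 𝒰 Γ₂, B.Relates c d := by
  -- The defect of the lifted cocycle identity is killed by p₁, because c satisfies that identity;
  -- its preimage under i₂ is the H₂-part of the new cocycle.
  have hlift : ∀ i j l, ∃ f : X → Γ₂.H,
      ContMDiffOn 𝓘(ℝ, E) Γ₂.H.I ∞ f (𝒰.U i ∩ 𝒰.U j ∩ 𝒰.U l) ∧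
      ∀ x ∈ (𝒰.U i ∩ 𝒰.U j ∩ 𝒰.U l : Set X), B.i₂ (f x) =
        k i l x * (B.i₁ (c.a i j l x) * k j l x * k i j x)⁻¹ := by
    intro i j l
    refine H.exists_kernel_lift B.exact₂₁.range_eq_ker ?_ ?_
    · exact ((hk i l).mono fun x hx => ⟨hx.1.1, hx.2⟩).mul
        (((B.exact₁₂.smooth_i.comp_contMDiffOn (c.smooth_a i j l)).mul
          ((hk j l).mono fun x hx => ⟨hx.1.2, hx.2⟩)).mul
            ((hk i j).mono fun x hx => hx.1)).inv
    · rintro x ⟨⟨hi, hj⟩, hl⟩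
      simp only [map_mul, map_inv]
      rw [hp _ _ x hi hl, hp _ _ x hj hl, hp _ _ x hi hj, B.p₁_i₁, c.cocycle_g i j l x hi hj hl,
        mul_inv_cancel]
  choose f hf hif using hlift
  have key : ∀ i j l x, x ∈ 𝒰.U i → x ∈ 𝒰.U j → x ∈ 𝒰.U l →
      B.i₂ (f i j l x) * B.i₁ (c.a i j l x) * (k j l x * k i j x) = k i l x := by
    intro i j l x hi hj hl
    rw [hif i j l x ⟨⟨hi, hj⟩, hl⟩]
    group
  refine ⟨⟨fun i j x => B.p₂ (k i j x), f, fun i j => B.exact₁₂.smooth_p.comp_contMDiffOn (hk i j),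
    hf, fun i j l x hi hj hl => ?_, fun i j l m x hi hj hl hm => ?_⟩, k, hk,
    fun i j x hi hj => ⟨hp i j x hi hj, rfl⟩, fun i j l x hi hj hl => ?_⟩
  · have := congrArg B.p₂ (key i j l x hi hj hl)
    simp only [map_mul] at this
    rw [B.p₂_i₁, B.p₂_i₂, mul_one] at this
    rw [← this, mul_assoc]
  -- Two decompositions of k_im over k_lm k_jl k_ij, through (i, l, m) and through (i, j, m). The
  -- i₁-factors agree by the cocycle condition for c, and cancelling leaves the one for f.
  · have e1 : B.i₂ (f i l m x * Γ₂.act (B.p₂ (k l m x)) (f i j l x)) *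
        B.i₁ (c.a i l m x * Γ₁.act (c.g l m x) (c.a i j l x)) *
          (k l m x * k j l x * k i j x) = k i m x := by
      rw [← B.i₂_i₁_mul, ← key i l m x hi hl hm, ← key i j l x hi hj hl,
        ← mul_assoc (k l m x) (_ * _), B.mul_i₂_i₁ (k l m x), hp l m x hl hm]
      simp only [mul_assoc]
    have e2 : B.i₂ (f i j m x * f j l m x) * B.i₁ (c.a i j m x * c.a j l m x) *
          (k l m x * k j l x * k i j x) = k i m x := by
      rw [← B.i₂_i₁_mul, ← key i j m x hi hj hm, ← key j l m x hj hl hm]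
      simp only [mul_assoc]
    rw [c.cocycle_a i j l m x hi hj hl hm, ← e2] at e1
    exact B.i₂_injective (mul_right_cancel (mul_right_cancel e1))
  · rw [mul_assoc, key i j l x hi hj hl]

end InvertibleButterfly

/-- Let smooth functions `g i j` be given on the overlaps of a cover, such that each of them lifts
locally. Then after a refinement all of them lift. -/
theorem exists_refinement_of_local {X : Type w} [TopologicalSpace X] [T2Space X] [ParacompactSpace X]
    (𝒰 : OpenCover X) (P : 𝒰.ι → 𝒰.ι → Set X → Prop)
    (hmono : ∀ i j s t, s ⊆ t → P i j t → P i j s) (hempty : ∀ i j, P i j ∅)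
    (hloc : ∀ i j x, x ∈ 𝒰.U i → x ∈ 𝒰.U j → ∃ W : Set X, IsOpen W ∧ x ∈ W ∧ P i j W) :
    ∃ (𝒱 : OpenCover X) (r : 𝒱.ι → 𝒰.ι), 𝒱.IsRefinement 𝒰 r ∧
      ∀ i j, P (r i) (r j) (𝒱.U i ∩ 𝒱.U j) := by
  -- A locally finite refinement U' is shrunk to V with closure of V_i inside U'_i. Local finiteness
  -- will leave finitely many conditions at each point, and the closures give room to avoid V_i when
  -- x is not adherent to it.
  obtain ⟨U', hU'o, hU'c, hU'f, hU'U⟩ := precise_refinement (fun i => (𝒰.U i : Set X))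
    (fun i => (𝒰.U i).2) (eq_univ_of_forall fun x => mem_iUnion.2 (𝒰.cover x))
  obtain ⟨V, hVc, hVo, hVU'⟩ := exists_iUnion_eq_closure_subset hU'o hU'f.point_finite hU'c
  have hcov : ∀ x, ∃ i, x ∈ V i := fun x => mem_iUnion.1 (hVc ▸ mem_univ x)
  choose r hr using hcov
  -- A neighbourhood of x small enough for P(r(x), i) to hold with respect to every i whose V_i it
  -- meets.
  have key : ∀ x : X, ∃ W : Set X, IsOpen W ∧ x ∈ W ∧ W ⊆ V (r x) ∧
      ∀ i, (W ∩ V i).Nonempty → P (r x) i W := by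
    intro x
    obtain ⟨T, hT, hTf⟩ := hU'f x
    have h1 : ∀ i, ∃ W ∈ 𝓝 x, (W ∩ V i).Nonempty → P (r x) i W := by
      intro i
      by_cases hx : x ∈ closure (V i)
      · obtain ⟨W, hW, hxW, hP⟩ := hloc (r x) i x
          (hU'U _ (hVU' _ (subset_closure (hr x)))) (hU'U _ (hVU' _ hx))
        exact ⟨W, hW.mem_nhds hxW, fun _ => hP⟩
      · refine ⟨(closure (V i))ᶜ, isClosed_closure.isOpen_compl.mem_nhds hx, ?_⟩
        rintro ⟨y, hy, hy'⟩
        exact (hy (subset_closure hy')).elim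
    choose W hW hWP using h1
    -- Inside T only finitely many U'_i, hence finitely many V_i, can be met, so a finite
    -- intersection suffices.
    let W₀ := interior (T ∩ V (r x) ∩ ⋂ i ∈ {i | (U' i ∩ T).Nonempty}, W i)
    have hsub : W₀ ⊆ T ∩ V (r x) ∩ ⋂ i ∈ {i | (U' i ∩ T).Nonempty}, W i := interior_subset
    refine ⟨W₀, isOpen_interior, ?_, fun y hy => (hsub hy).1.2, ?_⟩
    · exact mem_interior_iff_mem_nhds.2 (Filter.inter_mem (Filter.inter_mem hT
        ((hVo _).mem_nhds (hr x))) ((Filter.biInter_mem hTf).2 fun i _ => hW i))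
    · rintro i ⟨y, hy, hyi⟩
      have hi : (U' i ∩ T).Nonempty := ⟨y, hVU' _ (subset_closure hyi), (hsub hy).1.1⟩
      have hWi : W₀ ⊆ W i := fun z hz => mem_iInter₂.1 (hsub hz).2 i hi
      exact hmono _ _ _ _ hWi (hWP i ⟨y, hWi hy, hyi⟩)
  choose W hWo hxW hWV hWP using key
  refine ⟨⟨X, fun x => ⟨W x, hWo x⟩, fun x => ⟨x, hxW x⟩⟩, r,
    fun x y hy => hU'U _ (hVU' _ (subset_closure (hWV x hy))), fun x y => ?_⟩
  change P (r x) (r y) (W x ∩ W y)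
  rcases (W x ∩ W y).eq_empty_or_nonempty with h | ⟨z, hz⟩
  · rw [h]; exact hempty _ _
  -- A common point of W_x and W_y lies in V_{r(y)}, so W_x meets V_{r(y)} and P(r(x), r(y)) holds
  -- on all of W_x.
  · exact hmono _ _ _ _ inter_subset_left (hWP x (r y) ⟨z, hz.1, hWV y hz.2⟩)

/-! ### The induced bijection on nonabelian cohomology -/

namespace InvertibleButterfly

variable {Γ₁ : LieCrossedModule.{u₁, v₁}} {Γ₂ : LieCrossedModule.{u₂, v₂}}
  (B : InvertibleButterfly.{u, u₁, v₁, u₂, v₂} Γ₁ Γ₂)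
  {E : Type v} [NormedAddCommGroup E] [NormedSpace ℝ E]
  {X : Type w} [TopologicalSpace X] [ChartedSpace E X] [T2Space X] [ParacompactSpace X]

variable {B}

/-- Paracompactness enters here: each g_ij lifts only near points, and the cover must be refined so
that all overlaps carry lifts simultaneously. -/
theorem exists_weaklyRelates (H : HasSmoothLifts B.i₂ B.p₁) (c : CocycleOnCover E X Γ₁) :
    ∃ d : CocycleOnCover E X Γ₂, B.WeaklyRelates c d := by
  obtain ⟨𝒱, r, hr, hP⟩ := exists_refinement_of_local c.1
    (fun i j s => ∃ f : X → B.K, ContMDiffOn 𝓘(ℝ, E) B.K.I ∞ f s ∧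
      ∀ y ∈ s, B.p₁ (f y) = c.2.g i j y)
    (fun i j s t hst ⟨f, hf, hp⟩ => ⟨f, hf.mono hst, fun y hy => hp y (hst hy)⟩)
    (fun i j => ⟨fun _ => 1, contMDiffOn_const, fun y hy => hy.elim⟩)
    (fun i j x hi hj => by
      obtain ⟨W, hW, hxW, -, hf⟩ := H.exists_local_lift ((c.1.U i).2.inter (c.1.U j).2)
        (c.2.smooth_g i j) ⟨hi, hj⟩
      exact ⟨W, hW, hxW, hf⟩)
  choose k hk hp using hP
  obtain ⟨d, hd⟩ := exists_relates_of_lift H (c.2.restrict r hr) hk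
    fun i j x hi hj => hp i j x ⟨hi, hj⟩
  exact ⟨⟨𝒱, d⟩, 𝒱, r, id, hr, .refl _, hd⟩

/-- The map on cohomology induced by a butterfly. -/
def cohomologyMap (H : HasSmoothLifts B.i₂ B.p₁) : CechH1 E X Γ₁ → CechH1 E X Γ₂ :=
  Quot.lift (fun c => Quot.mk _ (exists_weaklyRelates H c).choose) fun c c' h =>
    Quot.sound ((exists_weaklyRelates H c).choose_spec.cocycleEquiv H
      (exists_weaklyRelates H c').choose_spec h)

/-- Any related cocycle computes the map, because two cocycles related to the same c are equivalent.
-/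
theorem cohomologyMap_mk (H : HasSmoothLifts B.i₂ B.p₁) {c : CocycleOnCover E X Γ₁}
    {d : CocycleOnCover E X Γ₂} (h : B.WeaklyRelates c d) :
    cohomologyMap H (Quot.mk _ c) = Quot.mk _ d :=
  Quot.sound ((exists_weaklyRelates H c).choose_spec.cocycleEquiv H h (.refl c))

variable (E X) in
/-- The bijection on cohomology induced by an invertible butterfly. -/
def cohomologyEquiv (H : HasSmoothLifts B.i₂ B.p₁) (H' : HasSmoothLifts B.i₁ B.p₂) :
    CechH1 E X Γ₁ ≃ CechH1 E X Γ₂ where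
  toFun := cohomologyMap H
  invFun := cohomologyMap (B := B.swap) H'
  left_inv := by
    rintro ⟨c⟩
    obtain ⟨d, hd⟩ := exists_weaklyRelates H c
    rw [cohomologyMap_mk H hd, cohomologyMap_mk (B := B.swap) H' hd.swap]
  right_inv := by
    rintro ⟨d⟩
    obtain ⟨c, hc⟩ := exists_weaklyRelates (B := B.swap) H' d
    rw [cohomologyMap_mk (B := B.swap) H' hc]
    exact cohomologyMap_mk H hc.swap

end InvertibleButterfly

/-! ### Cohomology with values in `Bkˣ × (ℤ/2)_dis` -/

section Delta

variable {ι : Type w} {Y : Type u} {B : Type v₁} [CommGroup B]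

theorem cechDelta_zero (c : (Fin 1 → ι) → Y → B) (s : Fin 2 → ι) (x : Y) :
    cechDelta c s x = c ![s 1] x * (c ![s 0] x)⁻¹ := by
  have h0 : s ∘ (0 : Fin 2).succAbove = ![s 1] := by ext i; fin_cases i; rfl
  have h1 : s ∘ (1 : Fin 2).succAbove = ![s 0] := by ext i; fin_cases i; rfl
  simp [cechDelta, Fin.prod_univ_two, ← h0, h1]

theorem cechDelta_one (c : (Fin 2 → ι) → Y → B) (s : Fin 3 → ι) (x : Y) :
    cechDelta c s x = c ![s 1, s 2] x * (c ![s 0, s 2] x)⁻¹ * c ![s 0, s 1] x := by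
  have h0 : s ∘ (0 : Fin 3).succAbove = ![s 1, s 2] := by ext i; fin_cases i <;> rfl
  have h1 : s ∘ (1 : Fin 3).succAbove = ![s 0, s 2] := by ext i; fin_cases i <;> rfl
  have h2 : s ∘ (2 : Fin 3).succAbove = ![s 0, s 1] := by ext i; fin_cases i <;> rfl
  simp [cechDelta, Fin.prod_univ_three, ← h0, h1, h2]

theorem cechDelta_two (c : (Fin 3 → ι) → Y → B) (s : Fin 4 → ι) (x : Y) :
    cechDelta c s x = c ![s 1, s 2, s 3] x * (c ![s 0, s 2, s 3] x)⁻¹ * c ![s 0, s 1, s 3] x *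
      (c ![s 0, s 1, s 2] x)⁻¹ := by
  have h0 : s ∘ (0 : Fin 4).succAbove = ![s 1, s 2, s 3] := by ext i; fin_cases i <;> rfl
  have h1 : s ∘ (1 : Fin 4).succAbove = ![s 0, s 2, s 3] := by ext i; fin_cases i <;> rfl
  have h2 : s ∘ (2 : Fin 4).succAbove = ![s 0, s 1, s 3] := by ext i; fin_cases i <;> rfl
  have h3 : s ∘ (3 : Fin 4).succAbove = ![s 0, s 1, s 2] := by ext i; fin_cases i <;> rfl
  have e2 : ((-1 : ℤ) ^ (2 : ℕ)) = 1 := by norm_num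
  have e3 : ((-1 : ℤ) ^ (3 : ℕ)) = -1 := by norm_num
  simp [cechDelta, Fin.prod_univ_four, ← h0, h1, h2, h3, e2, e3]

end Delta

section Split

variable {E : Type v} [NormedAddCommGroup E] [NormedSpace ℝ E]
  {X : Type w} [TopologicalSpace X] [ChartedSpace E X]

section Ab

variable {F : Type u₁} [NormedAddCommGroup F] [NormedSpace ℝ F]
  {B : Type v₁} [CommGroup B] [TopologicalSpace B] [ChartedSpace F B]

theorem CechAb.sound_of_eqOn {n : ℕ} {c c' : AbCocycleOnCover E F B X (n + 1)} (𝒱 : OpenCover X)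
    {r : 𝒱.ι → c.1.ι} {r' : 𝒱.ι → c'.1.ι} (hr : 𝒱.IsRefinement c.1 r)
    (hr' : 𝒱.IsRefinement c'.1 r')
    (h : ∀ (s : Fin (n + 2) → 𝒱.ι), ∀ x ∈ 𝒱.inter s, c'.2.val (r' ∘ s) x = c.2.val (r ∘ s) x) :
    (Quot.mk _ c : CechAb E F B X n) = Quot.mk _ c' :=
  Quot.sound ⟨𝒱, r, r', fun _ _ => 1, hr, hr', fun _ => contMDiffOn_const, fun s x hx => by
    simp [h s x hx, cechDelta]⟩

variable {𝒰 : OpenCover X}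

theorem OpenCover.mem_inter_one {i : 𝒰.ι} {x : X} (hi : x ∈ 𝒰.U i) : x ∈ 𝒰.inter ![i] := by
  intro m; fin_cases m; exact hi

theorem OpenCover.mem_inter_two {i j : 𝒰.ι} {x : X} (hi : x ∈ 𝒰.U i) (hj : x ∈ 𝒰.U j) :
    x ∈ 𝒰.inter ![i, j] := by
  intro m; fin_cases m <;> assumption

theorem OpenCover.mem_inter_three {i j l : 𝒰.ι} {x : X} (hi : x ∈ 𝒰.U i) (hj : x ∈ 𝒰.U j)
    (hl : x ∈ 𝒰.U l) : x ∈ 𝒰.inter ![i, j, l] := by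
  intro m; fin_cases m <;> assumption

theorem OpenCover.mem_inter_four {i j l m : 𝒰.ι} {x : X} (hi : x ∈ 𝒰.U i) (hj : x ∈ 𝒰.U j)
    (hl : x ∈ 𝒰.U l) (hm : x ∈ 𝒰.U m) : x ∈ 𝒰.inter ![i, j, l, m] := by
  intro m; fin_cases m <;> assumption

/-- The alternating product is rearranged into the shape of the crossed-module cocycle condition;
the next lemma does the same one degree higher. -/
theorem AbCocycle.val_mul_val (c : AbCocycle E F B 𝒰 1) {i j l : 𝒰.ι} {x : X} (hi : x ∈ 𝒰.U i)
    (hj : x ∈ 𝒰.U j) (hl : x ∈ 𝒰.U l) :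
    c.val ![j, l] x * c.val ![i, j] x = c.val ![i, l] x := by
  have := c.closed _ x (OpenCover.mem_inter_three hi hj hl)
  rw [cechDelta_one] at this
  change c.val ![j, l] x * (c.val ![i, l] x)⁻¹ * c.val ![i, j] x = 1 at this
  rwa [mul_right_comm, mul_inv_eq_one] at this

theorem AbCocycle.val_mul_val_two (c : AbCocycle E F B 𝒰 2) {i j l m : 𝒰.ι} {x : X}
    (hi : x ∈ 𝒰.U i) (hj : x ∈ 𝒰.U j) (hl : x ∈ 𝒰.U l) (hm : x ∈ 𝒰.U m) :
    c.val ![i, l, m] x * c.val ![i, j, l] x = c.val ![i, j, m] x * c.val ![j, l, m] x := by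
  have := c.closed _ x (OpenCover.mem_inter_four hi hj hl hm)
  rw [cechDelta_two] at this
  change c.val ![j, l, m] x * (c.val ![i, l, m] x)⁻¹ * c.val ![i, j, m] x *
    (c.val ![i, j, l] x)⁻¹ = 1 at this
  rw [mul_inv_eq_one, mul_right_comm, mul_inv_eq_iff_eq_mul] at this
  rw [mul_comm, ← this, mul_comm]

end Ab

section UnitsZ2

variable {k : Type u} [RCLike k] {𝒰 𝒱 : OpenCover X}

/-- The `ℤ/2`-valued transition functions of a cocycle. -/
def Cocycle.sign (d : Cocycle E 𝒰 (unitsZ2 k)) : 𝒰.ι → 𝒰.ι → X → Z2 := d.g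

/-- The `kˣ`-valued functions of a cocycle. -/
def Cocycle.gerbe (d : Cocycle E 𝒰 (unitsZ2 k)) : 𝒰.ι → 𝒰.ι → 𝒰.ι → X → kˣ := d.a

theorem Cocycle.sign_mul_sign (d : Cocycle E 𝒰 (unitsZ2 k)) {i j l : 𝒰.ι} {x : X}
    (hi : x ∈ 𝒰.U i) (hj : x ∈ 𝒰.U j) (hl : x ∈ 𝒰.U l) :
    d.sign j l x * d.sign i j x = d.sign i l x :=
  (congrArg (fun z : Z2 => z * d.sign i j x) (one_mul (d.sign j l x))).symm.trans
    (d.cocycle_g i j l x hi hj hl)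

theorem Cocycle.gerbe_mul_gerbe (d : Cocycle E 𝒰 (unitsZ2 k)) {i j l m : 𝒰.ι} {x : X}
    (hi : x ∈ 𝒰.U i) (hj : x ∈ 𝒰.U j) (hl : x ∈ 𝒰.U l) (hm : x ∈ 𝒰.U m) :
    d.gerbe i l m x * d.gerbe i j l x = d.gerbe i j m x * d.gerbe j l m x :=
  d.cocycle_a i j l m x hi hj hl hm

/-- With trivial t and trivial action the two equations decouple: h occurs only in the first and e
only in the second. -/
theorem cocycleEquiv_unitsZ2_iff {d d' : CocycleOnCover E X (unitsZ2 k)} : CocycleEquiv d d' ↔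
    ∃ (𝒱 : OpenCover X) (r : 𝒱.ι → d.1.ι) (r' : 𝒱.ι → d'.1.ι)
    (h : 𝒱.ι → X → Z2) (e : 𝒱.ι → 𝒱.ι → X → kˣ),
    𝒱.IsRefinement d.1 r ∧ 𝒱.IsRefinement d'.1 r' ∧
    (∀ i, ContMDiffOn 𝓘(ℝ, E) 𝓘(ℝ, PUnit.{1}) ∞ (h i) (𝒱.U i)) ∧
    (∀ i j, ContMDiffOn 𝓘(ℝ, E) 𝓘(ℝ, k) ∞ (e i j) (𝒱.U i ∩ 𝒱.U j)) ∧
    (∀ i j x, x ∈ 𝒱.U i → x ∈ 𝒱.U j →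
      h j x * d.2.sign (r i) (r j) x = d'.2.sign (r' i) (r' j) x * h i x) ∧
    (∀ i j l x, x ∈ 𝒱.U i → x ∈ 𝒱.U j → x ∈ 𝒱.U l →
      d'.2.gerbe (r' i) (r' j) (r' l) x * e i j x * e j l x =
        e i l x * d.2.gerbe (r i) (r j) (r l) x) := by
  constructor
  · rintro ⟨𝒱, r, r', h, e, hr, hr', h1, h2, h3, h4⟩
    refine ⟨𝒱, r, r', h, e, hr, hr', h1, h2, fun i j x hi hj => ?_, h4⟩
    exact (congrArg (fun z : Z2 => z * d.2.sign (r i) (r j) x)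
      (one_mul (M := Z2) (h j x))).symm.trans (h3 i j x hi hj)
  · rintro ⟨𝒱, r, r', h, e, hr, hr', h1, h2, h3, h4⟩
    refine ⟨𝒱, r, r', h, e, hr, hr', h1, h2, fun i j x hi hj => ?_, h4⟩
    exact (congrArg (fun z : Z2 => z * d.2.sign (r i) (r j) x)
      (one_mul (M := Z2) (h j x))).trans (h3 i j x hi hj)

/-- The `ℤ/2`-valued part of a cocycle. -/
def Cocycle.parity (d : Cocycle E 𝒰 (unitsZ2 k)) : AbCocycle E PUnit.{1} Z2 𝒰 1 where
  val s := d.sign (s 0) (s 1)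
  smooth s := (d.smooth_g (s 0) (s 1)).mono fun x hx => ⟨hx 0, hx 1⟩
  closed s x hx := by
    rw [cechDelta_one]
    change d.sign (s 1) (s 2) x * (d.sign (s 0) (s 2) x)⁻¹ * d.sign (s 0) (s 1) x = 1
    rw [mul_right_comm, mul_inv_eq_one]
    exact d.sign_mul_sign (hx 0) (hx 1) (hx 2)

/-- The `kˣ`-valued part of a cocycle. -/
def Cocycle.scalar (d : Cocycle E 𝒰 (unitsZ2 k)) : AbCocycle E k kˣ 𝒰 2 where
  val s := d.gerbe (s 0) (s 1) (s 2)
  smooth s := (d.smooth_a (s 0) (s 1) (s 2)).mono fun x hx => ⟨⟨hx 0, hx 1⟩, hx 2⟩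
  closed s x hx := by
    rw [cechDelta_two]
    change d.gerbe (s 1) (s 2) (s 3) x * (d.gerbe (s 0) (s 2) (s 3) x)⁻¹ *
      d.gerbe (s 0) (s 1) (s 3) x * (d.gerbe (s 0) (s 1) (s 2) x)⁻¹ = 1
    rw [mul_inv_eq_one, mul_right_comm, mul_inv_eq_iff_eq_mul,
      mul_comm _ (d.gerbe (s 0) (s 2) (s 3) x),
      d.gerbe_mul_gerbe (hx 0) (hx 1) (hx 2) (hx 3), mul_comm]

/-- The classes of the two parts of a cocycle. -/
def splitClass : CechH1 E X (unitsZ2 k) → CechAb E PUnit.{1} Z2 X 0 × CechAb E k kˣ X 1 :=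
  Quot.lift (fun d => (CechAb.mk E d.2.parity, CechAb.mk E d.2.scalar)) (by
    intro d d' hdd
    obtain ⟨𝒱, r, r', h, e, hr, hr', h1, h2, h3, h4⟩ := cocycleEquiv_unitsZ2_iff.1 hdd
    refine Prod.ext (Quot.sound ⟨𝒱, r, r', fun s => h (s 0), hr, hr',
      fun s => (h1 (s 0)).mono fun x hx => hx 0, fun s x hx => ?_⟩)
      -- The equation a' e_ij e_jl = e_il a says that a' is a times the coboundary of e⁻¹, hence the
      -- inverse.
      (Quot.sound ⟨𝒱, r, r', fun s x => (e (s 0) (s 1) x)⁻¹, hr, hr',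
      fun s => ContMDiffOn.inv ((h2 (s 0) (s 1)).mono fun x hx => ⟨hx 0, hx 1⟩),
      fun s x hx => ?_⟩)
    · rw [cechDelta_zero]
      change d'.2.sign (r' (s 0)) (r' (s 1)) x =
        d.2.sign (r (s 0)) (r (s 1)) x * (h (s 1) x * (h (s 0) x)⁻¹)
      rw [← mul_assoc, eq_mul_inv_iff_mul_eq, ← h3 (s 0) (s 1) x (hx 0) (hx 1), mul_comm]
    · rw [cechDelta_one]
      change d'.2.gerbe (r' (s 0)) (r' (s 1)) (r' (s 2)) x =
        d.2.gerbe (r (s 0)) (r (s 1)) (r (s 2)) x * ((e (s 1) (s 2) x)⁻¹ *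
          ((e (s 0) (s 2) x)⁻¹)⁻¹ * (e (s 0) (s 1) x)⁻¹)
      rw [← mul_assoc, eq_mul_inv_iff_mul_eq, inv_inv, mul_comm (_)⁻¹, ← mul_assoc,
        eq_mul_inv_iff_mul_eq, h4 (s 0) (s 1) (s 2) x (hx 0) (hx 1) (hx 2), mul_comm])

/-- The cocycle with given parts. -/
def joinCocycle (ε : AbCocycle E PUnit.{1} Z2 𝒰 1) (y : AbCocycle E k kˣ 𝒱 2) :
    Cocycle E (𝒰.prod 𝒱) (unitsZ2 k) where
  g i j := ε.val ![i.1, j.1]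
  a i j l := y.val ![i.2, j.2, l.2]
  smooth_g _ _ := (ε.smooth _).mono fun _ hx => OpenCover.mem_inter_two hx.1.1 hx.2.1
  smooth_a _ _ _ := (y.smooth _).mono fun _ hx =>
    OpenCover.mem_inter_three hx.1.1.2 hx.1.2.2 hx.2.2
  cocycle_g i j _ x hi hj hl :=
    (congrArg (fun z : Z2 => z * ε.val ![i.1, j.1] x) (one_mul (M := Z2) _)).trans
      (ε.val_mul_val hi.1 hj.1 hl.1)
  cocycle_a _ _ _ _ _ hi hj hl hm := y.val_mul_val_two hi.2 hj.2 hl.2 hm.2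

theorem joinCocycle_congr_left {c c' : AbCocycleOnCover E PUnit.{1} Z2 X 1}
    (y : AbCocycle E k kˣ 𝒱 2) (h : Cohomologous c c') :
    CocycleEquiv (⟨_, joinCocycle c.2 y⟩ : CocycleOnCover E X (unitsZ2 k))
      ⟨_, joinCocycle c'.2 y⟩ := by
  obtain ⟨𝒲, r, r', b, hr, hr', hb, hd⟩ := h
  refine cocycleEquiv_unitsZ2_iff.2 ⟨𝒲.prod 𝒱, fun p => (r p.1, p.2), fun p => (r' p.1, p.2),
    fun p => b ![p.1], fun _ _ _ => 1, fun p x hx => ⟨hr _ hx.1, hx.2⟩,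
    fun p x hx => ⟨hr' _ hx.1, hx.2⟩,
    fun p => (hb _).mono fun x hx => OpenCover.mem_inter_one hx.1, fun _ _ => contMDiffOn_const,
    fun i j x hi hj => ?_, fun i j l x hi hj hl => ?_⟩
  · have e1 := hd ![i.1, j.1] x (OpenCover.mem_inter_two hi.1 hj.1)
    rw [cechDelta_zero] at e1
    have e2 : r ∘ ![i.1, j.1] = ![r i.1, r j.1] := by ext m; fin_cases m <;> rfl
    have e3 : r' ∘ ![i.1, j.1] = ![r' i.1, r' j.1] := by ext m; fin_cases m <;> rfl
    rw [e2, e3] at e1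
    change b ![j.1] x * c.2.val ![r i.1, r j.1] x = c'.2.val ![r' i.1, r' j.1] x * b ![i.1] x
    rw [e1]
    change _ = c.2.val ![r i.1, r j.1] x * (b ![j.1] x * (b ![i.1] x)⁻¹) * b ![i.1] x
    rw [mul_assoc, inv_mul_cancel_right, mul_comm]
  · change y.val ![i.2, j.2, l.2] x * (1 : kˣ) * 1 = 1 * y.val ![i.2, j.2, l.2] x
    rw [mul_one, mul_one, one_mul]

theorem joinCocycle_congr_right (ε : AbCocycle E PUnit.{1} Z2 𝒰 1)
    {c c' : AbCocycleOnCover E k kˣ X 2} (h : Cohomologous c c') :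
    CocycleEquiv (⟨_, joinCocycle ε c.2⟩ : CocycleOnCover E X (unitsZ2 k))
      ⟨_, joinCocycle ε c'.2⟩ := by
  obtain ⟨𝒲, r, r', b, hr, hr', hb, hd⟩ := h
  refine cocycleEquiv_unitsZ2_iff.2 ⟨𝒰.prod 𝒲, fun p => (p.1, r p.2), fun p => (p.1, r' p.2),
    fun _ _ => 1, fun p q x => (b ![p.2, q.2] x)⁻¹, fun p x hx => ⟨hx.1, hr _ hx.2⟩,
    fun p x hx => ⟨hx.1, hr' _ hx.2⟩, fun _ => contMDiffOn_const,
    fun p q => ContMDiffOn.inv ((hb _).mono fun x hx => OpenCover.mem_inter_two hx.1.2 hx.2.2),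
    fun i j x hi hj => ?_, fun i j l x hi hj hl => ?_⟩
  · change 1 * ε.val ![i.1, j.1] x = ε.val ![i.1, j.1] x * 1
    rw [mul_one, one_mul]
  · have e1 := hd ![i.2, j.2, l.2] x (OpenCover.mem_inter_three hi.2 hj.2 hl.2)
    rw [cechDelta_one] at e1
    have e2 : r ∘ ![i.2, j.2, l.2] = ![r i.2, r j.2, r l.2] := by ext m; fin_cases m <;> rfl
    have e3 : r' ∘ ![i.2, j.2, l.2] = ![r' i.2, r' j.2, r' l.2] := by ext m; fin_cases m <;> rfl
    rw [e2, e3] at e1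
    change c'.2.val ![r' i.2, r' j.2, r' l.2] x * (b ![i.2, j.2] x)⁻¹ * (b ![j.2, l.2] x)⁻¹ =
      (b ![i.2, l.2] x)⁻¹ * c.2.val ![r i.2, r j.2, r l.2] x
    rw [e1]
    change c.2.val ![r i.2, r j.2, r l.2] x * (b ![j.2, l.2] x * (b ![i.2, l.2] x)⁻¹ *
      b ![i.2, j.2] x) * (b ![i.2, j.2] x)⁻¹ * (b ![j.2, l.2] x)⁻¹ = _
    rw [mul_comm (b ![j.2, l.2] x), ← mul_assoc, mul_inv_cancel_right, ← mul_assoc,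
      mul_inv_cancel_right, mul_comm]

/-- The class with given parts. -/
def joinClass (p : CechAb E PUnit.{1} Z2 X 0 × CechAb E k kˣ X 1) : CechH1 E X (unitsZ2 k) :=
  Quot.lift (fun c => Quot.lift (fun y => CechH1.mk E (joinCocycle c.2 y.2))
      (fun _ _ h => Quot.sound (joinCocycle_congr_right c.2 h)) p.2)
    (fun c c' h => by
      obtain ⟨y, hy⟩ := Quot.exists_rep p.2
      rw [← hy]
      exact Quot.sound (joinCocycle_congr_left y.2 h)) p.1

variable (E X k) in
/-- Cohomology with values in `Bkˣ × (ℤ/2)_dis` is the product of two abelian cohomologies. -/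
def splitEquiv : CechH1 E X (unitsZ2 k) ≃ CechAb E PUnit.{1} Z2 X 0 × CechAb E k kˣ X 1 where
  toFun := splitClass
  invFun := joinClass
  left_inv := by
    rintro ⟨𝒰, d⟩
    -- Splitting and rejoining lives on the cover by all U_i ∩ U_j; restricted along the diagonal it
    -- is the original cocycle.
    refine Quot.sound (cocycleEquiv_iff.2 ⟨𝒰, fun i => (i, i), id, fun i x hx => ⟨hx, hx⟩,
      .refl _, .refl _⟩)
  right_inv := by
    rintro ⟨⟨c⟩, ⟨y⟩⟩
    refine Prod.ext (CechAb.sound_of_eqOn (c.1.prod y.1) (r := id) (r' := Prod.fst) (.refl _)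
      (OpenCover.isRefinement_fst _ _) fun s x hx => ?_)
      (CechAb.sound_of_eqOn (c.1.prod y.1) (r := id) (r' := Prod.snd) (.refl _)
      (OpenCover.isRefinement_snd _ _) fun s x hx => ?_)
    · exact congrArg (fun z => c.2.val z x) (by ext m; fin_cases m <;> rfl)
    · exact congrArg (fun z => y.2.val z x) (by ext m; fin_cases m <;> rfl)

theorem splitEquiv_mk {d : Cocycle E 𝒰 (unitsZ2 k)} {ε : AbCocycle E PUnit.{1} Z2 𝒰 1}
    {y : AbCocycle E k kˣ 𝒰 2} (hε : ∀ s, ∀ x ∈ 𝒰.inter s, ε.val s x = d.g (s 0) (s 1) x)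
    (hy : ∀ s, ∀ x ∈ 𝒰.inter s, y.val s x = d.a (s 0) (s 1) (s 2) x) :
    splitEquiv E X k (CechH1.mk E d) = (CechAb.mk E ε, CechAb.mk E y) :=
  Prod.ext (CechAb.sound_of_eqOn (c := ⟨𝒰, d.parity⟩) (c' := ⟨𝒰, ε⟩) 𝒰 (.refl _) (.refl _) hε)
    (CechAb.sound_of_eqOn (c := ⟨𝒰, d.scalar⟩) (c' := ⟨𝒰, y⟩) 𝒰 (.refl _) (.refl _) hy)

end UnitsZ2

end Split

/-! ### The parity involution -/

section Parity

variable {k : Type v} [RCLike k] {A : Type u} [NormedRing A] [NormedAlgebra k A]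
  (𝒜 : ZMod 2 → Submodule k A) [GradedAlgebra 𝒜]

theorem zmod_two_cases (j : ZMod 2) : j = 0 ∨ j = 1 := by
  revert j; decide

theorem exists_even_add_odd (a : A) : ∃ x ∈ 𝒜 0, ∃ y ∈ 𝒜 1, a = x + y := by
  induction a using DirectSum.Decomposition.inductionOn 𝒜 with
  | zero => exact ⟨0, zero_mem _, 0, zero_mem _, (add_zero 0).symm⟩
  | @homogeneous j m =>
    rcases zmod_two_cases j with rfl | rfl
    · exact ⟨m, m.2, 0, zero_mem _, (add_zero _).symm⟩
    · exact ⟨0, zero_mem _, m, m.2, (zero_add _).symm⟩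
  | add a b ha hb =>
    obtain ⟨x, hx, y, hy, rfl⟩ := ha
    obtain ⟨x', hx', y', hy', rfl⟩ := hb
    exact ⟨x + x', add_mem hx hx', y + y', add_mem hy hy', add_add_add_comm _ _ _ _⟩

/-- The parity involution, as a linear map. -/
def parityLin : A →ₗ[k] A := GradedAlgebra.proj 𝒜 0 - GradedAlgebra.proj 𝒜 1

theorem parityLin_even {a : A} (ha : a ∈ 𝒜 0) : parityLin 𝒜 a = a := by
  change (DirectSum.decompose 𝒜 a 0 : A) - (DirectSum.decompose 𝒜 a 1 : A) = a
  rw [DirectSum.decompose_of_mem_same 𝒜 ha, DirectSum.decompose_of_mem_ne 𝒜 ha (by decide), sub_zero]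

theorem parityLin_odd {a : A} (ha : a ∈ 𝒜 1) : parityLin 𝒜 a = -a := by
  change (DirectSum.decompose 𝒜 a 0 : A) - (DirectSum.decompose 𝒜 a 1 : A) = -a
  rw [DirectSum.decompose_of_mem_same 𝒜 ha, DirectSum.decompose_of_mem_ne 𝒜 ha (by decide), zero_sub]

theorem parityLin_parityLin (a : A) : parityLin 𝒜 (parityLin 𝒜 a) = a := by
  obtain ⟨x, hx, y, hy, rfl⟩ := exists_even_add_odd 𝒜 a
  simp only [map_add, parityLin_even 𝒜 hx, parityLin_odd 𝒜 hy, map_neg, neg_neg]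

theorem parityLin_mul (a b : A) : parityLin 𝒜 (a * b) = parityLin 𝒜 a * parityLin 𝒜 b := by
  obtain ⟨x, hx, y, hy, rfl⟩ := exists_even_add_odd 𝒜 a
  obtain ⟨x', hx', y', hy', rfl⟩ := exists_even_add_odd 𝒜 b
  have h1 : x * x' ∈ 𝒜 0 := SetLike.mul_mem_graded hx hx'
  have h2 : x * y' ∈ 𝒜 1 := SetLike.mul_mem_graded hx hy'
  have h3 : y * x' ∈ 𝒜 1 := SetLike.mul_mem_graded hy hx'
  have h4 : y * y' ∈ 𝒜 0 := SetLike.mul_mem_graded hy hy'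
  simp only [mul_add, add_mul, map_add, parityLin_even 𝒜 hx, parityLin_odd 𝒜 hy,
    parityLin_even 𝒜 hx', parityLin_odd 𝒜 hy', parityLin_even 𝒜 h1, parityLin_odd 𝒜 h2,
    parityLin_odd 𝒜 h3, parityLin_even 𝒜 h4]
  noncomm_ring

/-- The parity involution: the identity on even, minus the identity on odd elements. -/
def parity : A ≃ₐ[k] A :=
  AlgEquiv.ofLinearEquiv
    (LinearEquiv.ofInvolutive (parityLin 𝒜) (parityLin_parityLin 𝒜))
    (parityLin_even 𝒜 SetLike.GradedOne.one_mem) (parityLin_mul 𝒜)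

theorem parity_even {a : A} (ha : a ∈ 𝒜 0) : parity 𝒜 a = a := parityLin_even 𝒜 ha

theorem parity_odd {a : A} (ha : a ∈ 𝒜 1) : parity 𝒜 a = -a := parityLin_odd 𝒜 ha

theorem parity_parity (a : A) : parity 𝒜 (parity 𝒜 a) = a := parityLin_parityLin 𝒜 a

theorem parity_mul_parity : parity 𝒜 * parity 𝒜 = 1 := AlgEquiv.ext (parity_parity 𝒜)

theorem parity_of_mem {j : ZMod 2} {a : A} (ha : a ∈ 𝒜 j) :
    parity 𝒜 a = (-1 : k) ^ j.val • a := by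
  rcases zmod_two_cases j with rfl | rfl
  · rw [parity_even 𝒜 ha]; simp
  · rw [parity_odd 𝒜 ha, ZMod.val_one, pow_one, neg_smul, one_smul]

theorem two_smul_decompose_zero (a : A) :
    (2 : k) • (DirectSum.decompose 𝒜 a 0 : A) = a + parity 𝒜 a := by
  obtain ⟨x, hx, y, hy, rfl⟩ := exists_even_add_odd 𝒜 a
  rw [DirectSum.decompose_add, DirectSum.add_apply, Submodule.coe_add,
    DirectSum.decompose_of_mem_same 𝒜 hx, DirectSum.decompose_of_mem_ne 𝒜 hy (by decide), map_add,
    parity_even 𝒜 hx, parity_odd 𝒜 hy, two_smul]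
  abel

theorem two_smul_decompose_one (a : A) :
    (2 : k) • (DirectSum.decompose 𝒜 a 1 : A) = a - parity 𝒜 a := by
  obtain ⟨x, hx, y, hy, rfl⟩ := exists_even_add_odd 𝒜 a
  rw [DirectSum.decompose_add, DirectSum.add_apply, Submodule.coe_add,
    DirectSum.decompose_of_mem_same 𝒜 hy, DirectSum.decompose_of_mem_ne 𝒜 hx (by decide), map_add,
    parity_even 𝒜 hx, parity_odd 𝒜 hy, two_smul]
  abel

/-- As 2 is invertible, the graded pieces are exactly the eigenspaces of the parity involution;
homogeneity can be checked by an equation. -/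
theorem mem_of_parity {j : ZMod 2} {a : A} (ha : parity 𝒜 a = (-1 : k) ^ j.val • a) :
    a ∈ 𝒜 j := by
  have h2 : (2 : k) ≠ 0 := two_ne_zero
  rcases zmod_two_cases j with rfl | rfl
  · have := two_smul_decompose_zero 𝒜 a
    rw [ha, ZMod.val_zero, pow_zero, one_smul, ← two_smul k] at this
    rw [← smul_right_injective _ h2 this]
    exact SetLike.coe_mem _
  · have := two_smul_decompose_one 𝒜 a
    rw [ha, ZMod.val_one, pow_one, neg_smul, one_smul, sub_neg_eq_add, ← two_smul k] at this
    rw [← smul_right_injective _ h2 this]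
    exact SetLike.coe_mem _

/-- The `j`-th power of the parity involution. -/
def twist (j : ZMod 2) : A ≃ₐ[k] A := parity 𝒜 ^ j.val

theorem twist_zero : twist 𝒜 0 = 1 := pow_zero _

theorem twist_one : twist 𝒜 1 = parity 𝒜 := pow_one _

theorem twist_add (i j : ZMod 2) : twist 𝒜 (i + j) = twist 𝒜 i * twist 𝒜 j := by
  rcases zmod_two_cases i with rfl | rfl <;> rcases zmod_two_cases j with rfl | rfl
  · simp [twist_zero]
  · simp [twist_zero]
  · simp [twist_zero]
  · rw [show (1 + 1 : ZMod 2) = 0 from rfl, twist_zero, twist_one, parity_mul_parity]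

theorem twist_add_apply (i j : ZMod 2) (a : A) :
    twist 𝒜 (i + j) a = twist 𝒜 i (twist 𝒜 j a) := by
  rw [twist_add]; rfl

/-- The sign (-1)^{ij} is the value of an algebra automorphism, so sign rules become identities
between automorphisms valid for all elements. -/
theorem twist_of_mem (i : ZMod 2) {j : ZMod 2} {a : A} (ha : a ∈ 𝒜 j) :
    twist 𝒜 i a = (-1 : k) ^ (i.val * j.val) • a := by
  rcases zmod_two_cases i with rfl | rfl
  · rw [twist_zero]; simp
  · rw [twist_one, parity_of_mem 𝒜 ha, ZMod.val_one, one_mul]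

theorem twist_mem (i : ZMod 2) {j : ZMod 2} {a : A} (ha : a ∈ 𝒜 j) : twist 𝒜 i a ∈ 𝒜 j := by
  rw [twist_of_mem 𝒜 i ha]
  exact (𝒜 j).smul_mem _ ha

theorem twist_twist (i : ZMod 2) (a : A) : twist 𝒜 i (twist 𝒜 i a) = a := by
  rw [← twist_add_apply, CharTwo.add_self_eq_zero, twist_zero]; rfl

theorem parity_twist (i : ZMod 2) (a : A) :
    parity 𝒜 (twist 𝒜 i a) = twist 𝒜 i (parity 𝒜 a) := by
  rw [← twist_one, ← twist_add_apply, add_comm, twist_add_apply]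

variable {𝒜}

/-! ### Central simple super algebras -/

namespace IsCentralSimple

/-- Such an S is a graded two-sided ideal, since the components of x are (x ± σ(x))/2. Being
nonzero, it is all of A by simplicity. -/
theorem one_mem (hcs : IsCentralSimple 𝒜) (S : AddSubgroup A) (hl : ∀ a, ∀ x ∈ S, a * x ∈ S)
    (hr : ∀ a, ∀ x ∈ S, x * a ∈ S) (hp : ∀ x ∈ S, parity 𝒜 x ∈ S) {z : A} (hz : z ∈ S)
    (hz0 : z ≠ 0) : (1 : A) ∈ S := by
  let I : TwoSidedIdeal A := TwoSidedIdeal.mk' S S.zero_mem S.add_mem S.neg_mem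
    (fun {x y} hy => hl x y hy) (fun {x y} hx => hr y x hx)
  have hI : ∀ x, x ∈ I ↔ x ∈ S := fun x => TwoSidedIdeal.mem_mk' ..
  have hs : ∀ (c : k), ∀ x ∈ S, c • x ∈ S := fun c x hx => by
    rw [Algebra.smul_def]; exact hl _ _ hx
  have h2 : (2 : k)⁻¹ * 2 = 1 := inv_mul_cancel₀ two_ne_zero
  have hgr : ∀ a ∈ I, ∀ i, (DirectSum.decompose 𝒜 a i : A) ∈ I := by
    intro a ha i
    rw [hI] at ha ⊢
    rcases zmod_two_cases i with rfl | rfl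
    · rw [← one_smul k (DirectSum.decompose 𝒜 a 0 : A), ← h2, mul_smul, two_smul_decompose_zero]
      exact hs _ _ (S.add_mem ha (hp a ha))
    · rw [← one_smul k (DirectSum.decompose 𝒜 a 1 : A), ← h2, mul_smul, two_smul_decompose_one]
      exact hs _ _ (S.sub_mem ha (hp a ha))
  rcases hcs.simple I hgr with h | h
  · exact (hz0 (by rw [← TwoSidedIdeal.mem_bot, ← h, hI]; exact hz)).elim
  · rw [← hI, h]; trivial

/-- A nonzero homogeneous normal element is invertible. -/
theorem isUnit_of_normal (hcs : IsCentralSimple 𝒜) {j : ZMod 2} {z : A} (hz : z ∈ 𝒜 j)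
    (hz0 : z ≠ 0) (α : A ≃ₐ[k] A) (h : ∀ c, c * z = z * α c) : IsUnit z := by
  -- The left ideal Az is two-sided because z a = α⁻¹(a) z, and stable under parity because z is
  -- homogeneous. So xz = 1 for some x, and normality turns this into the right inverse α(x).
  let S : AddSubgroup A := (AddMonoidHom.mulRight z).range
  obtain ⟨x, hx⟩ : (1 : A) ∈ S := by
    refine hcs.one_mem S ?_ ?_ ?_ (z := z) ⟨1, one_mul z⟩ hz0
    · rintro a _ ⟨x, rfl⟩
      exact ⟨a * x, mul_assoc _ _ _⟩
    · rintro a _ ⟨x, rfl⟩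
      refine ⟨x * α.symm a, ?_⟩
      change x * α.symm a * z = x * z * a
      rw [mul_assoc, h, α.apply_symm_apply, mul_assoc]
    · rintro _ ⟨x, rfl⟩
      refine ⟨(-1 : k) ^ j.val • parity 𝒜 x, ?_⟩
      change ((-1 : k) ^ j.val • parity 𝒜 x) * z = parity 𝒜 (x * z)
      rw [map_mul, parity_of_mem 𝒜 hz, smul_mul_assoc, mul_smul_comm]
  have hx : x * z = 1 := hx
  have hx' : z * α x = 1 := by rw [← h, hx]
  exact ⟨⟨z, x, by rw [left_inv_eq_right_inv hx hx'] ; exact hx', hx⟩, rfl⟩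

/-! ### Linear independence of the twisted two-sided multiplications -/

section Independence

variable {ι : Type w} [Fintype ι]

variable (𝒜) in
/-- The operator `x ↦ ∑ i, a i * σ^(d i) x * b i`, where `σ` is the parity involution. -/
def sandwich (d : ι → ZMod 2) (b : ι → A) : (ι → A) →ₗ[k] (A →ₗ[k] A) where
  toFun a := ∑ i, (LinearMap.mulLeft k (a i)) ∘ₗ (LinearMap.mulRight k (b i)) ∘ₗ
    (twist 𝒜 (d i)).toLinearMap
  map_add' a a' := by
    ext x; simp [add_mul, Finset.sum_add_distrib]
  map_smul' c a := by
    ext x; simp [Finset.smul_sum]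

theorem sandwich_apply (d : ι → ZMod 2) (b a : ι → A) (x : A) :
    sandwich 𝒜 d b a x = ∑ i, a i * (twist 𝒜 (d i) x * b i) := by
  simp [sandwich]

/-- This and the next two lemmas are symmetries of the space of relations: left multiplication,
twisted right multiplication, and signed parity. They make the coefficients that occur at a fixed
index a graded ideal. -/
theorem sandwich_mul_left (d : ι → ZMod 2) (b a : ι → A) (c x : A) :
    sandwich 𝒜 d b (fun i => c * a i) x = c * sandwich 𝒜 d b a x := by
  simp only [sandwich_apply, Finset.mul_sum, mul_assoc]

theorem sandwich_mul_right (d : ι → ZMod 2) (b a : ι → A) (c x : A) :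
    sandwich 𝒜 d b (fun i => a i * twist 𝒜 (d i) c) x = sandwich 𝒜 d b a (c * x) := by
  simp only [sandwich_apply, mul_assoc, map_mul]

theorem sandwich_parity {d : ι → ZMod 2} {b : ι → A} (hb : ∀ i, b i ∈ 𝒜 (d i)) (a : ι → A)
    (x : A) : sandwich 𝒜 d b (fun i => (-1 : k) ^ (d i).val • parity 𝒜 (a i)) x =
      parity 𝒜 (sandwich 𝒜 d b a (parity 𝒜 x)) := by
  simp only [sandwich_apply, map_sum, map_mul]
  refine Finset.sum_congr rfl fun i _ => ?_
  rw [parity_of_mem 𝒜 (hb i), parity_twist, parity_parity, mul_smul_comm, mul_smul_comm,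
    smul_mul_assoc]

theorem neg_one_pow_mul_self (n : ℕ) : (-1 : k) ^ n * (-1) ^ n = 1 := by
  rw [← mul_pow]; simp

/-- Shortest-relation argument. In a nonzero relation of minimal support one coefficient may be
normalised to 1. Commutators with elements of A are shorter relations, hence zero, and this forces
every coefficient to be a scalar. Evaluation at 1 is then a linear relation between the b_i. -/
theorem sandwich_injective (hcs : IsCentralSimple 𝒜) {d : ι → ZMod 2} {b : ι → A}
    (hb : ∀ i, b i ∈ 𝒜 (d i)) (hli : LinearIndependent k b) :
    Function.Injective (sandwich 𝒜 d b) := by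
  classical
  have hnt := hcs.nontrivial
  rw [injective_iff_map_eq_zero]
  intro a ha
  induction hn : (Finset.univ.filter fun i => a i ≠ 0).card using Nat.strong_induction_on
    generalizing a with
  | _ n ih =>
  subst hn
  by_contra hne
  obtain ⟨i₀, hi₀⟩ := Function.ne_iff.1 hne
  -- Minimality: a relation supported inside the support of a and vanishing at i₀ has strictly
  -- smaller support, so the induction applies.
  have hmin : ∀ a' : ι → A, (∀ i, a i = 0 → a' i = 0) → a' i₀ = 0 → sandwich 𝒜 d b a' = 0 →
      a' = 0 := by
    intro a' hs h0 hN
    refine ih _ (Finset.card_lt_card ?_) a' hN rfl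
    refine Finset.ssubset_iff_subset_ne.2 ⟨fun i hi => ?_, fun he => ?_⟩
    · simp only [Finset.mem_filter, Finset.mem_univ, true_and] at hi ⊢
      exact fun h => hi (hs i h)
    · have : i₀ ∈ Finset.univ.filter fun i => a i ≠ 0 := by simpa using hi₀
      rw [← he] at this
      simp [h0] at this
  let T : AddSubgroup (ι → A) :=
    { carrier := {a' | (∀ i, a i = 0 → a' i = 0) ∧ sandwich 𝒜 d b a' = 0}
      zero_mem' := ⟨fun _ _ => rfl, map_zero _⟩
      add_mem' := fun {x y} hx hy => ⟨fun i hi => by simp [hx.1 i hi, hy.1 i hi],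
        by rw [map_add, hx.2, hy.2, add_zero]⟩
      neg_mem' := fun {x} hx => ⟨fun i hi => by simp [hx.1 i hi], by rw [map_neg, hx.2, neg_zero]⟩ }
  have hTl : ∀ (c : A), ∀ a' ∈ T, (fun i => c * a' i) ∈ T := fun c a' h =>
    ⟨fun i hi => by simp [h.1 i hi], LinearMap.ext fun x => by
      rw [sandwich_mul_left, h.2]; simp⟩
  have hTr : ∀ (c : A), ∀ a' ∈ T, (fun i => a' i * twist 𝒜 (d i) c) ∈ T := fun c a' h =>
    ⟨fun i hi => by simp [h.1 i hi], LinearMap.ext fun x => by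
      rw [sandwich_mul_right, h.2]; simp⟩
  have hTp : ∀ a' ∈ T, (fun i => (-1 : k) ^ (d i).val • parity 𝒜 (a' i)) ∈ T := fun a' h =>
    ⟨fun i hi => by simp [h.1 i hi], LinearMap.ext fun x => by
      rw [sandwich_parity hb, h.2]; simp⟩
  have hTs : ∀ (c : k), ∀ a' ∈ T, c • a' ∈ T := fun c a' h =>
    ⟨fun i hi => by simp [h.1 i hi], by rw [map_smul, h.2, smul_zero]⟩
  obtain ⟨a', ha', ha'1⟩ : (1 : A) ∈ T.map (Pi.evalAddMonoidHom (fun _ : ι => A) i₀) := by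
    refine hcs.one_mem _ ?_ ?_ ?_ (z := a i₀) ⟨a, ⟨fun _ h => h, ha⟩, rfl⟩ hi₀
    · rintro c _ ⟨y, hy, rfl⟩
      exact ⟨_, hTl c y hy, rfl⟩
    · rintro c _ ⟨y, hy, rfl⟩
      refine ⟨_, hTr (twist 𝒜 (d i₀) c) y hy, ?_⟩
      change y i₀ * twist 𝒜 (d i₀) (twist 𝒜 (d i₀) c) = y i₀ * c
      rw [twist_twist]
    · rintro _ ⟨y, hy, rfl⟩
      refine ⟨_, hTs ((-1) ^ (d i₀).val) _ (hTp y hy), ?_⟩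
      change (-1 : k) ^ (d i₀).val • (-1 : k) ^ (d i₀).val • parity 𝒜 (y i₀) = parity 𝒜 (y i₀)
      rw [smul_smul, neg_one_pow_mul_self, one_smul]
  have ha'1 : a' i₀ = 1 := ha'1
  -- The difference of the right and left multiples is again a relation, and it vanishes at i₀
  -- because a'(i₀) = 1.
  have hcomm : ∀ c i, a' i * twist 𝒜 (d i) c = twist 𝒜 (d i₀) c * a' i := by
    intro c i
    have hm := T.sub_mem (hTr c a' ha') (hTl (twist 𝒜 (d i₀) c) a' ha')
    have := hmin _ hm.1 (by simp [ha'1]) hm.2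
    exact sub_eq_zero.1 (congrFun this i)
  have hpar : ∀ i, (-1 : k) ^ (d i₀).val • (-1 : k) ^ (d i).val • parity 𝒜 (a' i) = a' i := by
    intro i
    have hm := T.sub_mem (hTs ((-1) ^ (d i₀).val) _ (hTp a' ha')) ha'
    have := hmin _ hm.1 (by simp [ha'1, smul_smul, neg_one_pow_mul_self]) hm.2
    exact sub_eq_zero.1 (congrFun this i)
  -- The same minimality, applied to signed parity minus the identity, makes each coefficient a
  -- parity eigenvector.
  have hdeg : ∀ i, a' i ∈ 𝒜 (d i + d i₀) := by
    intro i
    refine mem_of_parity 𝒜 ?_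
    have h1 : (-1 : k) ^ (d i + d i₀).val = (-1 : k) ^ (d i).val * (-1) ^ (d i₀).val := by
      rcases zmod_two_cases (d i) with h | h <;> rcases zmod_two_cases (d i₀) with h' | h' <;>
        rw [h, h'] <;> simp [ZMod.val_one, show (1 + 1 : ZMod 2) = 0 from rfl]
    conv_rhs => rw [← hpar i]
    rw [h1, smul_smul, smul_smul, mul_assoc ((-1 : k) ^ (d i).val),
      neg_one_pow_mul_self, mul_one, neg_one_pow_mul_self, one_smul]
  have hscal : ∀ i, ∃ c : k, a' i = algebraMap k A c := by
    intro i
    by_cases hi : d i = d i₀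
    · refine hcs.central _ ?_ fun c => ?_
      · have := hdeg i
        rwa [hi, CharTwo.add_self_eq_zero] at this
      · have := hcomm (twist 𝒜 (d i₀) c) i
        rwa [hi, twist_twist] at this
    · have hodd : d i + d i₀ = 1 := by
        rcases zmod_two_cases (d i) with h | h <;> rcases zmod_two_cases (d i₀) with h' | h' <;>
          rw [h, h'] at hi ⊢ <;> simp at hi ⊢
      have hm : a' i ∈ 𝒜 1 := hodd ▸ hdeg i
      have hc : ∀ c, c * a' i = a' i * parity 𝒜 c := by
        intro c
        have := hcomm (twist 𝒜 (d i₀) c) i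
        rw [twist_twist, ← twist_add_apply, hodd, twist_one] at this
        exact this.symm
      -- An odd z with cz = zσ(c) for all c satisfies z² = -z², so it squares to zero. A nonzero one
      -- would be a unit by normality, so odd coefficients vanish.
      have hsq : a' i * a' i = 0 := by
        have := hc (a' i)
        rw [parity_odd 𝒜 hm, mul_neg, eq_neg_iff_add_eq_zero, ← two_smul k] at this
        exact (smul_eq_zero.1 this).resolve_left two_ne_zero
      by_cases h0 : a' i = 0
      · exact ⟨0, by rw [h0, map_zero]⟩
      · exact (h0 ((hcs.isUnit_of_normal hm h0 (parity 𝒜) hc).mul_right_eq_zero.1 hsq)).elim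
  choose c hc using hscal
  have hsum := LinearMap.congr_fun ha'.2 1
  rw [sandwich_apply] at hsum
  simp only [hc, map_one, one_mul, ← Algebra.smul_def, LinearMap.zero_apply] at hsum
  have := Fintype.linearIndependent_iff.1 hli c hsum i₀
  rw [hc, this, map_zero] at ha'1
  exact zero_ne_one ha'1

end Independence

end IsCentralSimple

end Parity

/-! ### The Casimir element and the Skolem–Noether theorem -/

section SkolemNoether

variable {k : Type v} [RCLike k] {A : Type u} [NormedRing A] [NormedAlgebra k A]
  [FiniteDimensional k A] {𝒜 : ZMod 2 → Submodule k A} [GradedAlgebra 𝒜]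

variable (𝒜) in
theorem exists_homogeneous_basis : ∃ (ι : Type) (_ : Fintype ι) (d : ι → ZMod 2)
    (b : Module.Basis ι k A), (∀ i, b i ∈ 𝒜 (d i)) ∧
      ∀ j, ∀ x ∈ 𝒜 j, ∀ i, d i ≠ j → b.repr x i = 0 := by
  have h := DirectSum.Decomposition.isInternal 𝒜
  refine ⟨Σ j : ZMod 2, Fin (Module.finrank k (𝒜 j)), inferInstance, Sigma.fst,
    h.collectedBasis fun j => Module.finBasis k (𝒜 j), h.collectedBasis_mem _, ?_⟩
  rintro j x hx ⟨i, a⟩ hij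
  exact h.collectedBasis_repr_of_mem_ne _ (Ne.symm hij) hx

/-- A functional not vanishing at 1, averaged over the parity involution, which fixes 1. -/
theorem exists_even_functional [Nontrivial A] : ∃ f : A →ₗ[k] k, f 1 = 1 ∧
    ∀ x, f (parity 𝒜 x) = f x := by
  obtain ⟨g, -, hg⟩ := exists_dual_vector k (1 : A) (norm_ne_zero_iff.2 one_ne_zero)
  have h1 : (‖(1 : A)‖ : k) ≠ 0 := by simp
  -- The dual vector g satisfies g(1) = ‖1‖, and ‖1‖ need not be 1; the factor 1/2 averages.
  refine ⟨(2⁻¹ * (‖(1 : A)‖ : k)⁻¹) • ((g : A →ₗ[k] k) +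
    (g : A →ₗ[k] k) ∘ₗ (parity 𝒜).toLinearMap), ?_, fun x => ?_⟩
  · have h2 : (2 : k) ≠ 0 := two_ne_zero
    simp [hg]
    field_simp
    norm_num
  · simp [parity_parity, add_comm]

namespace IsCentralSimple

/-- The Casimir element `∑ a i ⊗ b i` of a central simple super algebra. It commutes with `A`. -/
theorem exists_casimir (hcs : IsCentralSimple 𝒜) : ∃ (ι : Type) (_ : Fintype ι) (d : ι → ZMod 2)
    (b : Module.Basis ι k A) (a : ι → A), (∀ i, b i ∈ 𝒜 (d i)) ∧ (∀ i, a i ∈ 𝒜 (d i)) ∧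
      ∑ i, a i * b i = 1 ∧ ∀ j, ∀ c ∈ 𝒜 j, ∀ (φ : A →ₗ[k] A) (y : A),
        c * ∑ i, a i * (twist 𝒜 (d i) y * φ (b i)) =
          ∑ i, a i * (twist 𝒜 (d i) (twist 𝒜 j y) * φ (b i * c)) := by
  have hnt := hcs.nontrivial
  obtain ⟨ι, _, d, b, hb, hrepr⟩ := exists_homogeneous_basis 𝒜
  obtain ⟨f, hf1, hfp⟩ := exists_even_functional (k := k) (𝒜 := 𝒜)
  have hinj := hcs.sandwich_injective hb b.linearIndependent
  -- Both sides have dimension (dim A)², so injectivity gives surjectivity.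
  have hsurj : Function.Surjective (sandwich 𝒜 d b) := by
    refine (LinearMap.injective_iff_surjective_of_finrank_eq_finrank ?_).1 hinj
    rw [Module.finrank_pi_fintype, Module.finrank_linearMap, Module.finrank_eq_card_basis b]
    simp
  -- The coefficients a_i represent x ↦ f(x)·1. Evaluating at 1 gives ∑ a_i b_i = 1, and since f is
  -- even, uniqueness of the coefficients makes a_i homogeneous of degree d_i.
  obtain ⟨a, ha⟩ := hsurj (f.smulRight 1)
  have hax : ∀ x, sandwich 𝒜 d b a x = f x • 1 := fun x => by rw [ha]; rfl
  refine ⟨ι, inferInstance, d, b, a, hb, fun i => mem_of_parity 𝒜 ?_, ?_, fun j c hc φ y => ?_⟩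
  · have h1 : (fun i => (-1 : k) ^ (d i).val • parity 𝒜 (a i)) = a := hinj <|
      LinearMap.ext fun x => by
        rw [sandwich_parity hb, hax, hax, map_smul, map_one, hfp]
    rw [← congrFun h1 i]
    simp only [map_smul, parity_parity]
    rw [congrFun h1 i]
  · have := hax 1
    rw [sandwich_apply, hf1, one_smul] at this
    simpa using this
  -- Expanding b_i c in the basis moves c into coefficients that do not depend on φ. They can
  -- therefore be identified using φ = id alone.
  · have key : ∀ (φ : A →ₗ[k] A) (y : A),
        ∑ i, a i * (twist 𝒜 (d i) (twist 𝒜 j y) * φ (b i * c)) =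
          sandwich 𝒜 d (fun i => φ (b i)) (fun l => ∑ i, b.repr (b i * c) l • a i) y := by
      intro φ y
      simp only [sandwich_apply, Finset.sum_mul]
      rw [Finset.sum_comm]
      refine Finset.sum_congr rfl fun i _ => ?_
      conv_lhs => rw [← b.sum_repr (b i * c), map_sum, Finset.mul_sum, Finset.mul_sum]
      refine Finset.sum_congr rfl fun l _ => ?_
      -- Only basis elements of the degree of b_i c contribute, and for these σ^{d_l} = σ^{d_i} σ^j.
      by_cases hl : d l = d i + j
      · rw [hl, twist_add_apply, map_smul, mul_smul_comm, mul_smul_comm, smul_mul_assoc]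
      · rw [hrepr _ _ (SetLike.mul_mem_graded (hb i) hc) l hl]
        simp
    -- Both families represent x ↦ f(x)c, the left one because f(σ^j x) = f(x); injectivity
    -- identifies them.
    have h1 : (fun l => ∑ i, b.repr (b i * c) l • a i) = fun l => c * a l := by
      refine hinj (LinearMap.ext fun x => ?_)
      rw [sandwich_mul_left, hax]
      have h2 := key LinearMap.id x
      simp only [LinearMap.id_apply] at h2
      rw [← h2]
      have h3 := hax (twist 𝒜 j x)
      rw [sandwich_apply] at h3
      simp only [← mul_assoc, ← Finset.sum_mul] at h3 ⊢
      rw [h3, smul_mul_assoc, mul_smul_comm, one_mul, mul_one]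
      congr 1
      rcases zmod_two_cases j with rfl | rfl
      · rw [twist_zero]; rfl
      · rw [twist_one, hfp]
    rw [key, h1, sandwich_mul_left, sandwich_apply]

/-- Every even automorphism `φ` is implemented, up to parity, by the element `U φ y` for each
homogeneous `y`; some of these elements are nonzero, and `U 1 1 = 1`. -/
theorem exists_intertwining (hcs : IsCentralSimple 𝒜) :
    ∃ U : (A →L[k] A) →ₗ[k] (A →ₗ[k] A), U 1 1 = 1 ∧
      (∀ (φ : EvenAut 𝒜) (ε : ZMod 2), ∀ y ∈ 𝒜 ε, U φ.toCLM y ∈ 𝒜 ε) ∧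
      (∀ (φ : EvenAut 𝒜) (ε : ZMod 2), ∀ y ∈ 𝒜 ε, ∀ c,
        c * U φ.toCLM y = U φ.toCLM y * φ.1 (twist 𝒜 ε c)) ∧
      ∀ φ : EvenAut 𝒜, ∃ ε, ∃ y ∈ 𝒜 ε, U φ.toCLM y ≠ 0 := by
  have hnt := hcs.nontrivial
  obtain ⟨ι, _, d, b, a, hb, ha, h1, hcas⟩ := hcs.exists_casimir
  -- Defined for all operators φ and linear in φ; this is what later makes it a smooth function of
  -- the automorphism.
  let U : (A →L[k] A) →ₗ[k] (A →ₗ[k] A) :=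
    { toFun := fun φ => sandwich 𝒜 d (fun i => φ (b i)) a
      map_add' := fun φ ψ => LinearMap.ext fun x => by
        simp [sandwich_apply, mul_add, Finset.sum_add_distrib]
      map_smul' := fun c φ => LinearMap.ext fun x => by
        simp [sandwich_apply, Finset.smul_sum] }
  have hU : ∀ (φ : EvenAut 𝒜) y, U φ.toCLM y = ∑ i, a i * (twist 𝒜 (d i) y * φ.1 (b i)) :=
    fun φ y => sandwich_apply _ _ _ _
  refine ⟨U, ?_, fun φ ε y hy => ?_, fun φ ε y hy c => ?_, fun φ => ?_⟩
  · change sandwich 𝒜 d b a 1 = 1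
    rw [sandwich_apply]
    simpa using h1
  · rw [hU]
    refine Submodule.sum_mem _ fun i _ => ?_
    have := SetLike.mul_mem_graded (ha i)
      (SetLike.mul_mem_graded (twist_mem 𝒜 (d i) hy) ((φ.2 (d i) _).2 (hb i)))
    rwa [add_comm ε, ← add_assoc, CharTwo.add_self_eq_zero, zero_add] at this
  · have hom : ∀ j, ∀ c ∈ 𝒜 j, c * U φ.toCLM y = U φ.toCLM y * φ.1 (twist 𝒜 ε c) := by
      intro j c hc
      have := hcas j c hc φ.1.toLinearMap y
      simp only [AlgEquiv.toLinearMap_apply] at this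
      -- The sign from σ^j(y) and the sign from σ^ε(c) are both (-1)^{jε}.
      rw [hU, this, twist_of_mem 𝒜 j hy, twist_of_mem 𝒜 ε hc, mul_comm j.val]
      simp only [map_smul, map_mul, mul_smul_comm, smul_mul_assoc, Finset.sum_mul, Finset.smul_sum,
        mul_assoc]
    obtain ⟨x, hx, z, hz, rfl⟩ := exists_even_add_odd 𝒜 c
    rw [add_mul, hom 0 x hx, hom 1 z hz, map_add, map_add, mul_add]
  · by_contra! hcon
    have h0 : sandwich 𝒜 d (fun i => φ.1 (b i)) a = 0 := by
      refine LinearMap.ext fun y => ?_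
      obtain ⟨x, hx, z, hz, rfl⟩ := exists_even_add_odd 𝒜 y
      rw [map_add]
      have e1 : sandwich 𝒜 d (fun i => φ.1 (b i)) a x = 0 := hcon 0 x hx
      have e2 : sandwich 𝒜 d (fun i => φ.1 (b i)) a z = 0 := hcon 1 z hz
      rw [e1, e2, add_zero]; rfl
    -- The φ(b_i) are again independent and homogeneous of the same degrees, so a vanishing operator
    -- would force a = 0, against ∑ a_i b_i = 1.
    have hli : LinearIndependent k fun i => φ.1 (b i) :=
      b.linearIndependent.map' φ.1.toLinearMap (LinearMap.ker_eq_bot.2 φ.1.injective)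
    have := hcs.sandwich_injective (fun i => (φ.2 (d i) _).2 (hb i)) hli (h0.trans (map_zero _).symm)
    rw [this] at h1
    simp at h1

/-- The Skolem–Noether theorem for central simple super algebras. -/
theorem exists_unit_of_evenAut (hcs : IsCentralSimple 𝒜) (φ : EvenAut 𝒜) :
    ∃ (ε : ZMod 2) (z : Aˣ), (z : A) ∈ 𝒜 ε ∧ ∀ c, c * z = z * φ.1 (twist 𝒜 ε c) := by
  obtain ⟨U, -, hU1, hU2, hU3⟩ := hcs.exists_intertwining
  obtain ⟨ε, y, hy, hne⟩ := hU3 φ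
  obtain ⟨z, hz⟩ := hcs.isUnit_of_normal (hU1 φ ε y hy) hne ((twist 𝒜 ε).trans φ.1)
    (hU2 φ ε y hy)
  exact ⟨ε, z, hz ▸ hU1 φ ε y hy, fun c => by rw [hz]; exact hU2 φ ε y hy c⟩

end IsCentralSimple

end SkolemNoether

/-! ### Picard-surjectivity provides odd units -/

section Picard

variable {k : Type v} [RCLike k] {A : Type u} [NormedRing A] [NormedAlgebra k A]
  (𝒜 : ZMod 2 → Submodule k A) [GradedAlgebra 𝒜]

/-- The right action of `A` on `ΠA`. -/
@[reducible] def parityRightModule : Module Aᵐᵒᵖ A :=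
  Module.compHom A (parity 𝒜).toRingEquiv.toRingHom.op

variable [FiniteDimensional k A]

/-- The bimodule `ΠA`: opposite grading, right action twisted by parity. -/
def parityShift : SuperBimodule 𝒜 where
  carrier := A
  right := parityRightModule 𝒜
  towerRight := letI := parityRightModule 𝒜; IsScalarTower.mk fun c b m => by
    change m * parity 𝒜 (c • b.unop) = c • (m * parity 𝒜 b.unop)
    rw [map_smul, mul_smul_comm]
  comm := letI := parityRightModule 𝒜; SMulCommClass.mk fun a b m =>
    (mul_assoc a m (parity 𝒜 b.unop)).symm
  deg i := 𝒜 (i + 1)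
  internal := by
    have h := DirectSum.Decomposition.isInternal 𝒜
    rw [DirectSum.isInternal_submodule_iff_iSupIndep_and_iSup_eq_top] at h ⊢
    refine ⟨h.1.comp (add_left_injective 1), ?_⟩
    rw [← h.2]
    exact (Equiv.addRight (1 : ZMod 2)).iSup_comp (g := 𝒜)
  smul_mem i j a ha m hm := by
    have : a * m ∈ 𝒜 (i + (j + 1)) := SetLike.mul_mem_graded ha hm
    rw [← add_assoc] at this
    exact this
  op_smul_mem i j a ha m hm := by
    have : m * parity 𝒜 a ∈ 𝒜 (j + 1 + i) :=
      SetLike.mul_mem_graded hm (twist_one 𝒜 ▸ twist_mem 𝒜 1 ha)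
    rw [add_right_comm] at this
    exact this

/-- The isomorphism is m ⊗ n ↦ m σ(n), with inverse a ↦ a ⊗ 1: twisting by parity twice and shifting
degrees by 1 + 1 = 0 cancel. -/
theorem parityShift_tensorIsoUnit :
    SuperBimodule.TensorIsoUnit (parityShift 𝒜) (parityShift 𝒜) := by
  let μ : A ⊗[k] A →ₗ[k] A :=
    TensorProduct.lift ((LinearMap.mul k A).compl₂ (parity 𝒜).toLinearMap)
  have hμ : ∀ m n : A, μ (m ⊗ₜ n) =
    m * parity 𝒜 n := fun m n => rfl
  have hbal : ∀ m b n : A, μ ((m * parity 𝒜 b) ⊗ₜ n - m ⊗ₜ (b * n)) = 0 := fun m b n => by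
    rw [map_sub, hμ, hμ, map_mul, mul_assoc, sub_self]
  have hle : SuperBimodule.balanced (parityShift 𝒜) (parityShift 𝒜) ≤ LinearMap.ker μ := by
    refine Submodule.span_le.2 ?_
    rintro _ ⟨m, b, n, rfl⟩
    exact hbal m b n
  let θ : SuperBimodule.RelTensor (parityShift 𝒜) (parityShift 𝒜) →ₗ[k] A :=
    Submodule.liftQ _ μ hle
  have hθ : ∀ m n : A, θ (SuperBimodule.pure (M := parityShift 𝒜) (N := parityShift 𝒜) m n) =
    m * parity 𝒜 n := fun m n => rfl
  let η : A →ₗ[k] SuperBimodule.RelTensor (parityShift 𝒜) (parityShift 𝒜) :=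
    (Submodule.mkQ _) ∘ₗ ((TensorProduct.mk k A A).flip (1 : A))
  have hη : ∀ a : A, η a =
    SuperBimodule.pure (M := parityShift 𝒜) (N := parityShift 𝒜) a (1 : A) := fun a => rfl
  have h1 : θ ∘ₗ η = LinearMap.id := LinearMap.ext fun a => by
    change θ (η a) = a
    rw [hη, hθ, map_one, mul_one]
  have hηθ : ∀ m n : A, η (m * parity 𝒜 n) =
      SuperBimodule.pure (M := parityShift 𝒜) (N := parityShift 𝒜) m n := fun m n =>
    (Submodule.Quotient.eq _).2 (Submodule.subset_span ⟨m, n, (1 : A),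
      congrArg (fun z : A => (m * parity 𝒜 n) ⊗ₜ[k] (1 : A) - m ⊗ₜ[k] z) (mul_one n).symm⟩)
  have h2 : η ∘ₗ θ = LinearMap.id := by
    refine Submodule.linearMap_qext _ (TensorProduct.ext' fun m n => ?_)
    exact hηθ m n
  have hright : ∀ m n b : A, m * parity 𝒜 (n * parity 𝒜 b) = m * parity 𝒜 n * b := fun m n b => by
    rw [map_mul, parity_parity, mul_assoc]
  have hdeg : ∀ i j, ∀ m ∈ 𝒜 (i + 1), ∀ n ∈ 𝒜 (j + 1), m * parity 𝒜 n ∈ 𝒜 (i + j) := by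
    intro i j m hm n hn
    have : m * parity 𝒜 n ∈ 𝒜 (i + 1 + (j + 1)) :=
      SetLike.mul_mem_graded hm (twist_one 𝒜 ▸ twist_mem 𝒜 1 hn)
    rwa [add_add_add_comm, CharTwo.add_self_eq_zero, add_zero] at this
  exact ⟨LinearEquiv.ofLinearMap θ η h1 h2, fun a m n => mul_assoc (G := A) a m _, hright, hdeg⟩

variable {𝒜} in
-- An isomorphism ΠA ≅ A_φ is left linear, hence right multiplication by the image of 1, which is a
-- unit. As 1 is odd in ΠA, that unit is odd. Nothing else is extracted from Picard-surjectivity.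
theorem PicardSurjective.exists_odd_unit (hpic : PicardSurjective 𝒜) :
    ∃ z : Aˣ, (z : A) ∈ 𝒜 1 := by
  obtain ⟨φ, f, hf1, -, hf3⟩ := hpic (parityShift 𝒜)
    ⟨_, parityShift_tensorIsoUnit 𝒜, parityShift_tensorIsoUnit 𝒜⟩
  let g : A ≃ₗ[k] A := f
  have hg : ∀ a : A, g a = a * g 1 := fun a => by
    have : g (a * 1) = a * g 1 := hf1 a (1 : A)
    rwa [mul_one] at this
  have h1 : g.symm 1 * g 1 = 1 := by rw [← hg, g.apply_symm_apply]
  have h2 : g 1 * g.symm 1 = 1 := g.injective (by rw [hg, mul_assoc, h1, mul_one])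
  have h0 : (1 : A) ∈ 𝒜 (1 + 1) := by
    rw [CharTwo.add_self_eq_zero]; exact SetLike.GradedOne.one_mem
  exact ⟨⟨g 1, g.symm 1, h2, h1⟩, hf3 1 (1 : A) h0⟩

end Picard

/-! ### Local sections of homomorphisms of Lie groups -/

section Sections

theorem contMDiffOn_units_of_val {R : Type*} [NormedRing R] [CompleteSpace R] [NormedAlgebra ℝ R]
    {F H M : Type*} [NormedAddCommGroup F] [NormedSpace ℝ F] [TopologicalSpace H]
    {I : ModelWithCorners ℝ F H} [TopologicalSpace M] [ChartedSpace H M] {f : M → Rˣ} {s : Set M}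
    (hf : ContMDiffOn I 𝓘(ℝ, R) ∞ (fun x => (f x : R)) s) : ContMDiffOn I 𝓘(ℝ, R) ∞ f s := by
  intro x hx
  rw [contMDiffWithinAt_iff_target]
  exact ⟨Units.isOpenEmbedding_val.isEmbedding.continuousWithinAt_iff.2
    (hf x hx).continuousWithinAt, hf x hx⟩

variable {K : LieGrp.{v}} {Q : LieGrp.{w}} {p : K →* Q}

/-- A surjective homomorphism with a smooth section near `1` has smooth sections everywhere. -/
theorem exists_section_of_one (hp : Function.Surjective p)
    (h : ∃ O : Set Q, IsOpen O ∧ (1 : Q) ∈ O ∧ ∃ σ : Q → K,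
      ContMDiffOn Q.I K.I ∞ σ O ∧ ∀ y ∈ O, p (σ y) = y) (g : Q) :
    ∃ O : Set Q, IsOpen O ∧ g ∈ O ∧ ∃ σ : Q → K,
      ContMDiffOn Q.I K.I ∞ σ O ∧ ∀ y ∈ O, p (σ y) = y := by
  obtain ⟨O, hO, h1, σ, hσ, hpσ⟩ := h
  obtain ⟨x, rfl⟩ := hp g
  have hm : ContMDiff Q.I Q.I ∞ fun y : Q => (p x)⁻¹ * y := contMDiff_const.mul contMDiff_id
  refine ⟨(fun y => (p x)⁻¹ * y) ⁻¹' O, hO.preimage hm.continuous, by simpa using h1,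
    fun y => x * σ ((p x)⁻¹ * y), ?_, fun y hy => ?_⟩
  · exact contMDiffOn_const.mul (hσ.comp hm.contMDiffOn fun y hy => hy)
  · rw [map_mul, hpσ _ hy, mul_inv_cancel_left]

/-- A homomorphism with local smooth sections is a submersion. -/
theorem surjective_mfderiv_of_section (hsm : ContMDiff K.I Q.I ∞ p)
    (h : ∀ g : Q, ∃ O : Set Q, IsOpen O ∧ g ∈ O ∧ ∃ σ : Q → K,
      ContMDiffOn Q.I K.I ∞ σ O ∧ ∀ y ∈ O, p (σ y) = y) (x : K) :
    Function.Surjective (mfderiv K.I Q.I p x) := by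
  obtain ⟨O, hO, hx, σ, hσ, hpσ⟩ := h (p x)
  -- The local section need not pass through x; left translation by an element of ker p makes it do
  -- so, and the chain rule then gives a right inverse of the differential.
  let τ : Q → K := fun y => x * (σ (p x))⁻¹ * σ y
  have hτx : τ (p x) = x := by simp [τ]
  have hτ : MDifferentiableAt Q.I K.I τ (p x) := by
    have : ContMDiffOn Q.I K.I ∞ τ O := contMDiffOn_const.mul hσ
    exact (this.contMDiffAt (hO.mem_nhds hx)).mdifferentiableAt (by simp)
  have hpd : MDifferentiableAt K.I Q.I p (τ (p x)) := (hsm _).mdifferentiableAt (by simp)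
  have hcomp := hpd.hasMFDerivAt.comp (p x) hτ.hasMFDerivAt
  have hid : HasMFDerivAt Q.I Q.I (p ∘ τ) (p x) (ContinuousLinearMap.id ℝ (TangentSpace Q.I (p x))) := by
    refine (hasMFDerivAt_id (p x)).congr_of_eventuallyEq ?_
    filter_upwards [hO.mem_nhds hx] with y hy
    simp [τ, hpσ y hy, hpσ _ hx]
  have he := hasMFDerivAt_unique hcomp hid
  have key : Function.Surjective (mfderiv K.I Q.I p (τ (p x))) := fun v =>
    ⟨mfderiv Q.I K.I τ (p x) v, DFunLike.congr_fun he v⟩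
  rwa [hτx] at key

end Sections

/-! ### The Lie group of homogeneous units -/

section HomUnits

variable {k : Type v} [RCLike k] {A : Type u} [NormedRing A] [NormedAlgebra k A]
  (𝒜 : ZMod 2 → Submodule k A) [GradedAlgebra 𝒜]

variable {𝒜} in
theorem unit_inv_mem {j : ZMod 2} {z : Aˣ} (hz : (z : A) ∈ 𝒜 j) : ((z⁻¹ : Aˣ) : A) ∈ 𝒜 j := by
  refine mem_of_parity 𝒜 ?_
  have h1 : parity 𝒜 ((z⁻¹ : Aˣ) : A) * ((-1 : k) ^ j.val • (z : A)) = 1 := by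
    rw [← parity_of_mem 𝒜 hz, ← map_mul, Units.inv_mul, map_one]
  have h2 : (-1 : k) ^ j.val • parity 𝒜 ((z⁻¹ : Aˣ) : A) = ((z⁻¹ : Aˣ) : A) := by
    rw [mul_smul_comm, ← smul_mul_assoc] at h1
    exact Units.eq_inv_of_mul_eq_one_right h1
  rw [← h2, map_smul, parity_parity, h2]

/-- The group of homogeneous units together with their degrees. -/
def homUnits : Subgroup (Aˣ × Z2) where
  carrier := {p | (p.1 : A) ∈ 𝒜 p.2.val}
  one_mem' := SetLike.GradedOne.one_mem (A := 𝒜)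
  mul_mem' {p q} hp hq := SetLike.mul_mem_graded (A := 𝒜) hp hq
  inv_mem' {p} hp := by
    have h : (p⁻¹.2).val = p.2.val := ZMod.neg_eq_self_mod_two _
    change ((p.1⁻¹ : Aˣ) : A) ∈ 𝒜 (p⁻¹.2).val
    rw [h]
    exact unit_inv_mem hp

/-- The group of homogeneous units, as a type. -/
def HomUnits : Type u := homUnits 𝒜

instance : Group (HomUnits 𝒜) := inferInstanceAs (Group (homUnits 𝒜))

namespace HomUnits

variable {𝒜}

/-- The underlying unit. -/
def unit : HomUnits 𝒜 →* Aˣ := (MonoidHom.fst Aˣ Z2).comp (homUnits 𝒜).subtype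

/-- The degree. -/
def degree : HomUnits 𝒜 →* Z2 := (MonoidHom.snd Aˣ Z2).comp (homUnits 𝒜).subtype

/-- The underlying element of `A`. -/
def val : HomUnits 𝒜 →* A := (Units.coeHom A).comp unit

/-- A homogeneous unit with given degree. -/
def mk (z : Aˣ) (ε : Z2) (h : (z : A) ∈ 𝒜 ε.val) : HomUnits 𝒜 := ⟨(z, ε), h⟩

theorem val_mem (x : HomUnits 𝒜) : x.val ∈ 𝒜 x.degree.val := x.2

theorem unit_mem (x : HomUnits 𝒜) : (x.unit : A) ∈ 𝒜 x.degree.val := x.2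

theorem ext_unit {x y : HomUnits 𝒜} (h : x.unit = y.unit) (h' : x.degree = y.degree) : x = y :=
  Subtype.ext (Prod.ext h h')

/-- A unit of a nonzero algebra is nonzero and so has only one degree; the degree is therefore no
extra datum and the group can be topologised inside A. -/
theorem val_injective [Nontrivial A] : Function.Injective (val (𝒜 := 𝒜)) := by
  intro x y h
  refine ext_unit (Units.ext h) ?_
  by_contra hne
  have hx := x.val_mem
  have hy := y.val_mem
  rw [← h] at hy
  have := (DirectSum.decompose_of_mem_same 𝒜 hx).symm.trans
    (DirectSum.decompose_of_mem_ne 𝒜 hy fun he => hne (Multiplicative.toAdd.injective he).symm)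
  exact x.unit.ne_zero this

instance : TopologicalSpace (HomUnits 𝒜) := TopologicalSpace.induced val inferInstance

theorem isEmbedding_val [Nontrivial A] : Topology.IsEmbedding (val (𝒜 := 𝒜)) :=
  ⟨⟨rfl⟩, val_injective⟩

end HomUnits

variable [FiniteDimensional k A]

theorem continuous_parity : Continuous (parity 𝒜) :=
  (parity 𝒜).toLinearMap.continuous_of_finiteDimensional

/-- The projection to the even part. -/
def evenProj : A →L[k] EvenPart 𝒜 := LinearMap.toContinuousLinearMap
  { toFun := fun a => (⟨_, (DirectSum.decompose 𝒜 a 0).2⟩ : EvenPart 𝒜)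
    map_add' := fun x y => Subtype.ext (by simp [DirectSum.decompose_add]; rfl)
    map_smul' := fun c x => Subtype.ext (by simp [DirectSum.decompose_smul]; rfl) }

theorem evenProj_of_mem {a : A} (ha : a ∈ 𝒜 0) : evenProj 𝒜 a = (⟨a, ha⟩ : EvenPart 𝒜) :=
  Subtype.ext (DirectSum.decompose_of_mem_same 𝒜 ha)

theorem parity_exp [CompleteSpace A] (T : A) : parity 𝒜 (exp T) = exp (parity 𝒜 T) := by
  let : NormedAlgebra ℚ A := NormedAlgebra.restrictScalars ℚ k _
  exact map_exp (parity 𝒜) (continuous_parity 𝒜) T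

/-- The exponential commutes with parity and is injective near 0, so exp T is even only for even T.
Odd values are excluded because exp T + σ(exp T) stays near 2. This identifies the Lie algebra of
the group as A_0. -/
theorem exp_mem_range_homUnits_iff [CompleteSpace A] [Nontrivial A] : ∀ᶠ T in 𝓝 (0 : A),
    exp T ∈ range (HomUnits.val (𝒜 := 𝒜)) ↔ T ∈ 𝒜 0 := by
  let : NormedAlgebra ℚ A := NormedAlgebra.restrictScalars ℚ k _
  obtain ⟨s, hs, hinj⟩ : ∃ s ∈ 𝓝 (0 : A), InjOn (exp : A → A) s := by
    have hd : HasStrictFDerivAt (exp : A → A)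
      ((ContinuousLinearEquiv.refl k A : A ≃L[k] A) : A →L[k] A) 0 := hasStrictFDerivAt_exp_zero
    exact ⟨_, (hd.toOpenPartialHomeomorph _).open_source.mem_nhds
      hd.mem_toOpenPartialHomeomorph_source, (hd.toOpenPartialHomeomorph _).injOn⟩
  have hs' : ∀ᶠ T in 𝓝 (0 : A), parity 𝒜 T ∈ s :=
    ((continuous_parity 𝒜).tendsto' 0 0 (map_zero _)).eventually hs
  have hne : ∀ᶠ T in 𝓝 (0 : A), exp T + parity 𝒜 (exp T) ≠ 0 := by
    have hc : ContinuousAt (fun T : A => exp T + parity 𝒜 (exp T)) 0 := by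
      have h1 := (exp_analytic (𝕂 := k) (0 : A)).continuousAt
      exact h1.add ((continuous_parity 𝒜).continuousAt.comp h1)
    refine hc.eventually_ne ?_
    rw [exp_zero, map_one, ← two_smul k]
    exact smul_ne_zero two_ne_zero one_ne_zero
  filter_upwards [hs, hs', hne] with T h1 h2 h3
  constructor
  · rintro ⟨x, hx⟩
    have hm := x.val_mem
    rw [hx] at hm
    rcases zmod_two_cases x.degree.val with h | h
    · rw [h] at hm
      have he : parity 𝒜 T = T := hinj h2 h1 (by rw [← parity_exp, parity_even 𝒜 hm])
      exact mem_of_parity 𝒜 (by rw [he]; simp)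
    · rw [h] at hm
      exact (h3 (by rw [parity_odd 𝒜 hm, add_neg_cancel])).elim
  · intro hT
    have hm : exp T ∈ 𝒜 0 := mem_of_parity 𝒜 (by
      rw [parity_exp, parity_even 𝒜 hT]; simp)
    obtain ⟨z, hz⟩ := isUnit_exp T
    exact ⟨HomUnits.mk z 1 (by rw [hz]; exact hm), hz⟩

end HomUnits

/-- The algebra `A` over `k`, regarded as a real algebra. -/
def RealForm (_ : Type v) (A : Type u) : Type u := A

namespace RealForm

variable (k : Type v) [RCLike k] (A : Type u) [NormedRing A] [NormedAlgebra k A]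

instance : NormedRing (RealForm k A) := inferInstanceAs (NormedRing A)
instance : NormedAlgebra k (RealForm k A) := inferInstanceAs (NormedAlgebra k A)
instance : NormedAlgebra ℝ (RealForm k A) := NormedAlgebra.restrictScalars ℝ k (RealForm k A)
instance : IsScalarTower ℝ k (RealForm k A) := IsScalarTower.of_algebraMap_smul fun _ _ => rfl
instance [FiniteDimensional k A] : FiniteDimensional k (RealForm k A) :=
  inferInstanceAs (FiniteDimensional k A)
instance [FiniteDimensional k A] : CompleteSpace (RealForm k A) :=
  FiniteDimensional.complete k (RealForm k A)

end RealForm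

section HomUnitsLie

variable {k : Type v} [RCLike k] {A : Type u} [NormedRing A] [NormedAlgebra k A]
  [FiniteDimensional k A] (𝒜 : ZMod 2 → Submodule k A) [GradedAlgebra 𝒜]

attribute [local instance] opAlgebra complete_op tower_op

variable {𝒜} in
/-- The element of `A` underlying a homogeneous unit. -/
def HomUnits.toReal : HomUnits 𝒜 →* RealForm k A := HomUnits.val

/-- The inclusion of the even part. -/
def evenInclReal : EvenPart 𝒜 →L[ℝ] RealForm k A :=
  { toFun := fun a => a.1
    map_add' := fun _ _ => rfl
    map_smul' := fun _ _ => rfl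
    cont := continuous_subtype_val }

/-- The projection to the even part. -/
def evenProjReal : RealForm k A →L[ℝ] EvenPart 𝒜 :=
  { toFun := fun a => evenProj 𝒜 a
    map_add' := (evenProj 𝒜).map_add
    map_smul' := fun r x => (evenProj 𝒜).map_smul (algebraMap ℝ k r) x
    cont := (evenProj 𝒜).cont }

variable [Nontrivial A]

theorem HomUnits.isLinearLie :
    IsLinearLie (HomUnits.toReal (𝒜 := 𝒜)) (evenInclReal 𝒜) (evenProjReal 𝒜) where
  emb := by
    have h := HomUnits.isEmbedding_val (𝒜 := 𝒜)
    exact h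
  left_inv v := evenProj_of_mem 𝒜 v.2
  exp_mem := by
    have : CompleteSpace A := FiniteDimensional.complete k A
    have h := exp_mem_range_homUnits_iff 𝒜
    exact h.mono fun T hT => hT.trans
      ⟨fun h => ⟨(⟨T, h⟩ : EvenPart 𝒜), rfl⟩, fun ⟨v, hv⟩ => hv ▸ v.2⟩

instance : ChartedSpace (EvenPart 𝒜) (HomUnits 𝒜) := (HomUnits.isLinearLie 𝒜).chartedSpace

instance : LieGroup 𝓘(ℝ, EvenPart 𝒜) ∞ (HomUnits 𝒜) := (HomUnits.isLinearLie 𝒜).lieGroup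

instance : T2Space (HomUnits 𝒜) := HomUnits.isEmbedding_val.t2Space

instance : SecondCountableTopology (HomUnits 𝒜) := by
  have : ProperSpace A := FiniteDimensional.proper k _
  exact HomUnits.isEmbedding_val.secondCountableTopology

/-- The Lie group of homogeneous units of `A`. -/
def homUnitsLieGrp : LieGrp.{u} where
  carrier := HomUnits 𝒜
  model := EvenPart 𝒜

theorem HomUnits.contMDiff_toReal :
    ContMDiff 𝓘(ℝ, EvenPart 𝒜) 𝓘(ℝ, RealForm k A) ∞ (HomUnits.toReal (𝒜 := 𝒜)) :=
  (HomUnits.isLinearLie 𝒜).contMDiff_rho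

variable {𝒜}

section

variable {F H M : Type*} [NormedAddCommGroup F] [NormedSpace ℝ F] [TopologicalSpace H]
  {I : ModelWithCorners ℝ F H} [TopologicalSpace M] [ChartedSpace H M] {f : M → HomUnits 𝒜}

theorem HomUnits.contMDiff_of_toReal
    (hf : ContMDiff I 𝓘(ℝ, RealForm k A) ∞ fun x => (f x).toReal) :
    ContMDiff I 𝓘(ℝ, EvenPart 𝒜) ∞ f :=
  (HomUnits.isLinearLie 𝒜).contMDiff_of_rho hf

theorem HomUnits.contMDiffOn_of_toReal {s : Set M}
    (hf : ContMDiffOn I 𝓘(ℝ, RealForm k A) ∞ (fun x => (f x).toReal) s) :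
    ContMDiffOn I 𝓘(ℝ, EvenPart 𝒜) ∞ f s := fun x hx =>
  (HomUnits.isLinearLie 𝒜).contMDiffWithinAt_of_rho (hf x hx)

end

/-! ### The homomorphisms of the butterfly -/

/-- The two ones differ: `ε = 1` is the neutral element of the multiplicative group, meaning even,
whereas `ε.val = 1` means odd. -/
theorem Z2.cases (ε : Z2) : ε = 1 ∨ ε.val = 1 := zmod_two_cases ε.val

/-- Even units are those fixed by parity, a closed condition. Openness, in the next lemma, comes
from excluding the closed set where parity acts by -1. -/
theorem HomUnits.isClosed_degree_eq_one : IsClosed {x : HomUnits 𝒜 | x.degree = 1} := by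
  have hc : Continuous (HomUnits.val (𝒜 := 𝒜)) := HomUnits.isEmbedding_val.continuous
  have : {x : HomUnits 𝒜 | x.degree = 1} = {x | parity 𝒜 x.val = x.val} := by
    ext x
    constructor
    · intro h
      have hx := x.val_mem
      rw [show x.degree = 1 from h] at hx
      exact parity_even 𝒜 hx
    · intro h
      rcases Z2.cases x.degree with h' | h'
      · exact h'
      · have hx := x.val_mem
        rw [h'] at hx
        have h2 : -x.val = x.val := (parity_odd 𝒜 hx).symm.trans h
        rw [neg_eq_iff_add_eq_zero, ← two_smul k] at h2
        exact (x.unit.ne_zero ((smul_eq_zero.1 h2).resolve_left two_ne_zero)).elim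
  rw [this]
  exact isClosed_eq ((continuous_parity 𝒜).comp hc) hc

theorem HomUnits.isOpen_degree_eq_one : IsOpen {x : HomUnits 𝒜 | x.degree = 1} := by
  have hc : Continuous (HomUnits.val (𝒜 := 𝒜)) := HomUnits.isEmbedding_val.continuous
  have : {x : HomUnits 𝒜 | x.degree = 1} = {x | parity 𝒜 x.val = -x.val}ᶜ := by
    ext x
    constructor
    · intro h h2
      have hx := x.val_mem
      rw [show x.degree = 1 from h] at hx
      have h2 : x.val = -x.val := (parity_even 𝒜 hx).symm.trans h2
      rw [eq_neg_iff_add_eq_zero, ← two_smul k] at h2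
      exact (x.unit.ne_zero ((smul_eq_zero.1 h2).resolve_left two_ne_zero)).elim
    · intro h
      rcases Z2.cases x.degree with h' | h'
      · exact h'
      · have hx := x.val_mem
        rw [h'] at hx
        exact (h (parity_odd 𝒜 hx)).elim
  rw [this]
  exact (isClosed_eq ((continuous_parity 𝒜).comp hc) hc.neg).isOpen_compl

theorem HomUnits.contMDiff_degree :
    ContMDiff 𝓘(ℝ, EvenPart 𝒜) 𝓘(ℝ, PUnit.{1}) ∞ (HomUnits.degree (𝒜 := 𝒜)) := by
  intro x
  have hev : ∀ᶠ y in 𝓝 x, y.degree = x.degree := by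
    have hopen : IsOpen {y : HomUnits 𝒜 | (x⁻¹ * y).degree = 1} :=
      HomUnits.isOpen_degree_eq_one.preimage
        (contMDiff_const.mul contMDiff_id : ContMDiff 𝓘(ℝ, EvenPart 𝒜) 𝓘(ℝ, EvenPart 𝒜) ∞
          fun y : HomUnits 𝒜 => x⁻¹ * y).continuous
    filter_upwards [hopen.mem_nhds (show (x⁻¹ * x).degree = 1 by simp)] with y hy
    have : (x⁻¹ * y).degree = 1 := hy
    rw [map_mul, map_inv, inv_mul_eq_one] at this
    exact this.symm
  exact (contMDiffAt_const (c := x.degree)).congr_of_eventuallyEq hev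

/-- A homogeneous unit and its inverse have the same degree, so their signs cancel. This makes
signed conjugation multiplicative in the unit. -/
theorem twist_val_mul_inv (ε : ZMod 2) (x : HomUnits 𝒜) (b : A) :
    twist 𝒜 ε ((x.unit : A) * b * ((x.unit⁻¹ : Aˣ) : A)) =
      (x.unit : A) * twist 𝒜 ε b * ((x.unit⁻¹ : Aˣ) : A) := by
  rw [map_mul, map_mul, twist_of_mem 𝒜 ε x.unit_mem, twist_of_mem 𝒜 ε (unit_inv_mem x.unit_mem),
    mul_smul_comm, smul_mul_assoc, smul_mul_assoc, smul_smul,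
    IsCentralSimple.neg_one_pow_mul_self, one_smul]

/-- The automorphism `b ↦ (-1)^{|x||b|} x b x⁻¹` implemented by a homogeneous unit `x`. -/
def HomUnits.toAut : HomUnits 𝒜 →* EvenAut 𝒜 where
  toFun x := ⟨
    { toFun := fun b => (x.unit : A) * twist 𝒜 x.degree.val b * ((x.unit⁻¹ : Aˣ) : A)
      invFun := fun b => twist 𝒜 x.degree.val (((x.unit⁻¹ : Aˣ) : A) * b * (x.unit : A))
      left_inv := fun b => by simp [mul_assoc, twist_twist]
      right_inv := fun b => by simp [mul_assoc, twist_twist]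
      map_mul' := fun b c => by simp [mul_assoc]
      map_add' := fun b c => by simp [mul_add, add_mul]
      commutes' := fun r => by
        rw [AlgEquiv.commutes, ← Algebra.commutes, mul_assoc, Units.mul_inv, mul_one] },
    fun i b => by
      have key : ∀ c ∈ 𝒜 i, (x.unit : A) * c * ((x.unit⁻¹ : Aˣ) : A) ∈ 𝒜 i := fun c hc => by
        have := SetLike.mul_mem_graded (SetLike.mul_mem_graded x.unit_mem hc)
          (unit_inv_mem x.unit_mem)
        rw [add_right_comm, CharTwo.add_self_eq_zero, zero_add] at this
        exact this
      have key' : ∀ c ∈ 𝒜 i, ((x.unit⁻¹ : Aˣ) : A) * c * (x.unit : A) ∈ 𝒜 i := fun c hc => by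
        have := SetLike.mul_mem_graded (SetLike.mul_mem_graded (unit_inv_mem x.unit_mem) hc)
          x.unit_mem
        rw [add_right_comm, CharTwo.add_self_eq_zero, zero_add] at this
        exact this
      constructor
      · intro h
        have := twist_mem 𝒜 x.degree.val (key' _ h)
        simpa [mul_assoc, twist_twist] using this
      · exact fun h => key _ (twist_mem 𝒜 _ h)⟩
  map_one' := Subtype.ext (AlgEquiv.ext fun b => by
    change (1 : A) * twist 𝒜 0 b * 1 = b
    rw [twist_zero, one_mul, mul_one]; rfl)
  map_mul' x y := Subtype.ext (AlgEquiv.ext fun b => by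
    change (((x * y).unit : Aˣ) : A) * twist 𝒜 (x.degree.val + y.degree.val) b *
      (((x * y).unit⁻¹ : Aˣ) : A) = (x.unit : A) * twist 𝒜 x.degree.val
        ((y.unit : A) * twist 𝒜 y.degree.val b * ((y.unit⁻¹ : Aˣ) : A)) * ((x.unit⁻¹ : Aˣ) : A)
    rw [twist_val_mul_inv, twist_add_apply, map_mul]
    simp [mul_assoc])

theorem HomUnits.toAut_apply (x : HomUnits 𝒜) (b : A) :
    x.toAut.1 b = (x.unit : A) * twist 𝒜 x.degree.val b * ((x.unit⁻¹ : Aˣ) : A) := rfl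

theorem HomUnits.contMDiff_toAut :
    ContMDiff 𝓘(ℝ, EvenPart 𝒜) 𝓘(ℝ, EvenDer 𝒜) ∞ (HomUnits.toAut (𝒜 := 𝒜)) := by
  refine (EvenAut.isLinearLie 𝒜).contMDiff_of_rho ?_
  -- The automorphism is left multiplication by x, composed with right multiplication by x⁻¹ and a
  -- power of parity: bilinear in x and x⁻¹, with locally constant last factor.
  let L : RealForm k A →L[k] (A →L[k] A) := LinearMap.toContinuousLinearMap
    ((ContinuousLinearMap.mul k A).toLinearMap)
  let R : RealForm k A →L[k] (A →L[k] A) := LinearMap.toContinuousLinearMap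
    ((ContinuousLinearMap.mul k A).flip.toLinearMap)
  have h1 : ContDiff k ∞ fun p : RealForm k A × RealForm k A × (A →L[k] A) =>
      L p.1 * (R p.2.1 * p.2.2) :=
    (L.contDiff.comp contDiff_fst).mul
      ((R.contDiff.comp (contDiff_fst.comp contDiff_snd)).mul (contDiff_snd.comp contDiff_snd))
  have h2 := (h1.restrict_scalars ℝ).contMDiff
  let T : Z2 → (A →L[k] A) := fun ε => LinearMap.toContinuousLinearMap (twist 𝒜 ε.val).toLinearMap
  have hT : ContMDiff 𝓘(ℝ, PUnit.{1}) 𝓘(ℝ, A →L[k] A) ∞ T := contMDiff_of_discreteTopology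
  have hv := HomUnits.contMDiff_toReal 𝒜
  have hi : ContMDiff 𝓘(ℝ, EvenPart 𝒜) 𝓘(ℝ, RealForm k A) ∞
      fun x : HomUnits 𝒜 => (x⁻¹).toReal := hv.comp (contMDiff_inv 𝓘(ℝ, EvenPart 𝒜) ∞)
  refine (h2.comp (hv.prodMk_space (hi.prodMk_space (hT.comp HomUnits.contMDiff_degree)))).congr
    fun x => ContinuousLinearMap.ext fun b => ?_
  change (x.unit : A) * twist 𝒜 x.degree.val b * ((x.unit⁻¹ : Aˣ) : A) =
    (x.unit : A) * (twist 𝒜 x.degree.val b * (((x⁻¹).unit : Aˣ) : A))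
  rw [map_inv, mul_assoc]

/-- An even unit is homogeneous. -/
def HomUnits.ofEven : (EvenPart 𝒜)ˣ →* HomUnits 𝒜 where
  toFun a := HomUnits.mk (toUnit a) 1 (toUnit_mem 𝒜 a)
  map_one' := rfl
  map_mul' a b := HomUnits.ext_unit (map_mul toUnit a b) rfl

/-- The inverse of a scalar, as a homogeneous unit. -/
def HomUnits.ofScalar : kˣ →* HomUnits 𝒜 where
  toFun c := HomUnits.mk (Units.map (algebraMap k A).toMonoidHom c⁻¹) 1 (by
    change algebraMap k A _ ∈ 𝒜 0
    rw [Algebra.algebraMap_eq_smul_one]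
    exact (𝒜 0).smul_mem _ SetLike.GradedOne.one_mem)
  map_one' := HomUnits.ext_unit (by
    change Units.map _ (1 : kˣ)⁻¹ = 1
    rw [inv_one, map_one]) rfl
  map_mul' c c' := HomUnits.ext_unit (by
    change Units.map _ (c * c')⁻¹ = Units.map _ c⁻¹ * Units.map _ c'⁻¹
    rw [← map_mul, mul_inv]) rfl

end HomUnitsLie

/-! ### The canonical butterfly -/

section Butterfly

variable {k : Type v} [RCLike k] {A : Type u} [NormedRing A] [NormedAlgebra k A]
  [FiniteDimensional k A] {𝒜 : ZMod 2 → Submodule k A} [GradedAlgebra 𝒜] [Nontrivial A]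

attribute [local instance] opAlgebra complete_op tower_op

theorem HomUnits.toAut_ofEven (a : (EvenPart 𝒜)ˣ) : (HomUnits.ofEven a).toAut = conjAut a :=
  Subtype.ext (AlgEquiv.ext fun b => by
    change ((toUnit a : Aˣ) : A) * twist 𝒜 0 b * (((toUnit a)⁻¹ : Aˣ) : A) =
      (toUnit a : Aˣ) * b * ((toUnit a)⁻¹ : Aˣ)
    rw [twist_zero]; rfl)

theorem HomUnits.ofEven_evalAct (x : HomUnits 𝒜) (a : (EvenPart 𝒜)ˣ) :
    HomUnits.ofEven (evalAct x.toAut a) = x * HomUnits.ofEven a * x⁻¹ := by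
  refine HomUnits.ext_unit (Units.ext ?_) ?_
  · change (x.unit : A) * twist 𝒜 x.degree.val (toUnit a : Aˣ) * ((x.unit⁻¹ : Aˣ) : A) =
      (x.unit : A) * (toUnit a : Aˣ) * ((x⁻¹).unit : Aˣ)
    rw [twist_of_mem 𝒜 _ (toUnit_mem 𝒜 a), map_inv]
    simp
  · rw [map_mul, map_mul, map_inv, mul_right_comm, mul_inv_cancel, one_mul]
    rfl

theorem HomUnits.ofScalar_eq_conj (x : HomUnits 𝒜) (c : kˣ) :
    HomUnits.ofScalar c = x * HomUnits.ofScalar c * x⁻¹ := by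
  refine HomUnits.ext_unit (Units.ext ?_) ?_
  · change algebraMap k A ((c⁻¹ : kˣ) : k) =
      (x.unit : A) * algebraMap k A ((c⁻¹ : kˣ) : k) * ((x⁻¹).unit : Aˣ)
    rw [← Algebra.commutes, mul_assoc, map_inv, Units.mul_inv, mul_one]
  · rw [map_mul, map_mul, map_inv, mul_right_comm, mul_inv_cancel, one_mul]

theorem HomUnits.toAut_ofScalar (c : kˣ) : (HomUnits.ofScalar (𝒜 := 𝒜) c).toAut = 1 :=
  Subtype.ext (AlgEquiv.ext fun b => by
    change algebraMap k A ((c⁻¹ : kˣ) : k) * twist 𝒜 0 b *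
      (((Units.map (algebraMap k A).toMonoidHom c⁻¹)⁻¹ : Aˣ) : A) = b
    rw [twist_zero, Algebra.commutes, mul_assoc]
    exact (congrArg (b * ·) (Units.mul_inv (Units.map (algebraMap k A).toMonoidHom c⁻¹))).trans
      (mul_one b))

/-- An even unit acting trivially is central, hence a scalar. An odd one would satisfy -x² = x² on
applying its action to itself, which is impossible for a unit. -/
theorem HomUnits.exists_ofScalar (hcs : IsCentralSimple 𝒜) {x : HomUnits 𝒜} (hx : x.toAut = 1) :
    ∃ c, HomUnits.ofScalar c = x := by
  have h : ∀ b, (x.unit : A) * twist 𝒜 x.degree.val b = b * x.unit := fun b => by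
    rw [← Units.mul_inv_eq_iff_eq_mul, ← HomUnits.toAut_apply, hx]; rfl
  have hm := x.unit_mem
  rcases Z2.cases x.degree with hd | hd
  · rw [hd] at hm
    obtain ⟨c, hc⟩ := hcs.central (x.unit : A) hm fun a => by
      have := h a
      rw [hd] at this
      rw [← this]
      change _ = _ * twist 𝒜 0 a
      rw [twist_zero]; rfl
    have hc0 : c ≠ 0 := by
      rintro rfl
      rw [map_zero] at hc
      exact x.unit.ne_zero hc
    refine ⟨(Units.mk0 c hc0)⁻¹, HomUnits.ext_unit (Units.ext ?_) hd.symm⟩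
    change algebraMap k A (((Units.mk0 c hc0)⁻¹⁻¹ : kˣ) : k) = _
    rw [inv_inv, hc]; rfl
  · have h2 := h x.unit
    rw [hd] at hm h2
    rw [twist_one, parity_odd 𝒜 hm, mul_neg, neg_eq_iff_add_eq_zero, ← two_smul k] at h2
    exact ((x.unit * x.unit).ne_zero ((smul_eq_zero.1 h2).resolve_left two_ne_zero)).elim

theorem HomUnits.exists_ofEven {x : HomUnits 𝒜} (hx : x.degree = 1) :
    ∃ a, HomUnits.ofEven a = x := by
  have hm := x.unit_mem
  rw [hx] at hm
  exact ⟨⟨⟨x.unit, hm⟩, ⟨(x.unit⁻¹ : Aˣ), unit_inv_mem hm⟩, Subtype.ext (Units.mul_inv _),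
    Subtype.ext (Units.inv_mul _)⟩, HomUnits.ext_unit (Units.ext rfl) hx.symm⟩

theorem HomUnits.degree_surjective (hpic : PicardSurjective 𝒜) :
    Function.Surjective (HomUnits.degree (𝒜 := 𝒜)) := by
  intro ε
  rcases Z2.cases ε with rfl | h
  · exact ⟨1, map_one _⟩
  · obtain ⟨z, hz⟩ := hpic.exists_odd_unit
    exact ⟨HomUnits.mk z ε (by rw [h]; exact hz), rfl⟩

theorem HomUnits.toAut_surjective (hcs : IsCentralSimple 𝒜) :
    Function.Surjective (HomUnits.toAut (𝒜 := 𝒜)) := by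
  intro φ
  obtain ⟨ε, z, hz, h⟩ := hcs.exists_unit_of_evenAut φ
  -- From c z = z φ(σ^ε c) one reads φ(σ^ε c) = z⁻¹ c z, so the implementing unit is z⁻¹.
  refine ⟨HomUnits.mk z⁻¹ (Multiplicative.ofAdd ε) (unit_inv_mem hz), Subtype.ext
    (AlgEquiv.ext fun b => ?_)⟩
  change ((z⁻¹ : Aˣ) : A) * twist 𝒜 ε b * ((z⁻¹⁻¹ : Aˣ) : A) = φ.1 b
  rw [inv_inv, mul_assoc, h, twist_twist, Units.inv_mul_cancel_left]

theorem HomUnits.contMDiff_ofEven :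
    ContMDiff 𝓘(ℝ, EvenPart 𝒜) 𝓘(ℝ, EvenPart 𝒜) ∞ (HomUnits.ofEven (𝒜 := 𝒜)) :=
  HomUnits.contMDiff_of_toReal ((evenInclReal 𝒜).contDiff.contMDiff.comp Units.contMDiff_val)

theorem HomUnits.contMDiff_ofScalar :
    ContMDiff 𝓘(ℝ, k) 𝓘(ℝ, EvenPart 𝒜) ∞ (HomUnits.ofScalar (𝒜 := 𝒜)) := by
  refine HomUnits.contMDiff_of_toReal ?_
  have h1 : ContDiff k ∞ fun c : k => c • (1 : RealForm k A) := contDiff_id.smul contDiff_const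
  have h2 : ContMDiff 𝓘(ℝ, k) 𝓘(ℝ, k) ∞ fun c : kˣ => ((c⁻¹ : kˣ) : k) :=
    Units.contMDiff_val.comp (contMDiff_inv 𝓘(ℝ, k) ∞)
  refine ((h1.restrict_scalars ℝ).contMDiff.comp h2).congr fun c => ?_
  exact Algebra.algebraMap_eq_smul_one (A := A) _

theorem HomUnits.isEmbedding_ofEven : Topology.IsEmbedding (HomUnits.ofEven (𝒜 := 𝒜)) := by
  have h1 : Topology.IsEmbedding (Units.val : (EvenPart 𝒜)ˣ → EvenPart 𝒜) :=
    Units.isOpenEmbedding_val.isEmbedding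
  have h2 : Topology.IsEmbedding (fun a : EvenPart 𝒜 => (a.1 : A)) :=
    Topology.IsEmbedding.subtypeVal
  exact Topology.IsEmbedding.of_comp HomUnits.contMDiff_ofEven.continuous
    HomUnits.isEmbedding_val.continuous (h2.comp h1)

theorem HomUnits.isEmbedding_ofScalar : Topology.IsEmbedding (HomUnits.ofScalar (𝒜 := 𝒜)) := by
  refine Topology.IsEmbedding.of_comp HomUnits.contMDiff_ofScalar.continuous
    HomUnits.isEmbedding_val.continuous ?_
  have h1 : Topology.IsEmbedding (Algebra.linearMap k A) :=
    (LinearMap.isClosedEmbedding_of_injective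
      (LinearMap.ker_eq_bot.2 (algebraMap k A).injective)).isEmbedding
  have h2 : Topology.IsEmbedding (Units.val : kˣ → k) := Units.isOpenEmbedding_val.isEmbedding
  exact (h1.comp h2).comp (Homeomorph.inv kˣ).isEmbedding

/-- Skolem–Noether with y = 1 depends linearly on φ and gives 1 at φ = id. On the open set where its
value is invertible, the inverse is an even unit implementing φ, and inversion is smooth. -/
theorem HomUnits.exists_section_one (hcs : IsCentralSimple 𝒜) :
    ∃ O : Set (EvenAut 𝒜), IsOpen O ∧ (1 : EvenAut 𝒜) ∈ O ∧ ∃ σ : EvenAut 𝒜 → HomUnits 𝒜,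
      ContMDiffOn 𝓘(ℝ, EvenDer 𝒜) 𝓘(ℝ, EvenPart 𝒜) ∞ σ O ∧ ∀ φ ∈ O, (σ φ).toAut = φ := by
  classical
  obtain ⟨U, hU1, hU2, hU3, -⟩ := hcs.exists_intertwining
  let V : (A →L[k] A) →L[k] RealForm k A := LinearMap.toContinuousLinearMap (U.flip 1)
  have hV : ContMDiff 𝓘(ℝ, EvenDer 𝒜) 𝓘(ℝ, RealForm k A) ∞
      fun φ : EvenAut 𝒜 => V φ.toCLM :=
    (V.contDiff.restrict_scalars ℝ).contMDiff.comp (EvenAut.contMDiff_toCLM 𝒜)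
  let O : Set (EvenAut 𝒜) := {φ | IsUnit (V φ.toCLM)}
  have h1 : (1 : A) ∈ 𝒜 0 := SetLike.GradedOne.one_mem
  have hmem : ∀ φ ∈ O, ∃ x : HomUnits 𝒜, x.toReal = Ring.inverse (V φ.toCLM) ∧ x.toAut = φ := by
    rintro φ ⟨z, hz⟩
    let z' : Aˣ := z
    have hz' : (z' : A) = U φ.toCLM 1 := hz
    have hzm : (z' : A) ∈ 𝒜 0 := by rw [hz']; exact hU2 φ 0 1 h1
    refine ⟨HomUnits.mk z'⁻¹ 1 (unit_inv_mem hzm), ?_, Subtype.ext (AlgEquiv.ext fun b => ?_)⟩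
    · rw [← hz, Ring.inverse_unit]; rfl
    · change ((z'⁻¹ : Aˣ) : A) * twist 𝒜 0 b * ((z'⁻¹⁻¹ : Aˣ) : A) = φ.1 b
      have := hU3 φ 0 1 h1 b
      rw [← hz', twist_zero] at this
      rw [inv_inv, mul_assoc, twist_zero]
      change _ * (b * _) = _
      rw [this, Units.inv_mul_cancel_left]; rfl
  choose! σ hσ hσ' using hmem
  refine ⟨O, Units.isOpen.preimage hV.continuous, ?_, σ, ?_, hσ'⟩
  · change IsUnit (U (EvenAut.toCLM 1) 1)
    rw [show EvenAut.toCLM (1 : EvenAut 𝒜) = 1 from map_one _, hU1]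
    exact isUnit_one
  · refine HomUnits.contMDiffOn_of_toReal (ContMDiffOn.congr ?_ hσ)
    rintro φ ⟨z, hz⟩
    have h3 : ContDiffAt ℝ ∞ (Ring.inverse : RealForm k A → RealForm k A) (V φ.toCLM) := by
      rw [← hz]; exact contDiffAt_ringInverse ℝ z
    exact (h3.contMDiffAt.comp φ (hV φ)).contMDiffWithinAt

/-- A functional with f(1) = 1 recovers c⁻¹ from the unit attached to c, so 1/f is a retraction
where f does not vanish. -/
theorem HomUnits.exists_retraction_scalar : ∃ (O : Set (HomUnits 𝒜)) (r : HomUnits 𝒜 → kˣ),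
    (∀ c, HomUnits.ofScalar c ∈ O) ∧ ContMDiffOn 𝓘(ℝ, EvenPart 𝒜) 𝓘(ℝ, k) ∞ r O ∧
      ∀ c, r (HomUnits.ofScalar c) = c := by
  classical
  obtain ⟨f, hf, -⟩ := exists_even_functional (k := k) (𝒜 := 𝒜)
  let F : RealForm k A →L[k] k := LinearMap.toContinuousLinearMap f
  have hFs : ∀ c : kˣ, F (HomUnits.ofScalar (𝒜 := 𝒜) c).toReal = ((c⁻¹ : kˣ) : k) := fun c => by
    change f (algebraMap k A _) = _
    rw [Algebra.algebraMap_eq_smul_one, map_smul, hf, smul_eq_mul, mul_one]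
  have hF : ContMDiff 𝓘(ℝ, EvenPart 𝒜) 𝓘(ℝ, k) ∞ fun x : HomUnits 𝒜 => F x.toReal :=
    (F.contDiff.restrict_scalars ℝ).contMDiff.comp (HomUnits.contMDiff_toReal 𝒜)
  -- The value 1 where f vanishes is arbitrary; those points lie outside the domain of smoothness.
  let r : HomUnits 𝒜 → kˣ := fun x => if h : F x.toReal = 0 then 1 else (Units.mk0 _ h)⁻¹
  have hr : ∀ x, F x.toReal ≠ 0 → (r x : k) = (F x.toReal)⁻¹ := fun x hx => by
    simp [r, hx]
  refine ⟨{x | F x.toReal ≠ 0}, r, fun c => ?_, ?_, fun c => ?_⟩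
  · change F _ ≠ 0
    rw [hFs]; exact Units.ne_zero _
  · refine contMDiffOn_units_of_val (ContMDiffOn.congr (fun x hx => ?_) hr)
    exact ((contDiffAt_inv ℝ hx).contMDiffAt.comp x (hF x)).contMDiffWithinAt
  · refine Units.ext ?_
    rw [hr _ (by rw [hFs]; exact Units.ne_zero _), hFs]
    simp

/-- The domain is the kernel of the degree itself, which is open; there the retraction is the
restriction of the linear projection onto A_0, hence smooth. -/
theorem HomUnits.exists_retraction_even : ∃ (O : Set (HomUnits 𝒜)) (r : HomUnits 𝒜 → (EvenPart 𝒜)ˣ),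
    (∀ x : HomUnits 𝒜, x.degree = 1 → x ∈ O) ∧
      ContMDiffOn 𝓘(ℝ, EvenPart 𝒜) 𝓘(ℝ, EvenPart 𝒜) ∞ r O ∧
      ∀ a, r (HomUnits.ofEven a) = a := by
  have h : ∀ x : HomUnits 𝒜, x.degree = 1 → ∃ a, HomUnits.ofEven a = x :=
    fun x => HomUnits.exists_ofEven
  choose! r hr using h
  have hval : ∀ x : HomUnits 𝒜, x.degree = 1 → (r x : EvenPart 𝒜) = evenProjReal 𝒜 x.toReal := by
    intro x hx
    conv_rhs => rw [← hr x hx]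
    exact (evenProj_of_mem 𝒜 (r x).1.2).symm
  refine ⟨{x | x.degree = 1}, r, fun x hx => hx, ?_, fun a => ?_⟩
  · refine contMDiffOn_units_of_val (ContMDiffOn.congr ?_ hval)
    exact ((evenProjReal 𝒜).contDiff.contMDiff.comp (HomUnits.contMDiff_toReal 𝒜)).contMDiffOn
  · exact HomUnits.isEmbedding_ofEven.injective (hr _ rfl)

theorem hasSmoothLifts_toAut (hcs : IsCentralSimple 𝒜) :
    HasSmoothLifts (N := unitsLieGrp k) (K := homUnitsLieGrp 𝒜) (Q := autLieGrp 𝒜)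
      HomUnits.ofScalar HomUnits.toAut where
  exists_section := exists_section_of_one (K := homUnitsLieGrp 𝒜) (Q := autLieGrp 𝒜)
    (HomUnits.toAut_surjective hcs) (HomUnits.exists_section_one hcs)
  exists_retraction := by
    obtain ⟨O, r, h1, h2, h3⟩ := HomUnits.exists_retraction_scalar (𝒜 := 𝒜)
    refine ⟨O, r, fun x hx => ?_, h2, h3⟩
    obtain ⟨c, hc⟩ := HomUnits.exists_ofScalar hcs hx
    exact hc ▸ h1 c

theorem hasSmoothLifts_degree (hpic : PicardSurjective 𝒜) :
    HasSmoothLifts (N := evenUnitsLieGrp 𝒜) (K := homUnitsLieGrp 𝒜) (Q := z2LieGrp)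
      HomUnits.ofEven HomUnits.degree where
  exists_section := exists_section_of_one (K := homUnitsLieGrp 𝒜) (Q := z2LieGrp)
    -- The target is discrete, so a constant section on the singleton {1} is enough.
    (HomUnits.degree_surjective hpic) ⟨{1}, isOpen_discrete (α := Z2) _, rfl, fun _ => 1,
      contMDiffOn_const, by rintro _ rfl; rfl⟩
  exists_retraction := HomUnits.exists_retraction_even

theorem isShortExact_ofEven (hpic : PicardSurjective 𝒜) :
    IsShortExact (N := evenUnitsLieGrp 𝒜) (K := homUnitsLieGrp 𝒜) (Q := z2LieGrp)
      HomUnits.ofEven HomUnits.degree where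
  smooth_i := HomUnits.contMDiff_ofEven
  smooth_p := HomUnits.contMDiff_degree
  closedEmbedding := by
    refine ⟨HomUnits.isEmbedding_ofEven, ?_⟩
    have h : range (HomUnits.ofEven (𝒜 := 𝒜)) = {x | x.degree = 1} := by
      ext x
      exact ⟨fun ⟨a, ha⟩ => ha ▸ rfl, HomUnits.exists_ofEven⟩
    have h' := HomUnits.isClosed_degree_eq_one (𝒜 := 𝒜)
    rw [← h] at h'
    exact h'
  range_eq_ker := by
    ext x
    exact ⟨fun ⟨a, ha⟩ => ha ▸ rfl, HomUnits.exists_ofEven⟩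
  surjective := HomUnits.degree_surjective hpic
  submersion := surjective_mfderiv_of_section (K := homUnitsLieGrp 𝒜) (Q := z2LieGrp)
    HomUnits.contMDiff_degree (hasSmoothLifts_degree hpic).exists_section

theorem isShortExact_ofScalar (hcs : IsCentralSimple 𝒜) :
    IsShortExact (N := unitsLieGrp k) (K := homUnitsLieGrp 𝒜) (Q := autLieGrp 𝒜)
      HomUnits.ofScalar HomUnits.toAut where
  smooth_i := by
    have h := HomUnits.contMDiff_ofScalar (𝒜 := 𝒜)
    exact h
  smooth_p := HomUnits.contMDiff_toAut
  closedEmbedding := by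
    refine ⟨HomUnits.isEmbedding_ofScalar, ?_⟩
    have h : range (HomUnits.ofScalar (𝒜 := 𝒜)) = {x | x.toAut = 1} := by
      ext x
      exact ⟨fun ⟨c, hc⟩ => hc ▸ HomUnits.toAut_ofScalar c, HomUnits.exists_ofScalar hcs⟩
    have h' : IsClosed {x : HomUnits 𝒜 | x.toAut = 1} :=
      isClosed_eq HomUnits.contMDiff_toAut.continuous continuous_const
    rw [← h] at h'
    exact h'
  range_eq_ker := by
    ext x
    exact ⟨fun ⟨c, hc⟩ => hc ▸ HomUnits.toAut_ofScalar c, HomUnits.exists_ofScalar hcs⟩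
  surjective := HomUnits.toAut_surjective hcs
  submersion := surjective_mfderiv_of_section (K := homUnitsLieGrp 𝒜) (Q := autLieGrp 𝒜)
    HomUnits.contMDiff_toAut (hasSmoothLifts_toAut hcs).exists_section

/-- The weak equivalence between `AUT(A)` and `Bkˣ × (ℤ/2)_dis`. -/
def canonicalButterfly (hcs : IsCentralSimple 𝒜) (hpic : PicardSurjective 𝒜) :
    InvertibleButterfly.{u, u, u, v, 0} (AUT 𝒜) (unitsZ2 k) where
  K := homUnitsLieGrp 𝒜
  i₁ := HomUnits.ofEven
  i₂ := HomUnits.ofScalar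
  p₁ := HomUnits.toAut
  p₂ := HomUnits.degree
  p₁_i₁ := HomUnits.toAut_ofEven
  p₂_i₂ _ := rfl
  exact₁₂ := isShortExact_ofEven hpic
  exact₂₁ := isShortExact_ofScalar hcs
  conj₁ := HomUnits.ofEven_evalAct
  conj₂ := HomUnits.ofScalar_eq_conj

/-- A homogeneous unit acts on `A` by right multiplication with its inverse. -/
def HomUnits.toLinear : HomUnits 𝒜 →* (A ≃ₗ[k] A) where
  toFun x :=
    { LinearMap.mulRight k ((x.unit⁻¹ : Aˣ) : A) with
      invFun := fun y => y * x.unit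
      left_inv := fun y => Units.inv_mul_cancel_right y x.unit
      right_inv := fun y => Units.mul_inv_cancel_right y x.unit }
  map_one' := LinearEquiv.ext fun y => by
    change y * (((1 : HomUnits 𝒜).unit⁻¹ : Aˣ) : A) = y
    simp
  map_mul' x y := LinearEquiv.ext fun z => by
    change z * (((x * y).unit⁻¹ : Aˣ) : A) = z * ((y.unit⁻¹ : Aˣ) : A) * ((x.unit⁻¹ : Aˣ) : A)
    simp [mul_assoc]

theorem HomUnits.toLinear_apply (x : HomUnits 𝒜) (y : A) :
    x.toLinear y = y * ((x.unit⁻¹ : Aˣ) : A) := rfl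

theorem HomUnits.isParityIntertwiner (x : HomUnits 𝒜) :
    IsParityIntertwiner 𝒜 x.degree x.toAut x.toLinear where
  even i y hy := by
    have := SetLike.mul_mem_graded hy (unit_inv_mem x.unit_mem)
    rw [add_assoc, CharTwo.add_self_eq_zero, add_zero] at this
    exact this
  left a y := by simp only [HomUnits.toLinear_apply, mul_assoc]
  right j b hb y := by
    rw [HomUnits.toLinear_apply, HomUnits.toLinear_apply, HomUnits.toAut_apply,
      twist_of_mem 𝒜 _ hb]
    simp [mul_assoc]

/-- With z = F(1), left linearity gives F(y) = yz, evenness gives |z| = ε, and right linearity at 1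
gives σ^ε(b) z = z φ(b). So z⁻¹ is the only homogeneous unit that can induce the triple, and it
does. -/
theorem HomUnits.existsUnique_of_intertwiner {ε : Z2} {φ : EvenAut 𝒜} {F : A ≃ₗ[k] A}
    (h : IsParityIntertwiner 𝒜 ε φ F) :
    ∃! x : HomUnits 𝒜, x.degree = ε ∧ x.toAut = φ ∧ x.toLinear = F := by
  have hF : ∀ y, F y = y * F 1 := fun y => by rw [← h.left, mul_one]
  have h1 : F.symm 1 * F 1 = 1 := by rw [← hF, F.apply_symm_apply]
  have h2 : F 1 * F.symm 1 = 1 := F.injective (by rw [hF, mul_assoc, h1, mul_one])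
  let z : Aˣ := ⟨F 1, F.symm 1, h2, h1⟩
  have hz : (z : A) ∈ 𝒜 ε.val := h.even _ 1 (by
    rw [CharTwo.add_self_eq_zero]; exact SetLike.GradedOne.one_mem)
  have hφ : ∀ b, twist 𝒜 ε.val b * z = z * φ.1 b := by
    have hom : ∀ j, ∀ b ∈ 𝒜 j, twist 𝒜 ε.val b * z = z * φ.1 b := fun j b hb => by
      rw [twist_of_mem 𝒜 _ hb]
      have := h.right j b hb 1
      rwa [one_mul, hF] at this
    intro b
    obtain ⟨x, hx, y, hy, rfl⟩ := exists_even_add_odd 𝒜 b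
    rw [map_add, map_add, add_mul, mul_add, hom 0 x hx, hom 1 y hy]
  refine ⟨HomUnits.mk z⁻¹ ε (unit_inv_mem hz), ⟨rfl, Subtype.ext (AlgEquiv.ext fun b => ?_),
    LinearEquiv.ext fun y => ?_⟩, ?_⟩
  · change ((z⁻¹ : Aˣ) : A) * twist 𝒜 ε.val b * ((z⁻¹⁻¹ : Aˣ) : A) = φ.1 b
    rw [inv_inv, mul_assoc, hφ, Units.inv_mul_cancel_left]
  · change y * ((z⁻¹⁻¹ : Aˣ) : A) = F y
    rw [inv_inv, hF y]
  · rintro x ⟨hx1, -, hx3⟩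
    refine HomUnits.ext_unit (inv_injective (Units.ext ?_)) hx1
    have := congrArg (fun L : A ≃ₗ[k] A => L 1) hx3
    simp only [HomUnits.toLinear_apply, one_mul] at this
    rw [this]
    change F 1 = ((z⁻¹⁻¹ : Aˣ) : A)
    rw [inv_inv]

theorem isCanonical_canonicalButterfly (hcs : IsCentralSimple 𝒜) (hpic : PicardSurjective 𝒜) :
    IsCanonical (canonicalButterfly hcs hpic) := by
  refine ⟨HomUnits.toLinear, HomUnits.isParityIntertwiner,
    fun ε φ F h => HomUnits.existsUnique_of_intertwiner h, fun a y => rfl, fun c y => ?_, ?_⟩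
  · change y * (((Units.map (algebraMap k A).toMonoidHom c⁻¹)⁻¹ : Aˣ) : A) = (c : k) • y
    rw [← map_inv, inv_inv]
    change y * algebraMap k A (c : k) = _
    rw [← Algebra.commutes, Algebra.smul_def]
  · have hinv : ∀ x : HomUnits 𝒜, LinearMap.toContinuousLinearMap (x.toLinear).toLinearMap =
        (ContinuousLinearMap.mul k A).flip (x⁻¹).val := fun x =>
      ContinuousLinearMap.ext fun y => by
        change y * ((x.unit⁻¹ : Aˣ) : A) = y * ((x⁻¹).unit : Aˣ)
        rw [map_inv]
    have hcv : Continuous fun x : HomUnits 𝒜 => (x⁻¹).val :=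
      HomUnits.isEmbedding_val.continuous.comp (contMDiff_inv 𝓘(ℝ, EvenPart 𝒜) ∞).continuous
    have hc : Continuous fun x : HomUnits 𝒜 =>
        LinearMap.toContinuousLinearMap (x.toLinear).toLinearMap := by
      simp only [hinv]
      exact (ContinuousLinearMap.mul k A).flip.continuous.comp hcv
    have hcont : Continuous fun x : HomUnits 𝒜 => (x.toAut, x.degree,
        LinearMap.toContinuousLinearMap (x.toLinear).toLinearMap) :=
      HomUnits.contMDiff_toAut.continuous.prodMk
        (HomUnits.contMDiff_degree.continuous.prodMk hc)
    have : IsTopologicalGroup (HomUnits 𝒜) := topologicalGroup_of_lieGroup 𝓘(ℝ, EvenPart 𝒜) ∞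
    have he : Topology.IsEmbedding fun x : HomUnits 𝒜 => (x⁻¹).val :=
      HomUnits.isEmbedding_val.comp (Homeomorph.inv (HomUnits 𝒜)).isEmbedding
    -- Evaluating the third component at 1 returns x⁻¹ in A, which already is an embedding; hence so
    -- is the continuous map to the triple.
    refine Topology.IsEmbedding.of_comp (g := fun p : EvenAut 𝒜 × Z2 × (A →L[k] A) => p.2.2 1)
      hcont ?_ ?_
    · exact (ContinuousLinearMap.apply k A (1 : A)).continuous.comp
        (continuous_snd.comp continuous_snd)
    · have hg : (fun x : HomUnits 𝒜 => x.toLinear (1 : A)) = fun x => (x⁻¹).val :=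
        funext fun x => by
          rw [HomUnits.toLinear_apply, one_mul]
          change _ = (((x⁻¹).unit : Aˣ) : A)
          rw [map_inv]
      rw [← hg] at he
      exact he

end Butterfly

end SuperAUT

end

theorem mainTheorem10 {k : Type v} [RCLike k] {A : Type u} [NormedRing A]
    [NormedAlgebra k A] [FiniteDimensional k A] (𝒜 : ZMod 2 → Submodule k A) [GradedAlgebra 𝒜]
    (hcs : IsCentralSimple 𝒜) (hpic : PicardSurjective 𝒜) :
    ∃ B : InvertibleButterfly.{u, u, u, v, 0} (AUT 𝒜) (unitsZ2 k), IsCanonical B ∧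
      ∀ (E : Type w₁) [NormedAddCommGroup E] [NormedSpace ℝ E] [FiniteDimensional ℝ E]
        (X : Type w₂) [TopologicalSpace X] [ChartedSpace E X] [IsManifold 𝓘(ℝ, E) ∞ X]
        [T2Space X] [SecondCountableTopology X],
        ∃ Φ : CechH1 E X (AUT 𝒜) ≃ CechAb E PUnit.{1} Z2 X 0 × CechAb E k kˣ X 1,
          ∀ (𝒰 : OpenCover X) (c : Cocycle E 𝒰 (AUT 𝒜)) (d : Cocycle E 𝒰 (unitsZ2 k))
            (ε : AbCocycle E PUnit.{1} Z2 𝒰 1) (x : AbCocycle E k kˣ 𝒰 2),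
            B.Relates c d →
            (∀ s, ∀ y ∈ 𝒰.inter s, ε.val s y = d.g (s 0) (s 1) y) →
            (∀ s, ∀ y ∈ 𝒰.inter s, x.val s y = d.a (s 0) (s 1) (s 2) y) →
            Φ (CechH1.mk E c) = (CechAb.mk E ε, CechAb.mk E x) := by
  have : Nontrivial A := hcs.nontrivial
  refine ⟨canonicalButterfly hcs hpic, isCanonical_canonicalButterfly hcs hpic,
    fun E _ _ _ X _ _ _ _ _ => ?_⟩
  -- Finite dimension gives local compactness, and with the Hausdorff and second countability
  -- assumptions this yields the paracompactness needed for lifting.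
  have : LocallyCompactSpace X := Manifold.locallyCompact_of_finiteDimensional 𝓘(ℝ, E)
  have : ParacompactSpace X := inferInstance
  have H : HasSmoothLifts (canonicalButterfly hcs hpic).i₂ (canonicalButterfly hcs hpic).p₁ :=
    hasSmoothLifts_toAut hcs
  have H' : HasSmoothLifts (canonicalButterfly hcs hpic).i₁ (canonicalButterfly hcs hpic).p₂ :=
    hasSmoothLifts_degree hpic
  refine ⟨((canonicalButterfly hcs hpic).cohomologyEquiv E X H H').trans (splitEquiv E X k),
    fun 𝒰 c d ε x h hε hx => ?_⟩
  have h1 : (canonicalButterfly hcs hpic).cohomologyEquiv E X H H' (CechH1.mk E c) =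
      CechH1.mk E d := InvertibleButterfly.cohomologyMap_mk H h.weaklyRelates
  rw [Equiv.trans_apply, h1]
  exact splitEquiv_mk hε hx
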